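/- **Theorem 2.1 (Global regularity).** Let $\Gamma$ be a subgroup of finite index of $\mathrm{SL}_2(\mathbb{Z})$, let $r>0$ be real, and let $f\neq 0$ be a modular form of weight $r$ for $\Gamma$ with unimodular multipliers $\mu_\gamma$; that is, $f$ is holomorphic on the upper half-plane $\mathbb{H}$, $f(\gamma z)=\mu_\gamma(cz+d)^r f(z)$ for every $\gamma=\begin{pmatrix}a&b\\c&d\end{pmatrix}\in\Gamma$ (with $|\mu_\gamma|=1$ and the branch $-\pi<\arg\le\pi$), and $f$ has at most polynomial growth as $\operatorname{Im} z\to0^+$. For a cusp $\mathfrak a=\gamma(\infty)$, $\gamma\in\mathrm{SL}_2(\mathbb{Z})$, put $f|_\gamma(z)=f(\gamma z)/(cz+d)^{r}$, let $m_{\mathfrak a}$ be the width of $\mathfrak a$ (the least $m\ge1$ with $\pm\gamma\begin{pmatrix}1&m\\0&1\end{pmatrix}\gamma^{-1}\in\Gamma$ for some choice of sign), let $\kappa_{\mathfrak a}\in[0,1)$ be the number with $f|_\gamma(z+m_{\mathfrak a})=e^{2\pi i\kappa_{\mathfrak a}}f|_\gamma(z)$, and let $a_n^{\mathfrak a}$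 be the coefficients of the Fourier expansion $f|_\gamma(m_{\mathfrak a}z)=\sum_{n\ge0}a_n^{\mathfrak a}e^{2\pi i(n+\kappa_{\mathfrak a})z}$. Assume $\kappa_{\mathfrak a}\in\mathbb{Q}$ for every cusp $\mathfrak a$. The form $f$ is a cusp form if at every cusp $\kappa_{\mathfrak a}>0$ or $a_0^{\mathfrak a}=0$. Put $\alpha_0=r/2$ if $f$ is a cusp form and $\alpha_0=r$ otherwise. Write $m,\kappa,a_n$ for the data at $\infty$ (with $\gamma$ the identity) and, for $\alpha>0$, consider the series $$f_\alpha(mx)=\sum_{n+\kappa>0}\frac{a_n}{(n+\kappa)^\alpha}e^{2\pi i(n+\kappa)x}\qquad(x\in\mathbb{R}).\tag{1}$$ For an integer $k\ge0$, $0\le s\le1$ and an open set $\Omega\subset\mathbb{R}$, let $\mathcal C^{k,s}(\Omega)$ be the set of continuous functions $g$ on $\Omega$ such that $g^{(k)}$ exists in $\Omega$ and, on every compact $K\subset\Omega$, is continuous and satisfies $|g^{(k)}(x)-g^{(k)}(y)|\le C_K|x-y|^s$. The class $\mathcal C^{k,s}_{\log}(\Omega)$ is defined in the same way with the bound $C_K|x-y|^s\,\bigl|\log|x-y|\bigr|$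 for $x,y\in K$, $0<|x-y|\le\frac12$. Let $[t]$ and $\{t\}$ be the integer and fractional parts of $t$. Let $\alpha>0$. Then: 1. If $\alpha\le\alpha_0$, the series (1) defining $f_\alpha$ diverges (its partial sums have no limit in $\mathbb{C}$) on a dense set of real points. 2. If $\alpha>\alpha_0$, the series (1) converges uniformly on $\mathbb{R}$ to a continuous function $f_\alpha$. Moreover $f_\alpha\in\mathcal C^{[\alpha-\alpha_0],\{\alpha-\alpha_0\}}(\mathbb{R})$ if $\alpha-\alpha_0\notin\mathbb{Z}$, and $f_\alpha\in\mathcal C^{\alpha-\alpha_0-1,\,1}_{\log}(\mathbb{R})$ if $\alpha-\alpha_0\in\mathbb{Z}$. 3. If $0<\alpha-\alpha_0\le1$, then $f_\alpha\notin\mathcal C^{1,0}(I)$ for every nonempty open interval $I$, and the same is true of $\operatorname{Re}f_\alpha$ and $\operatorname{Im}f_\alpha$. -/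

import Mathlib

open UpperHalfPlane Filter Topology MatrixGroups Manifold

noncomputable section

namespace FracInt

/-! ### Modular forms of real weight with a multiplier system -/

/-- `f` is a modular form of real weight `r` for the subgroup `Γ` of `SL(2, ℤ)` with (unimodular)
multipliers `μ`: it is holomorphic on the upper half-plane, satisfies
`f (γ z) = μ_γ (c z + d) ^ r f z` (principal branch, `-π < arg ≤ π`) for all `γ ∈ Γ`, and has at
most polynomial growth as `Im z → 0⁺`. -/
structure IsModularForm (Γ : Subgroup SL(2, ℤ)) (r : ℝ) (μ : Γ → Circle) (f : ℍ → ℂ) : Prop where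
  holo : MDifferentiable 𝓘(ℂ) 𝓘(ℂ) f
  transform : ∀ (γ : Γ) (z : ℍ),
    f ((γ : SL(2, ℤ)) • z) =
      (μ γ : ℂ) * (((γ : SL(2, ℤ)) 1 0 : ℂ) * (z : ℂ) + ((γ : SL(2, ℤ)) 1 1 : ℂ)) ^ (r : ℂ) * f z
  growth : ∃ C A δ : ℝ, 0 < δ ∧ ∀ z : ℍ, z.im < δ → ‖f z‖ ≤ C * z.im ^ (-A)

/-- The slash operator of weight `r`: `f|_γ (z) = f (γ z) / (c z + d) ^ r`. -/
def slash (r : ℝ) (f : ℍ → ℂ) (γ : SL(2, ℤ)) (z : ℍ) : ℂ :=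
  f (γ • z) / ((γ 1 0 : ℂ) * (z : ℂ) + (γ 1 1 : ℂ)) ^ (r : ℂ)

/-- The width of the cusp `γ(∞)` for `Γ`: the index of the stabilizer of that cusp in `Γ` in its
stabilizer in `SL(2, ℤ)`, both modulo `±1`. The latter stabilizer is `{±γ T ^ n γ⁻¹}`, so this is
the smallest `m ≥ 1` such that `γ T ^ m γ⁻¹` or its negative lies in `Γ`. -/
def width (Γ : Subgroup SL(2, ℤ)) (γ : SL(2, ℤ)) : ℕ :=
  sInf {m : ℕ | 0 < m ∧
    (γ * ModularGroup.T ^ m * γ⁻¹ ∈ Γ ∨ -(γ * ModularGroup.T ^ m * γ⁻¹) ∈ Γ)}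

/-- The cusp parameter of `g` with respect to the translation by `m`: the number `κ ∈ [0, 1)` with
`g (z + m) = e^{2πiκ} g z` for all `z` (it is unique when `g ≠ 0`). -/
def cuspParam (g : ℍ → ℂ) (m : ℕ) : ℝ :=
  sInf {κ : ℝ | 0 ≤ κ ∧ κ < 1 ∧
    ∀ z : ℍ, g ((m : ℝ) +ᵥ z) = Complex.exp (2 * Real.pi * Complex.I * κ) * g z}

/-- The `n`-th Fourier coefficient `a_n` in the expansion
`g (m z) = ∑_{n ≥ 0} a_n e^{2πi(n + κ)z}`, computed on the horizontal line `Im (m z) = 1`. -/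
def cuspCoeff (g : ℍ → ℂ) (m : ℕ) (κ : ℝ) (n : ℕ) : ℂ :=
  (1 / (m : ℂ)) * ∫ x in (0 : ℝ)..(m : ℝ),
    g (x +ᵥ UpperHalfPlane.I) *
      Complex.exp (-(2 * Real.pi * Complex.I * (n + κ) * ((x + Complex.I) / m)))

/-- `f` is cuspidal at the cusp `γ(∞)`: either the cusp parameter is positive or the coefficient
`a_0` of the Fourier expansion at that cusp is zero. (Passing to a scaling matrix multiplies the
coefficients by the nonzero constant `m ^ (r / 2)`, which is irrelevant here.) -/
def IsCuspidalAt (Γ : Subgroup SL(2, ℤ)) (r : ℝ) (f : ℍ → ℂ) (γ : SL(2, ℤ)) : Prop :=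
  0 < cuspParam (slash r f γ) (width Γ γ) ∨
    cuspCoeff (slash r f γ) (width Γ γ) (cuspParam (slash r f γ) (width Γ γ)) 0 = 0

/-- `f` is a cusp form: it is cuspidal at every cusp. Every element of `ℚ ∪ {∞}` is of the form
`γ(∞)` with `γ ∈ SL(2, ℤ)`. -/
def IsCuspForm (Γ : Subgroup SL(2, ℤ)) (r : ℝ) (f : ℍ → ℂ) : Prop :=
  ∀ γ : SL(2, ℤ), IsCuspidalAt Γ r f γ

open Classical in
/-- The critical exponent `α₀`: it is `r / 2` for cusp forms and `r` otherwise. -/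
def alphaZero (Γ : Subgroup SL(2, ℤ)) (r : ℝ) (f : ℍ → ℂ) : ℝ :=
  if IsCuspForm Γ r f then r / 2 else r

/-! ### The fractional integral -/

/-- The `n`-th term, at the point `x`, of the series defining the `α`-fractional integral
`f_α (m x) = ∑_{n + κ > 0} a_n / (n + κ) ^ α * e^{2πi(n + κ)x}`, where `m`, `κ` and `a_n` are the
width, the parameter and the Fourier coefficients of `f` at the cusp `∞`. -/
def fracTerm (Γ : Subgroup SL(2, ℤ)) (f : ℍ → ℂ) (α : ℝ) (n : ℕ) (x : ℝ) : ℂ :=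
  let m : ℕ := width Γ 1
  let κ : ℝ := cuspParam f m
  if 0 < (n : ℝ) + κ then
    cuspCoeff f m κ n / ((((n : ℝ) + κ) ^ α : ℝ) : ℂ) *
      Complex.exp (2 * Real.pi * Complex.I * (n + κ) * (x / m))
  else 0

/-- Partial sums of the series defining `f_α`. -/
def fracSum (Γ : Subgroup SL(2, ℤ)) (f : ℍ → ℂ) (α : ℝ) (N : ℕ) (x : ℝ) : ℂ :=
  ∑ n ∈ Finset.range N, fracTerm Γ f α n x

/-- The `α`-fractional integral `f_α`, the pointwise limit of the partial sums of its series. -/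
def fracInt (Γ : Subgroup SL(2, ℤ)) (f : ℍ → ℂ) (α : ℝ) (x : ℝ) : ℂ :=
  limUnder atTop fun N : ℕ => fracSum Γ f α N x

/-! ### Regularity classes -/

variable {E : Type*} [NormedAddCommGroup E] [NormedSpace ℝ E]

/-- The class `Λ^s(K)`: continuous functions with a uniform `s`-Hölder condition on `K`. -/
def MemHolder (s : ℝ) (g : ℝ → E) (K : Set ℝ) : Prop :=
  ContinuousOn g K ∧ ∃ C : ℝ, ∀ x ∈ K, ∀ y ∈ K, ‖g x - g y‖ ≤ C * |x - y| ^ s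

/-- The class `Λ^s_log(K)`: the modulus `|x - y| ^ s` is replaced by `|x - y| ^ s log |x - y|`.
The bound concerns small `|x - y|`, since the logarithm vanishes at `|x - y| = 1`. -/
def MemHolderLog (s : ℝ) (g : ℝ → E) (K : Set ℝ) : Prop :=
  ContinuousOn g K ∧ ∃ C : ℝ, ∀ x ∈ K, ∀ y ∈ K, |x - y| ≤ 1 / 2 →
    ‖g x - g y‖ ≤ C * (|x - y| ^ s * |(Real.log |x - y|)|)

/-- The `k`-th derivative of `g` exists at every point of the open set `Ω`. -/
def HasDerivsOn (k : ℕ) (g : ℝ → E) (Ω : Set ℝ) : Prop :=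
  ∀ j < k, ∀ x ∈ Ω, DifferentiableAt ℝ (iteratedDeriv j g) x

/-- The class `C^{k,s}(Ω)` for an open set `Ω`: continuous functions whose `k`-th derivative exists
in `Ω` and belongs to `Λ^s(K)` for every compact `K ⊆ Ω`. -/
def MemCk (k : ℕ) (s : ℝ) (g : ℝ → E) (Ω : Set ℝ) : Prop :=
  ContinuousOn g Ω ∧ HasDerivsOn k g Ω ∧
    ∀ K ⊆ Ω, IsCompact K → MemHolder s (iteratedDeriv k g) K

/-- The class `C^{k,s}_log(Ω)` for an open set `Ω`. -/
def MemCkLog (k : ℕ) (s : ℝ) (g : ℝ → E) (Ω : Set ℝ) : Prop :=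
  ContinuousOn g Ω ∧ HasDerivsOn k g Ω ∧
    ∀ K ⊆ Ω, IsCompact K → MemHolderLog s (iteratedDeriv k g) K

end FracInt

end

/-!
Write `α₀` for the critical exponent and `H = f - c`, where `c` is the constant term of the Fourier
expansion of `f` at `∞`. Up to a factor, `f_α` is the Mellin transform
`x ↦ ∫₀^∞ t ^ (α - 1) H (x + i t) dt` of `H` along vertical half-lines. Modularity yields
`|H (x + i y)| ≪ y ^ (-α₀)` uniformly in `x`, and this single estimate gives the uniform convergence
of the series as well as the Hölder bounds for `f_α` and its derivatives.

Conversely, suppose that the series converges at `x` for some `α ≤ α₀`, or that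
`p f_α + q conj f_α` with `p ≠ 0` is differentiable at `x` for some `α ≤ α₀ + 1`. In the first case
by Abel summation, in the second by averaging against a kernel that annihilates nonpositive
frequencies and turns `f_α` into `y ^ α H (x + i y)`, one finds `y ^ α₀ |f (x + i y)| → 0` as
`y → 0⁺`. For a dense set of `x` this is impossible: if `f` is not a cusp form, the limit is
positive at the translates of a noncuspidal cusp; otherwise `y ^ (r / 2) |f|` is `Γ`-invariant, a
`Γ`-orbit accumulates at every real point, and Baire's theorem applies.
-/

namespace FracInt

open MeasureTheory
open scoped Real

/-- The exponential `e^{2πi(n + κ)z/m}`, the building block of Fourier expansions at a cusp of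
width `m` and parameter `κ`. -/
noncomputable def expMode (m κ : ℝ) (n : ℕ) (z : ℂ) : ℂ :=
  Complex.exp (2 * π * Complex.I * (n + κ) * (z / m))

lemma norm_expMode (m κ : ℝ) (n : ℕ) (z : ℂ) :
    ‖expMode m κ n z‖ = Real.exp (-(2 * π * (n + κ) / m * z.im)) := by
  rw [expMode, Complex.norm_exp]
  congr 1
  have : 2 * (π : ℂ) * Complex.I * (n + κ) * (z / m) =
      ((2 * π * (n + κ) / m : ℝ) : ℂ) * (Complex.I * z) := by
    push_cast; ring
  rw [this, Complex.re_ofReal_mul]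
  simp

lemma expMode_add (m κ : ℝ) (n : ℕ) (z w : ℂ) :
    expMode m κ n (z + w) = expMode m κ n z * expMode m κ n w := by
  rw [expMode, expMode, expMode, ← Complex.exp_add]
  congr 1
  ring

lemma expMode_zero (m κ : ℝ) (n : ℕ) : expMode m κ n 0 = 1 := by
  simp [expMode]

lemma expMode_neg_mul (m κ : ℝ) (n : ℕ) (z : ℂ) :
    expMode m κ n (-z) * expMode m κ n z = 1 := by
  rw [← expMode_add, neg_add_cancel, expMode_zero]

lemma expMode_add_nat (m κ : ℝ) (n k : ℕ) (z : ℂ) :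
    expMode m κ (n + k) z = expMode m κ n z * expMode m 0 1 z ^ k := by
  rw [expMode, expMode, expMode, ← Complex.exp_nat_mul, ← Complex.exp_add]
  congr 1
  push_cast
  ring

lemma expMode_add_period {m : ℝ} (hm : m ≠ 0) (κ : ℝ) (n : ℕ) (z : ℂ) :
    expMode m κ n (z + m) = Complex.exp (2 * π * Complex.I * κ) * expMode m κ n z := by
  have hm' : (m : ℂ) ≠ 0 := by exact_mod_cast hm
  have hn : expMode m κ n m = Complex.exp (2 * π * Complex.I * κ) := by
    rw [expMode, Complex.exp_eq_exp_iff_exists_int]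
    refine ⟨n, ?_⟩
    push_cast
    field_simp
    ring
  rw [expMode_add, hn, mul_comm]

@[fun_prop]
lemma differentiable_expMode (m κ : ℝ) (n : ℕ) : Differentiable ℂ (expMode m κ n) := by
  unfold expMode
  fun_prop

@[fun_prop]
lemma continuous_expMode (m κ : ℝ) (n : ℕ) : Continuous (expMode m κ n) :=
  (differentiable_expMode m κ n).continuous

lemma integral_expMode_mul {m : ℝ} (hm : 0 < m) (κ : ℝ) (n k : ℕ) (w : ℂ) :
    ∫ u in (0 : ℝ)..m, expMode m κ k (u + w) * expMode m κ n (-(u + w)) =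
      if k = n then (m : ℂ) else 0 := by
  split_ifs with h
  · subst h
    have hone (u : ℝ) : expMode m κ k (u + w) * expMode m κ k (-(u + w)) = 1 := by
      rw [mul_comm, expMode_neg_mul]
    simp [hone, -neg_add_rev]
  have hm' : (m : ℂ) ≠ 0 := by exact_mod_cast hm.ne'
  set d : ℂ := 2 * π * Complex.I * ((k : ℂ) - n) / m with hd
  have hd0 : d ≠ 0 := div_ne_zero
    (mul_ne_zero Complex.two_pi_I_ne_zero (sub_ne_zero.mpr (by exact_mod_cast h))) hm'
  have hprod (u : ℝ) : expMode m κ k (u + w) * expMode m κ n (-(u + w)) =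
      Complex.exp (d * w) * Complex.exp (d * u) := by
    rw [expMode, expMode, ← Complex.exp_add, ← Complex.exp_add, hd]
    congr 1
    field_simp
    ring
  have hdm : Complex.exp (d * m) = 1 := by
    rw [Complex.exp_eq_one_iff]
    refine ⟨(k : ℤ) - n, ?_⟩
    rw [hd]
    push_cast
    field_simp
  simp_rw [hprod]
  rw [intervalIntegral.integral_const_mul, integral_exp_mul_complex hd0, hdm]
  simp

lemma norm_le_exp_of_hasSum {m κ δ Y : ℝ} (hm : 0 < m) (hY : 0 < Y) {c : ℕ → ℂ} {H : ℂ → ℂ}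
    (hδ : ∀ n : ℕ, c n ≠ 0 → δ ≤ n + κ)
    (hs : ∀ z : ℂ, 0 < z.im → HasSum (fun n => c n * expMode m κ n z) (H z)) :
    ∃ C : ℝ, 0 < C ∧
      ∀ z : ℂ, Y ≤ z.im → ‖H z‖ ≤ C * Real.exp (-(2 * π * δ / m * z.im)) := by
  set w : ℂ := Y * Complex.I with hw
  have hwi : w.im = Y := by simp [hw]
  have hsum : Summable fun n => ‖c n * expMode m κ n w‖ := (hs w (hwi.symm ▸ hY)).summable.norm
  set S := ∑' n, ‖c n * expMode m κ n w‖
  have hS0 : 0 ≤ S := tsum_nonneg fun n => norm_nonneg _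
  refine ⟨(S + 1) * Real.exp (2 * π * δ / m * Y), by positivity, fun z hz => ?_⟩
  have hterm (n : ℕ) : ‖c n * expMode m κ n z‖ ≤
      ‖c n * expMode m κ n w‖ * Real.exp (-(2 * π * δ / m * (z.im - Y))) := by
    by_cases h0 : c n = 0
    · simp [h0]
    rw [norm_mul, norm_mul, mul_assoc, norm_expMode, norm_expMode, ← Real.exp_add, hwi]
    refine mul_le_mul_of_nonneg_left (Real.exp_le_exp.mpr ?_) (norm_nonneg _)
    have h1 : 2 * π * δ / m ≤ 2 * π * (n + κ) / m := by
      gcongr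
      exact hδ n h0
    nlinarith
  calc ‖H z‖ ≤ S * Real.exp (-(2 * π * δ / m * (z.im - Y))) :=
        (hs z (hY.trans_le hz)).tsum_eq ▸ tsum_of_norm_bounded (hsum.hasSum.mul_right _) hterm
    _ ≤ (S + 1) * Real.exp (-(2 * π * δ / m * (z.im - Y))) := by gcongr; linarith
    _ = (S + 1) * Real.exp (2 * π * δ / m * Y) * Real.exp (-(2 * π * δ / m * z.im)) := by
        rw [mul_assoc (S + 1), ← Real.exp_add]
        ring_nf

lemma exists_pos_forall_le_add {κ : ℝ} (hκ : 0 ≤ κ) :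
    ∃ δ : ℝ, 0 < δ ∧ ∀ n : ℕ, 0 < (n : ℝ) + κ → δ ≤ n + κ := by
  rcases hκ.eq_or_lt with rfl | h
  · refine ⟨1, one_pos, fun n hn => ?_⟩
    rw [add_zero] at hn ⊢
    exact_mod_cast hn
  · exact ⟨κ, h, fun n _ => by simp⟩

lemma exp_neg_mul_le_rpow {p b y : ℝ} (hp : 0 < p) (hb : 0 < b) (hy : 0 < y) :
    Real.exp (-(p * y)) ≤ (b / p) ^ b * y ^ (-b) := by
  have h1 : p * y / b ≤ Real.exp (p * y / b) := by
    linarith [Real.add_one_le_exp (p * y / b)]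
  have h2 : (p * y / b) ^ b ≤ Real.exp (p * y) := by
    calc (p * y / b) ^ b ≤ Real.exp (p * y / b) ^ b := by gcongr
      _ = Real.exp (p * y) := by rw [← Real.exp_mul, div_mul_cancel₀ _ hb.ne']
  calc Real.exp (-(p * y)) = (Real.exp (p * y))⁻¹ := Real.exp_neg _
    _ ≤ ((p * y / b) ^ b)⁻¹ := by gcongr
    _ = (b / p) ^ b * y ^ (-b) := by
        rw [← Real.inv_rpow (by positivity), Real.rpow_neg hy.le, ← Real.inv_rpow hy.le,
          ← Real.mul_rpow (by positivity) (by positivity)]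
        congr 1
        field_simp

/-- `H` is holomorphic on the upper half-plane, has a Fourier expansion `∑ c_n e^{2πi(n + κ)z/m}`
supported on positive frequencies, and is `O((Im z) ^ (-a))`. This is all that the analytic part
of the argument uses about a modular form of growth exponent `a`, after removing its constant
term. -/
structure IsFourierExpansion (m κ a : ℝ) (c : ℕ → ℂ) (H : ℂ → ℂ) : Prop where
  m_pos : 0 < m
  κ_nonneg : 0 ≤ κ
  a_pos : 0 < a
  coeff_eq_zero : ∀ n : ℕ, ¬ 0 < (n : ℝ) + κ → c n = 0
  holo : DifferentiableOn ℂ H {z | 0 < z.im}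
  hasSum : ∀ z : ℂ, 0 < z.im → HasSum (fun n => c n * expMode m κ n z) (H z)
  bound : ∃ C : ℝ, 0 < C ∧ ∀ z : ℂ, 0 < z.im → ‖H z‖ ≤ C * z.im ^ (-a)

lemma hasSum_intervalIntegral_of_norm_le {E : Type*} [NormedAddCommGroup E] [NormedSpace ℝ E]
    {ι : Type*} [Countable ι] {F : ι → ℝ → E} {g : ℝ → E} {B : ι → ℝ} (p q : ℝ)
    (hF : ∀ n, Continuous (F n)) (hB : Summable B) (hle : ∀ n u, ‖F n u‖ ≤ B n)
    (hg : ∀ u, HasSum (fun n => F n u) (g u)) :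
    HasSum (fun n => ∫ u in p..q, F n u) (∫ u in p..q, g u) :=
  intervalIntegral.hasSum_integral_of_dominated_convergence (fun n _ => B n)
    (fun n => (hF n).aestronglyMeasurable) (fun n => ae_of_all _ fun u _ => hle n u)
    (ae_of_all _ fun _ _ => hB) intervalIntegrable_const (ae_of_all _ fun u _ => hg u)

namespace IsFourierExpansion

variable {m κ a : ℝ} {c : ℕ → ℂ} {H : ℂ → ℂ}

lemma mono (h : IsFourierExpansion m κ a c H) {b : ℝ} (hab : a ≤ b) :
    IsFourierExpansion m κ b c H := by
  refine { h with a_pos := h.a_pos.trans_le hab, bound := ?_ }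
  have hb := h.a_pos.trans_le hab
  have hm := h.m_pos
  obtain ⟨C, hC, hCz⟩ := h.bound
  obtain ⟨δ, hδ, hδn⟩ := exists_pos_forall_le_add h.κ_nonneg
  obtain ⟨D, hD, hDz⟩ := norm_le_exp_of_hasSum hm one_pos
    (fun n hn => hδn n (not_not.mp fun hneg => hn (h.coeff_eq_zero n hneg))) h.hasSum
  refine ⟨C + D * (b / (2 * π * δ / m)) ^ b, by positivity, fun z hz => ?_⟩
  have hzb : 0 < z.im ^ (-b) := Real.rpow_pos_of_pos hz _
  rcases le_total z.im 1 with hz1 | hz1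
  · calc ‖H z‖ ≤ C * z.im ^ (-a) := hCz z hz
      _ ≤ C * z.im ^ (-b) := by
        gcongr ?_ * ?_
        exact Real.rpow_le_rpow_of_exponent_ge hz hz1 (neg_le_neg hab)
      _ ≤ _ := by gcongr; exact le_add_of_nonneg_right (by positivity)
  · calc ‖H z‖ ≤ D * ((b / (2 * π * δ / m)) ^ b * z.im ^ (-b)) :=
          (hDz z hz1).trans (by gcongr; exact exp_neg_mul_le_rpow (by positivity) hb hz)
      _ = D * (b / (2 * π * δ / m)) ^ b * z.im ^ (-b) := by ring
      _ ≤ _ := by gcongr; exact le_add_of_nonneg_left hC.le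

lemma continuous_comp_line (h : IsFourierExpansion m κ a c H) {t : ℝ} (ht : 0 < t) :
    Continuous fun u : ℝ => H (u + t * Complex.I) :=
  h.holo.continuousOn.comp_continuous (by fun_prop) fun u => by simpa using ht

lemma summable_norm (h : IsFourierExpansion m κ a c H) {t : ℝ} (ht : 0 < t) :
    Summable fun n => ‖c n‖ * Real.exp (-(2 * π * (n + κ) / m * t)) := by
  have := (h.hasSum (t * Complex.I) (by simpa using ht)).summable.norm
  simpa [norm_mul, norm_expMode] using this

lemma coeff_eq (h : IsFourierExpansion m κ a c H) (n : ℕ) {t : ℝ} (ht : 0 < t) :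
    c n = (1 / (m : ℂ)) * ∫ u in (0 : ℝ)..m,
      H (u + t * Complex.I) * expMode m κ n (-(u + t * Complex.I)) := by
  have hm' : (m : ℂ) ≠ 0 := by exact_mod_cast h.m_pos.ne'
  have hterm (k : ℕ) : (∫ u in (0 : ℝ)..m, c k * expMode m κ k (u + t * Complex.I) *
      expMode m κ n (-(u + t * Complex.I))) = if k = n then c n * m else 0 := by
    simp_rw [mul_assoc]
    rw [intervalIntegral.integral_const_mul, integral_expMode_mul h.m_pos]
    split_ifs with hkn
    · rw [hkn]
    · rw [mul_zero]
  have hsum := hasSum_intervalIntegral_of_norm_le 0 m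
    (F := fun k u => c k * expMode m κ k (u + t * Complex.I) *
      expMode m κ n (-(u + t * Complex.I)))
    (fun k => by fun_prop)
    ((h.summable_norm ht).mul_right (Real.exp (2 * π * (n + κ) / m * t)))
    (fun k u => by simp [norm_expMode])
    (fun u => (h.hasSum (u + t * Complex.I) (by simpa using ht)).mul_right _)
  simp_rw [hterm] at hsum
  rw [hsum.unique (hasSum_ite_eq n (c n * (m : ℂ)))]
  field_simp

end IsFourierExpansion

lemma norm_one_sub_le_of_norm_eq_one {w : ℂ} (hw : ‖w‖ = 1) {ρ : ℝ} (hρ : 0 ≤ ρ) :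
    ‖1 - w‖ ≤ 2 * ‖1 - ρ * w‖ := by
  have hnorm : ‖(ρ : ℂ) * w‖ = ρ := by simp [hw, abs_of_nonneg hρ]
  have h1 : |1 - ρ| ≤ ‖1 - ρ * w‖ := by
    simpa only [hnorm, norm_one] using abs_norm_sub_norm_le 1 ((ρ : ℂ) * w)
  have h2 : ‖((ρ : ℂ) - 1) * w‖ = |1 - ρ| := by
    rw [norm_mul, hw, mul_one, norm_sub_rev, ← Complex.ofReal_one, ← Complex.ofReal_sub,
      Complex.norm_real, Real.norm_eq_abs]
  calc ‖1 - w‖ = ‖(1 - ρ * w) + ((ρ : ℂ) - 1) * w‖ := by ring_nf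
    _ ≤ 2 * ‖1 - ρ * w‖ := by linarith [norm_add_le (1 - ρ * w) (((ρ : ℂ) - 1) * w)]

lemma one_sub_exp_le_norm_one_sub_expMode (m : ℝ) (w : ℂ) :
    1 - Real.exp (-(2 * π / m * w.im)) ≤ ‖1 - expMode m 0 1 w‖ := by
  simpa [norm_expMode] using norm_sub_norm_le 1 (expMode m 0 1 w)

lemma abs_re_le_norm_one_sub_expMode {m : ℝ} (hm : 0 < m) {w : ℂ} (hw : |w.re| ≤ m / 2) :
    2 / m * |w.re| ≤ ‖1 - expMode m 0 1 w‖ := by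
  have hsplit : expMode m 0 1 w =
      (Real.exp (-(2 * π / m * w.im)) : ℝ) *
        Complex.exp (Complex.I * (2 * π * w.re / m : ℝ)) := by
    nth_rw 1 [expMode, ← Complex.re_add_im w]
    rw [Complex.ofReal_exp, ← Complex.exp_add]
    congr 1
    push_cast
    linear_combination (2 * π * w.im / m) * Complex.I_sq
  have hsin : ‖1 - Complex.exp (Complex.I * (2 * π * w.re / m : ℝ))‖ =
      2 * |Real.sin (π * w.re / m)| := by
    rw [norm_sub_rev, Complex.norm_exp_I_mul_ofReal_sub_one, norm_mul]
    simp only [Real.norm_ofNat, Real.norm_eq_abs]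
    congr 3
    ring
  have hle := norm_one_sub_le_of_norm_eq_one
    (Complex.norm_exp_I_mul_ofReal (2 * π * w.re / m)) (Real.exp_pos (-(2 * π / m * w.im))).le
  have habs : |π * w.re / m| = π / m * |w.re| := by
    rw [mul_div_right_comm, abs_mul, abs_of_pos (by positivity)]
  have hjordan := Real.mul_abs_le_abs_sin (x := π * w.re / m) (by
    calc |π * w.re / m| = π / m * |w.re| := habs
      _ ≤ π / m * (m / 2) := by gcongr
      _ = π / 2 := by field_simp)
  calc 2 / m * |w.re| = 2 / π * |π * w.re / m| := by rw [habs]; field_simp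
    _ ≤ ‖1 - expMode m 0 1 w‖ := by rw [hsplit]; linarith

lemma one_sub_expMode_ne_zero {m : ℝ} (hm : 0 < m) {w : ℂ} (hw : 0 < w.im) :
    1 - expMode m 0 1 w ≠ 0 := by
  have hlt : Real.exp (-(2 * π / m * w.im)) < 1 := by
    rw [Real.exp_lt_one_iff, Left.neg_neg_iff]
    positivity
  refine norm_pos_iff.mp (lt_of_lt_of_le ?_ (one_sub_exp_le_norm_one_sub_expMode m w))
  linarith

lemma hasSum_expMode_add {m : ℝ} (hm : 0 < m) (κ : ℝ) (N : ℕ) {w : ℂ} (hw : 0 < w.im) :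
    HasSum (fun k => expMode m κ (N + k) w) (expMode m κ N w * (1 - expMode m 0 1 w)⁻¹) := by
  simp_rw [expMode_add_nat m κ N]
  have hlt : ‖expMode m 0 1 w‖ < 1 := by
    rw [norm_expMode, Real.exp_lt_one_iff, Left.neg_neg_iff]
    positivity
  exact (hasSum_geometric_of_norm_lt_one hlt).mul_left _

lemma one_sub_exp_neg_rpow_neg_le {s ε : ℝ} (hs : 0 < s) (hε0 : 0 ≤ ε) (hε1 : ε ≤ 1) :
    (1 - Real.exp (-s)) ^ (-ε) ≤ 1 + s ^ (-ε) := by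
  have h1 : Real.exp (-s) ≤ 1 / (1 + s) := by
    rw [Real.exp_neg, ← one_div]
    apply one_div_le_one_div_of_le (by positivity)
    linarith [Real.add_one_le_exp s]
  have h2 : s / (1 + s) ≤ 1 - Real.exp (-s) := by
    have : s / (1 + s) = 1 - 1 / (1 + s) := by field_simp; ring
    linarith
  calc (1 - Real.exp (-s)) ^ (-ε) ≤ (s / (1 + s)) ^ (-ε) :=
        Real.rpow_le_rpow_of_nonpos (by positivity) h2 (by linarith)
    _ = (1 + s⁻¹) ^ ε := by
        rw [Real.rpow_neg (by positivity), ← Real.inv_rpow (by positivity)]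
        congr 1
        field_simp
        ring
    _ ≤ 1 ^ ε + (s⁻¹) ^ ε := Real.rpow_add_le_add_rpow zero_le_one (by positivity) hε0 hε1
    _ = 1 + s ^ (-ε) := by rw [Real.one_rpow, Real.inv_rpow hs.le, Real.rpow_neg hs.le]

lemma norm_inv_one_sub_expMode_le {m ε : ℝ} (hm : 0 < m) (hε0 : 0 ≤ ε) (hε1 : ε ≤ 1) {w : ℂ}
    (hw : 0 < w.im) (hre : w.re ≠ 0) (hre' : |w.re| ≤ m / 2) :
    ‖(1 - expMode m 0 1 w)⁻¹‖ ≤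
      (1 + (2 * π / m * w.im) ^ (-ε)) * (2 / m * |w.re|) ^ (ε - 1) := by
  have hD : 0 < ‖1 - expMode m 0 1 w‖ := norm_pos_iff.mpr (one_sub_expMode_ne_zero hm hw)
  have hlow : 0 < 1 - Real.exp (-(2 * π / m * w.im)) := by
    rw [sub_pos, Real.exp_lt_one_iff, Left.neg_neg_iff]
    positivity
  calc ‖(1 - expMode m 0 1 w)⁻¹‖ =
        ‖1 - expMode m 0 1 w‖ ^ (-ε) * ‖1 - expMode m 0 1 w‖ ^ (ε - 1) := by
        rw [← Real.rpow_add hD, norm_inv, ← Real.rpow_neg_one]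
        ring_nf
    _ ≤ (1 - Real.exp (-(2 * π / m * w.im))) ^ (-ε) * (2 / m * |w.re|) ^ (ε - 1) := by
        gcongr ?_ * ?_
        · exact Real.rpow_le_rpow_of_nonpos hlow (one_sub_exp_le_norm_one_sub_expMode m w)
            (neg_nonpos.mpr hε0)
        · exact Real.rpow_le_rpow_of_nonpos (by positivity)
            (abs_re_le_norm_one_sub_expMode hm hre') (by linarith)
    _ ≤ _ := by
        gcongr
        exact one_sub_exp_neg_rpow_neg_le (by positivity) hε0 hε1

lemma integral_norm_inv_one_sub_expMode_eq {m : ℝ} (hm : m ≠ 0) (z : ℂ) :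
    ∫ u in (0 : ℝ)..m, ‖(1 - expMode m 0 1 (z - u))⁻¹‖ =
      ∫ u in (-(m / 2))..(m / 2), ‖(1 - expMode m 0 1 (u + z.im * Complex.I))⁻¹‖ := by
  set F : ℝ → ℝ := fun u => ‖(1 - expMode m 0 1 (u + z.im * Complex.I))⁻¹‖ with hF
  have hper : Function.Periodic F m := fun u => by
    simp only [hF, Complex.ofReal_add, add_right_comm _ (m : ℂ), expMode_add_period hm]
    simp
  have h1 := intervalIntegral.integral_comp_sub_left (a := 0) (b := m) F z.re
  have h2 := hper.intervalIntegral_add_eq (z.re - m) (-(m / 2))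
  rw [sub_add_cancel, show -(m / 2) + m = m / 2 by ring] at h2
  rw [sub_zero] at h1
  rw [← h2, ← h1]
  refine intervalIntegral.integral_congr fun u _ => ?_
  simp only [hF, Complex.ofReal_sub, sub_add_eq_add_sub, Complex.re_add_im]

/-- The true growth is logarithmic, but an arbitrarily small power suffices. -/
lemma exists_integral_norm_inv_one_sub_expMode_le {m ε : ℝ} (hm : 0 < m) (hε0 : 0 < ε)
    (hε1 : ε ≤ 1) :
    ∃ C : ℝ, 0 < C ∧ ∀ z : ℂ, 0 < z.im →
      ∫ u in (0 : ℝ)..m, ‖(1 - expMode m 0 1 (z - u))⁻¹‖ ≤ C * (1 + z.im ^ (-ε)) := by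
  set g : ℝ → ℝ := fun u => (2 / m * |u|) ^ (ε - 1) with hg
  have hgi : IntervalIntegrable g volume (-(m / 2)) (m / 2) := by
    refine intervalIntegrable_of_even (fun u => by simp [hg]) fun x hx => ?_
    refine (((intervalIntegral.intervalIntegrable_rpow' (r := ε - 1) (by linarith)).const_mul
      ((2 / m) ^ (ε - 1)))).congr fun u hu => ?_
    rw [Set.uIoc_of_le hx.le] at hu
    simp only [hg]
    rw [abs_of_pos hu.1, Real.mul_rpow (by positivity) hu.1.le]
  set J : ℝ := ∫ u in (-(m / 2))..(m / 2), g u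
  have hJ0 : 0 ≤ J :=
    intervalIntegral.integral_nonneg (by linarith) fun u _ => by positivity
  refine ⟨(J + 1) * (1 + (2 * π / m) ^ (-ε)), by positivity, fun z hz => ?_⟩
  set F : ℝ → ℝ := fun u => ‖(1 - expMode m 0 1 (u + z.im * Complex.I))⁻¹‖ with hF
  have him (u : ℝ) : 0 < ((u : ℂ) + z.im * Complex.I).im := by simpa using hz
  have hFc : Continuous F :=
    ((by fun_prop : Continuous fun u : ℝ => 1 - expMode m 0 1 (u + z.im * Complex.I)).inv₀
      fun u => one_sub_expMode_ne_zero hm (him u)).norm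
  have hpt : ∀ᵐ u, u ∈ Set.Icc (-(m / 2)) (m / 2) →
      F u ≤ (1 + (2 * π / m * z.im) ^ (-ε)) * g u := by
    filter_upwards [compl_mem_ae_iff.mpr (measure_singleton (0 : ℝ))] with u hu0 hu
    simpa [hF, hg] using norm_inv_one_sub_expMode_le hm hε0.le hε1 (him u) (by simpa using hu0)
      (by simpa [abs_le] using hu)
  calc ∫ u in (0 : ℝ)..m, ‖(1 - expMode m 0 1 (z - u))⁻¹‖
      = ∫ u in (-(m / 2))..(m / 2), F u := integral_norm_inv_one_sub_expMode_eq hm.ne' z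
    _ ≤ ∫ u in (-(m / 2))..(m / 2), (1 + (2 * π / m * z.im) ^ (-ε)) * g u :=
        intervalIntegral.integral_mono_ae_restrict (by linarith)
          (hFc.intervalIntegrable _ _) (hgi.const_mul _)
          ((ae_restrict_iff' measurableSet_Icc).mpr hpt)
    _ = (1 + (2 * π / m) ^ (-ε) * z.im ^ (-ε)) * J := by
        rw [intervalIntegral.integral_const_mul, Real.mul_rpow (by positivity) hz.le]
    _ ≤ ((1 + (2 * π / m) ^ (-ε)) * (1 + z.im ^ (-ε))) * (J + 1) := by
        gcongr
        · nlinarith [Real.rpow_pos_of_pos hz (-ε),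
            Real.rpow_pos_of_pos (show 0 < 2 * π / m by positivity) (-ε)]
        · linarith
    _ = _ := by ring

namespace IsFourierExpansion

variable {m κ a : ℝ} {c : ℕ → ℂ} {H : ℂ → ℂ}

lemma tail_eq (h : IsFourierExpansion m κ a c H) (N : ℕ) {z : ℂ} {t : ℝ} (ht : 0 < t)
    (hz : t < z.im) :
    H z - ∑ n ∈ Finset.range N, c n * expMode m κ n z =
      (1 / (m : ℂ)) * ∫ u in (0 : ℝ)..m, H (u + t * Complex.I) *
        (expMode m κ N (z - t * Complex.I - u) *
          (1 - expMode m 0 1 (z - t * Complex.I - u))⁻¹) := by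
  have him (u : ℝ) : (z - t * Complex.I - u).im = z.im - t := by simp
  obtain ⟨C, hC, hCz⟩ := h.bound
  have hpos (u : ℝ) : 0 < (z - t * Complex.I - u).im := by rw [him]; linarith
  have hterm (k : ℕ) : c (N + k) * expMode m κ (N + k) z =
      (1 / (m : ℂ)) * ∫ u in (0 : ℝ)..m,
        H (u + t * Complex.I) * expMode m κ (N + k) (z - t * Complex.I - u) := by
    rw [h.coeff_eq (N + k) ht, mul_assoc, ← intervalIntegral.integral_mul_const]
    congr 2 with u
    rw [mul_assoc, ← expMode_add]
    ring_nf
  have hsum := hasSum_intervalIntegral_of_norm_le 0 m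
    (F := fun k u => H (u + t * Complex.I) * expMode m κ (N + k) (z - t * Complex.I - u))
    (fun k => (h.continuous_comp_line ht).mul (by fun_prop))
    ((hasSum_expMode_add h.m_pos κ N (hpos 0)).summable.norm.mul_left (C * t ^ (-a)))
    (fun k u => by
      rw [norm_mul, norm_expMode, norm_expMode, him, him]
      gcongr
      simpa using hCz (u + t * Complex.I) (by simpa using ht))
    (fun u => (hasSum_expMode_add h.m_pos κ N (hpos u)).mul_left _)
  have htail := (hasSum_nat_add_iff' N).mpr (h.hasSum z (ht.trans hz))
  simp_rw [add_comm _ N, hterm] at htail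
  exact htail.unique (hsum.mul_left _)

lemma norm_tail_le_integral (h : IsFourierExpansion m κ a c H) {C t : ℝ} (ht : 0 < t)
    (hC : ∀ u : ℝ, ‖H (u + t * Complex.I)‖ ≤ C) (N : ℕ) {z : ℂ} (hz : t < z.im) :
    ‖H z - ∑ n ∈ Finset.range N, c n * expMode m κ n z‖ ≤
      1 / m * (C * Real.exp (-(2 * π * (N + κ) / m * (z.im - t))) *
        ∫ u in (0 : ℝ)..m, ‖(1 - expMode m 0 1 (z - t * Complex.I - u))⁻¹‖) := by
  have hm := h.m_pos
  have him (u : ℝ) : (z - t * Complex.I - u).im = z.im - t := by simp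
  have hcont : Continuous fun u : ℝ => ‖(1 - expMode m 0 1 (z - t * Complex.I - u))⁻¹‖ :=
    ((by fun_prop : Continuous fun u : ℝ => 1 - expMode m 0 1 (z - t * Complex.I - u)).inv₀
      fun u => one_sub_expMode_ne_zero hm (by rw [him]; linarith)).norm
  rw [h.tail_eq N ht hz, norm_mul, ← intervalIntegral.integral_const_mul]
  gcongr ?_ * ?_
  · simp [abs_of_pos hm]
  · refine intervalIntegral.norm_integral_le_of_norm_le hm.le (ae_of_all _ fun u _ => ?_)
      ((hcont.const_mul _).intervalIntegrable _ _)
    rw [norm_mul, norm_mul, norm_expMode, him, ← mul_assoc]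
    gcongr
    exact hC u

/-- The coefficients of the tail are recovered on the line at half the height of `z`; the loss
from the exponent `a` to `b` absorbs the growth of the kernel. -/
lemma exists_norm_tail_le (h : IsFourierExpansion m κ a c H) {b : ℝ} (hab : a < b) :
    ∃ C : ℝ, 0 < C ∧ ∀ (N : ℕ) (z : ℂ), 0 < z.im →
      ‖H z - ∑ n ∈ Finset.range N, c n * expMode m κ n z‖ ≤
        C * z.im ^ (-b) * Real.exp (-(π * (N + κ) / m * z.im)) := by
  have hm := h.m_pos
  set ε := min (b - a) 1
  have hε0 : 0 < ε := lt_min (sub_pos.mpr hab) one_pos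
  have hεa : a ≤ b - ε := by linarith [min_le_left (b - a) 1]
  obtain ⟨K, hK, hKz⟩ := exists_integral_norm_inv_one_sub_expMode_le hm hε0 (min_le_right _ _)
  obtain ⟨B, hB, hBz⟩ := (h.mono hab.le).bound
  obtain ⟨B', hB', hBz'⟩ := (h.mono hεa).bound
  refine ⟨1 / m * ((B + B') * K) * (1 / 2) ^ (-b), by positivity, fun N z hz => ?_⟩
  set t := z.im / 2 with ht
  have ht0 : 0 < t := half_pos hz
  have hline (u : ℝ) : ‖H (u + t * Complex.I)‖ ≤ min (B * t ^ (-b)) (B' * t ^ (-(b - ε))) :=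
    le_min (by simpa using hBz (u + t * Complex.I) (by simpa using ht0))
      (by simpa using hBz' (u + t * Complex.I) (by simpa using ht0))
  have hmin : min (B * t ^ (-b)) (B' * t ^ (-(b - ε))) * (1 + t ^ (-ε)) ≤
      (B + B') * t ^ (-b) := by
    calc _ ≤ B * t ^ (-b) + B' * t ^ (-(b - ε)) * t ^ (-ε) := by
          rw [mul_add, mul_one]
          gcongr
          · exact min_le_left _ _
          · exact min_le_right _ _
      _ = (B + B') * t ^ (-b) := by
          rw [mul_assoc, ← Real.rpow_add ht0]
          ring_nf
  have hkernel : ∫ u in (0 : ℝ)..m, ‖(1 - expMode m 0 1 (z - t * Complex.I - u))⁻¹‖ ≤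
      K * (1 + t ^ (-ε)) := by
    have him : (z - t * Complex.I).im = t := by simp [ht]; ring
    simpa only [him] using hKz (z - t * Complex.I) (him.symm ▸ ht0)
  calc _ ≤ 1 / m * (min (B * t ^ (-b)) (B' * t ^ (-(b - ε))) *
        Real.exp (-(2 * π * (N + κ) / m * (z.im - t))) * (K * (1 + t ^ (-ε)))) := by
        refine (h.norm_tail_le_integral ht0 hline N (half_lt_self hz)).trans ?_
        gcongr
    _ = 1 / m * K * Real.exp (-(π * (N + κ) / m * z.im)) *
        (min (B * t ^ (-b)) (B' * t ^ (-(b - ε))) * (1 + t ^ (-ε))) := by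
        rw [show 2 * π * (N + κ) / m * (z.im - t) = π * (N + κ) / m * z.im by rw [ht]; ring]
        ring
    _ ≤ 1 / m * K * Real.exp (-(π * (N + κ) / m * z.im)) * ((B + B') * t ^ (-b)) := by gcongr
    _ = _ := by
        rw [show t = 1 / 2 * z.im by rw [ht]; ring, Real.mul_rpow (by norm_num) hz.le]
        ring

end IsFourierExpansion

/-- Partial sums of the fractional integral of order `α` of the Fourier series with
coefficients `c`. -/
noncomputable def fracPartial (m κ α : ℝ) (c : ℕ → ℂ) (N : ℕ) (x : ℝ) : ℂ :=
  ∑ n ∈ Finset.range N, c n / ((((n : ℝ) + κ) ^ α : ℝ) : ℂ) * expMode m κ n x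

/-- The fractional integral of order `α` of `H`, written as a normalised Mellin transform along
vertical half-lines. -/
noncomputable def fracLimit (m α : ℝ) (H : ℂ → ℂ) (x : ℝ) : ℂ :=
  (((2 * π / m) ^ α / Real.Gamma α : ℝ) : ℂ) *
    ∫ t in Set.Ioi (0 : ℝ), ((t ^ (α - 1) : ℝ) : ℂ) * H (x + t * Complex.I)

lemma integrableOn_rpow_mul_exp_neg_mul {s b : ℝ} (hs : 0 < s) (hb : 0 < b) :
    IntegrableOn (fun t : ℝ => t ^ (s - 1) * Real.exp (-(b * t))) (Set.Ioi 0) := by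
  simpa [neg_mul] using
    integrableOn_rpow_mul_exp_neg_mul_rpow (s := s - 1) (p := 1) (by linarith) one_pos hb

lemma expMode_add_mul_I (m κ : ℝ) (n : ℕ) (x t : ℝ) :
    expMode m κ n (x + t * Complex.I) =
      expMode m κ n x * (Real.exp (-(2 * π * (n + κ) / m * t)) : ℝ) := by
  have hvert : expMode m κ n (t * Complex.I) = (Real.exp (-(2 * π * (n + κ) / m * t)) : ℝ) := by
    rw [expMode, Complex.ofReal_exp]
    congr 1
    push_cast
    linear_combination (2 * π * (n + κ) / m * t) * Complex.I_sq
  rw [expMode_add, hvert]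

lemma integrableOn_rpow_mul_expMode {m κ α : ℝ} (hm : 0 < m) (hα : 0 < α) {n : ℕ}
    (hn : 0 < (n : ℝ) + κ) (x : ℝ) :
    IntegrableOn (fun t : ℝ => ((t ^ (α - 1) : ℝ) : ℂ) * expMode m κ n (x + t * Complex.I))
      (Set.Ioi 0) := by
  simp_rw [expMode_add_mul_I, mul_left_comm, ← Complex.ofReal_mul]
  exact (integrableOn_rpow_mul_exp_neg_mul hα (by positivity)).ofReal.const_mul _

lemma integral_rpow_mul_expMode {m κ α : ℝ} (hm : 0 < m) (hα : 0 < α) {n : ℕ}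
    (hn : 0 < (n : ℝ) + κ) (x : ℝ) :
    (((2 * π / m) ^ α / Real.Gamma α : ℝ) : ℂ) * ∫ t in Set.Ioi (0 : ℝ),
      ((t ^ (α - 1) : ℝ) : ℂ) * expMode m κ n (x + t * Complex.I) =
      expMode m κ n x / ((((n : ℝ) + κ) ^ α : ℝ) : ℂ) := by
  have hΓ := (Real.Gamma_pos_of_pos hα).ne'
  have hpow : (1 / (2 * π * (n + κ) / m)) ^ α = ((2 * π / m) ^ α * (n + κ) ^ α)⁻¹ := by
    rw [← Real.mul_rpow (by positivity) hn.le, ← Real.inv_rpow (by positivity)]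
    congr 1
    field_simp
  simp_rw [expMode_add_mul_I, mul_left_comm, ← Complex.ofReal_mul]
  rw [integral_const_mul, integral_complex_ofReal,
    Real.integral_rpow_mul_exp_neg_mul_Ioi hα (by positivity), hpow, mul_left_comm,
    ← Complex.ofReal_mul, div_eq_mul_inv (expMode m κ n x), ← Complex.ofReal_inv]
  congr 2
  field_simp

namespace IsFourierExpansion

variable {m κ a : ℝ} {c : ℕ → ℂ} {H : ℂ → ℂ}

lemma integrableOn_term (h : IsFourierExpansion m κ a c H) {α : ℝ} (hα : 0 < α) (n : ℕ) (x : ℝ) :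
    IntegrableOn (fun t : ℝ => ((t ^ (α - 1) : ℝ) : ℂ) *
      (c n * expMode m κ n (x + t * Complex.I))) (Set.Ioi 0) := by
  by_cases hn : 0 < (n : ℝ) + κ
  · simp_rw [mul_left_comm _ (c n)]
    exact (integrableOn_rpow_mul_expMode h.m_pos hα hn x).const_mul _
  · simp [h.coeff_eq_zero n hn]

lemma integral_term (h : IsFourierExpansion m κ a c H) {α : ℝ} (hα : 0 < α) (n : ℕ) (x : ℝ) :
    (((2 * π / m) ^ α / Real.Gamma α : ℝ) : ℂ) * ∫ t in Set.Ioi (0 : ℝ),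
      ((t ^ (α - 1) : ℝ) : ℂ) * (c n * expMode m κ n (x + t * Complex.I)) =
      c n / ((((n : ℝ) + κ) ^ α : ℝ) : ℂ) * expMode m κ n x := by
  by_cases hn : 0 < (n : ℝ) + κ
  · simp_rw [mul_left_comm _ (c n)]
    rw [integral_const_mul, mul_left_comm, integral_rpow_mul_expMode h.m_pos hα hn]
    ring
  · simp [h.coeff_eq_zero n hn]

lemma continuousOn_vertical (h : IsFourierExpansion m κ a c H) (x : ℝ) :
    ContinuousOn (fun t : ℝ => H (x + t * Complex.I)) (Set.Ioi 0) :=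
  h.holo.continuousOn.comp (by fun_prop) fun t ht => by simpa using ht

lemma exists_norm_tail_vertical_le (h : IsFourierExpansion m κ a c H) {b : ℝ} (hb : a < b)
    (α : ℝ) : ∃ C : ℝ, 0 < C ∧ ∀ (N : ℕ) (x t : ℝ), 0 < t →
      ‖((t ^ (α - 1) : ℝ) : ℂ) * (H (x + t * Complex.I) -
        ∑ n ∈ Finset.range N, c n * expMode m κ n (x + t * Complex.I))‖ ≤
      C * (t ^ (α - b - 1) * Real.exp (-(π * (N + κ) / m * t))) := by
  obtain ⟨C, hC0, hC⟩ := h.exists_norm_tail_le hb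
  refine ⟨C, hC0, fun N x t ht => ?_⟩
  have him : ((x : ℂ) + t * Complex.I).im = t := by simp
  have htail := hC N (x + t * Complex.I) (him.symm ▸ ht)
  rw [him] at htail
  rw [norm_mul, Complex.norm_real, Real.norm_of_nonneg (by positivity)]
  refine (mul_le_mul_of_nonneg_left htail (by positivity)).trans_eq ?_
  rw [show α - b - 1 = (α - 1) + -b by ring, Real.rpow_add ht]
  ring

lemma integrableOn_vertical (h : IsFourierExpansion m κ a c H) {α : ℝ} (hα : a < α) (x : ℝ) :
    IntegrableOn (fun t : ℝ => ((t ^ (α - 1) : ℝ) : ℂ) * H (x + t * Complex.I)) (Set.Ioi 0) := by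
  obtain ⟨b, hab, hbα⟩ := exists_between hα
  obtain ⟨C, -, hC⟩ := h.exists_norm_tail_vertical_le hab α
  have hp : 0 < π * ((1 : ℕ) + κ) / m := by
    have := h.m_pos
    have := h.κ_nonneg
    positivity
  have hterm := h.integrableOn_term (h.a_pos.trans hα) 0 x
  have hmeas : AEStronglyMeasurable (fun t : ℝ => ((t ^ (α - 1) : ℝ) : ℂ) *
      H (x + t * Complex.I)) (volume.restrict (Set.Ioi 0)) := by
    refine ContinuousOn.aestronglyMeasurable ?_ measurableSet_Ioi
    refine (Complex.continuous_ofReal.comp_continuousOn ?_).mul (h.continuousOn_vertical x)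
    exact continuousOn_id.rpow_const fun t ht => Or.inl (Set.mem_Ioi.mp ht).ne'
  have htail : IntegrableOn (fun t : ℝ => ((t ^ (α - 1) : ℝ) : ℂ) * H (x + t * Complex.I) -
      ((t ^ (α - 1) : ℝ) : ℂ) * (c 0 * expMode m κ 0 (x + t * Complex.I))) (Set.Ioi 0) := by
    refine Integrable.mono' ((integrableOn_rpow_mul_exp_neg_mul (sub_pos.mpr hbα) hp).const_mul C)
      (hmeas.sub hterm.aestronglyMeasurable) ?_
    filter_upwards [ae_restrict_mem measurableSet_Ioi] with t ht
    simpa [mul_sub] using hC 1 x t ht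
  exact (htail.add hterm).congr (Eventually.of_forall fun t => by simp)

lemma exists_norm_fracPartial_sub_le (h : IsFourierExpansion m κ a c H) {α b : ℝ} (hab : a < b)
    (hbα : b < α) : ∃ C : ℝ, ∀ (N : ℕ) (x : ℝ), 1 ≤ N →
      ‖fracPartial m κ α c N x - fracLimit m α H x‖ ≤
        C * (1 / (π * (N + κ) / m)) ^ (α - b) := by
  obtain ⟨C, -, hC⟩ := h.exists_norm_tail_vertical_le hab α
  have hα := h.a_pos.trans (hab.trans hbα)
  set A : ℝ := (2 * π / m) ^ α / Real.Gamma α with hA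
  refine ⟨|A| * (C * Real.Gamma (α - b)), fun N x hN => ?_⟩
  have hp : 0 < π * (N + κ) / m := by
    have := h.m_pos
    have := h.κ_nonneg
    positivity
  have hdiff : fracPartial m κ α c N x - fracLimit m α H x =
      -((A : ℂ) * ∫ t in Set.Ioi (0 : ℝ), ((t ^ (α - 1) : ℝ) : ℂ) * (H (x + t * Complex.I) -
        ∑ n ∈ Finset.range N, c n * expMode m κ n (x + t * Complex.I))) := by
    simp_rw [mul_sub, Finset.mul_sum]
    rw [integral_sub (h.integrableOn_vertical (hab.trans hbα) x)
      (integrable_finsetSum _ fun n _ => h.integrableOn_term hα n x),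
      integral_finsetSum _ fun n _ => h.integrableOn_term hα n x, mul_sub, Finset.mul_sum,
      neg_sub, fracLimit, fracPartial]
    simp_rw [hA, h.integral_term hα]
  have hint := integrableOn_rpow_mul_exp_neg_mul (sub_pos.mpr hbα) hp
  calc ‖fracPartial m κ α c N x - fracLimit m α H x‖
      ≤ |A| * ∫ t in Set.Ioi (0 : ℝ),
          C * (t ^ (α - b - 1) * Real.exp (-(π * (N + κ) / m * t))) := by
        rw [hdiff, norm_neg, norm_mul, Complex.norm_real, Real.norm_eq_abs]
        gcongr
        refine norm_integral_le_of_norm_le (hint.const_mul C) ?_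
        filter_upwards [ae_restrict_mem measurableSet_Ioi] with t ht using hC N x t ht
    _ = |A| * (C * Real.Gamma (α - b)) * (1 / (π * (N + κ) / m)) ^ (α - b) := by
        rw [integral_const_mul, Real.integral_rpow_mul_exp_neg_mul_Ioi (sub_pos.mpr hbα) hp]
        ring

theorem tendstoUniformly_fracPartial (h : IsFourierExpansion m κ a c H) {α : ℝ} (hα : a < α) :
    TendstoUniformly (fracPartial m κ α c) (fracLimit m α H) atTop := by
  obtain ⟨b, hab, hbα⟩ := exists_between hα
  obtain ⟨C, hC⟩ := h.exists_norm_fracPartial_sub_le hab hbα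
  have hinv : Tendsto (fun N : ℕ => 1 / (π * (N + κ) / m)) atTop (𝓝 0) := by
    simp_rw [one_div]
    exact tendsto_inv_atTop_zero.comp <| Tendsto.atTop_div_const h.m_pos <|
      Tendsto.const_mul_atTop Real.pi_pos <|
      tendsto_atTop_add_const_right _ _ tendsto_natCast_atTop_atTop
  have hlim : Tendsto (fun N : ℕ => C * (1 / (π * (N + κ) / m)) ^ (α - b)) atTop (𝓝 0) := by
    have hβ := sub_pos.mpr hbα
    simpa [Real.zero_rpow hβ.ne'] using (hinv.rpow_const (Or.inr hβ.le)).const_mul C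
  rw [Metric.tendstoUniformly_iff]
  intro δ hδ
  filter_upwards [hlim.eventually (gt_mem_nhds hδ), eventually_ge_atTop 1] with N hNδ hN x
  rw [dist_comm, dist_eq_norm]
  exact (hC N x hN).trans_lt hNδ

lemma continuous_fracPartial (α : ℝ) (N : ℕ) : Continuous (fracPartial m κ α c N) := by
  unfold fracPartial
  fun_prop

theorem continuous_fracLimit (h : IsFourierExpansion m κ a c H) {α : ℝ} (hα : a < α) :
    Continuous (fracLimit m α H) :=
  (h.tendstoUniformly_fracPartial hα).continuous
    (Frequently.of_forall fun N => continuous_fracPartial α N)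

lemma exists_norm_fracLimit_le (h : IsFourierExpansion m κ a c H) {α : ℝ} (hα : a < α) :
    ∃ C : ℝ, ∀ x, ‖fracLimit m α H x‖ ≤ C := by
  obtain ⟨N, hN⟩ := (Metric.tendstoUniformly_iff.mp
    (h.tendstoUniformly_fracPartial hα) 1 one_pos).exists
  refine ⟨1 + ∑ n ∈ Finset.range N, ‖c n / ((((n : ℝ) + κ) ^ α : ℝ) : ℂ)‖, fun x => ?_⟩
  have hpartial : ‖fracPartial m κ α c N x‖ ≤
      ∑ n ∈ Finset.range N, ‖c n / ((((n : ℝ) + κ) ^ α : ℝ) : ℂ)‖ :=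
    norm_sum_le_of_le _ fun n _ => by simp [norm_expMode]
  have hdist := dist_eq_norm (fracLimit m α H x) _ ▸ (hN x).le
  linarith [norm_le_norm_sub_add (fracLimit m α H x) (fracPartial m κ α c N x)]

lemma hasDerivAt_expMode (m κ : ℝ) (n : ℕ) (x : ℝ) :
    HasDerivAt (fun x : ℝ => expMode m κ n x)
      (2 * π * Complex.I / m * ((n + κ) * expMode m κ n x)) x := by
  unfold expMode
  have hlin := ((Complex.ofRealCLM.hasDerivAt (x := x)).div_const (m : ℂ)).const_mul
    (2 * π * Complex.I * (n + κ))
  refine (by simpa using hlin.cexp : HasDerivAt _ _ x).congr_deriv ?_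
  ring

lemma hasDerivAt_fracPartial (h : IsFourierExpansion m κ a c H) (α : ℝ) (N : ℕ) (x : ℝ) :
    HasDerivAt (fracPartial m κ α c N)
      (2 * π * Complex.I / m * fracPartial m κ (α - 1) c N x) x := by
  unfold fracPartial
  rw [Finset.mul_sum]
  refine HasDerivAt.fun_sum fun n _ => ?_
  refine ((hasDerivAt_expMode m κ n x).const_mul _).congr_deriv ?_
  by_cases hn : 0 < (n : ℝ) + κ
  · have hnκ : ((n : ℂ) + κ) ≠ 0 := by exact_mod_cast hn.ne'
    have hpow : (((n + κ) ^ α : ℝ) : ℂ) ≠ 0 := by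
      exact_mod_cast (Real.rpow_pos_of_pos hn _).ne'
    rw [Real.rpow_sub_one hn.ne']
    push_cast
    field_simp
  · simp [h.coeff_eq_zero n hn]

theorem hasDerivAt_fracLimit (h : IsFourierExpansion m κ a c H) {α : ℝ} (hα : a < α - 1) (x : ℝ) :
    HasDerivAt (fracLimit m α H) (2 * π * Complex.I / m * fracLimit m (α - 1) H x) x :=
  hasDerivAt_of_tendstoUniformly (l := atTop)
    ((uniformContinuous_const_smul (2 * π * Complex.I / m : ℂ)).comp_tendstoUniformly
      (h.tendstoUniformly_fracPartial hα))
    (Eventually.of_forall fun N y => h.hasDerivAt_fracPartial α N y)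
    (fun y => (h.tendstoUniformly_fracPartial (by linarith)).tendsto_at y) x

theorem iteratedDeriv_fracLimit (h : IsFourierExpansion m κ a c H) (k : ℕ) {α : ℝ}
    (hα : a < α - k) :
    iteratedDeriv k (fracLimit m α H) =
      fun x => (2 * π * Complex.I / m) ^ k * fracLimit m (α - k) H x := by
  induction k with
  | zero => simp
  | succ k ih =>
    push_cast at hα
    rw [iteratedDeriv_succ, ih (by linarith)]
    ext x
    rw [((h.hasDerivAt_fracLimit (α := α - k) (by linarith) x).const_mul _).deriv]
    push_cast
    rw [show α - (k + 1) = α - k - 1 by ring]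
    ring

lemma hasDerivsOn_fracLimit (h : IsFourierExpansion m κ a c H) (k : ℕ) {α : ℝ}
    (hα : a < α - k) : HasDerivsOn k (fracLimit m α H) Set.univ := by
  intro j hj x _
  have hjk : (j : ℝ) + 1 ≤ k := by exact_mod_cast hj
  rw [h.iteratedDeriv_fracLimit j (by linarith)]
  exact ((h.hasDerivAt_fracLimit (by linarith) x).const_mul _).differentiableAt

end IsFourierExpansion

lemma norm_integral_Ioc_zero_le {E : Type*} [NormedAddCommGroup E] [NormedSpace ℝ E] {g : ℝ → E}
    {A β d : ℝ} (hβ : 0 < β) (hd : 0 ≤ d)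
    (hg : ∀ t : ℝ, 0 < t → ‖g t‖ ≤ A * t ^ (β - 1)) :
    ‖∫ t in Set.Ioc 0 d, g t‖ ≤ A / β * d ^ β := by
  have hint : IntegrableOn (fun t : ℝ => A * t ^ (β - 1)) (Set.Ioc 0 d) := by
    rw [← intervalIntegrable_iff_integrableOn_Ioc_of_le hd]
    exact (intervalIntegral.intervalIntegrable_rpow' (by linarith)).const_mul _
  calc ‖∫ t in Set.Ioc 0 d, g t‖ ≤ ∫ t in Set.Ioc 0 d, A * t ^ (β - 1) :=
        norm_integral_le_of_norm_le hint <| by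
          filter_upwards [ae_restrict_mem measurableSet_Ioc] with t ht using hg t ht.1
    _ = A / β * d ^ β := by
        rw [← intervalIntegral.integral_of_le hd, intervalIntegral.integral_const_mul,
          integral_rpow (Or.inl (by linarith)), sub_add_cancel, Real.zero_rpow hβ.ne']
        ring

lemma norm_integral_Ioi_le {E : Type*} [NormedAddCommGroup E] [NormedSpace ℝ E] {g : ℝ → E}
    {A β d : ℝ} (hβ : 0 < β) (hd : 0 < d)
    (hg : ∀ t : ℝ, 0 < t → ‖g t‖ ≤ A * t ^ (-β - 1)) :
    ‖∫ t in Set.Ioi d, g t‖ ≤ A / β * d ^ (-β) := by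
  calc ‖∫ t in Set.Ioi d, g t‖ ≤ ∫ t in Set.Ioi d, A * t ^ (-β - 1) :=
        norm_integral_le_of_norm_le
          ((integrableOn_Ioi_rpow_of_lt (by linarith) hd).const_mul _) <| by
          filter_upwards [ae_restrict_mem measurableSet_Ioi] with t ht using hg t (hd.trans ht)
    _ = A / β * d ^ (-β) := by
        rw [integral_const_mul, integral_Ioi_rpow_of_lt (by linarith) hd, sub_add_cancel]
        field_simp

lemma norm_integral_Ioc_one_le {E : Type*} [NormedAddCommGroup E] [NormedSpace ℝ E] {g : ℝ → E}
    {A d : ℝ} (hd : 0 < d) (hd1 : d ≤ 1) (hg : ∀ t : ℝ, 0 < t → ‖g t‖ ≤ A * t⁻¹) :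
    ‖∫ t in Set.Ioc d 1, g t‖ ≤ A * |Real.log d| := by
  have hint : IntegrableOn (fun t : ℝ => A * t⁻¹) (Set.Ioc d 1) := by
    rw [← intervalIntegrable_iff_integrableOn_Ioc_of_le hd1]
    refine (intervalIntegral.intervalIntegrable_inv (fun t ht => ?_) continuousOn_id).const_mul _
    rw [Set.uIcc_of_le hd1] at ht
    exact (hd.trans_le ht.1).ne'
  calc ‖∫ t in Set.Ioc d 1, g t‖ ≤ ∫ t in Set.Ioc d 1, A * t⁻¹ :=
        norm_integral_le_of_norm_le hint <| by
          filter_upwards [ae_restrict_mem measurableSet_Ioc] with t ht using hg t (hd.trans ht.1)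
    _ = A * |Real.log d| := by
        rw [integral_const_mul, ← intervalIntegral.integral_of_le hd1,
          integral_inv_of_pos hd one_pos, abs_of_nonpos (Real.log_nonpos hd.le hd1), one_div,
          Real.log_inv]

/-- Cauchy's estimate on a disc of radius half the distance to the real axis. -/
lemma norm_deriv_le_of_norm_le_rpow {H : ℂ → ℂ} {B b : ℝ} (hb : 0 ≤ b) (hB : 0 ≤ B)
    (hH : DifferentiableOn ℂ H {z | 0 < z.im})
    (hBz : ∀ z : ℂ, 0 < z.im → ‖H z‖ ≤ B * z.im ^ (-b)) {z : ℂ} (hz : 0 < z.im) :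
    ‖deriv H z‖ ≤ B * 2 ^ b * 2 * z.im ^ (-b - 1) := by
  have him (w : ℂ) (hw : w ∈ Metric.closedBall z (z.im / 2)) : z.im / 2 ≤ w.im := by
    have habs := (Complex.abs_im_le_norm (w - z)).trans (mem_closedBall_iff_norm.mp hw)
    rw [Complex.sub_im] at habs
    linarith [(abs_le.mp habs).1]
  have hcauchy : ‖deriv H z‖ ≤ B * (z.im / 2) ^ (-b) / (z.im / 2) := by
    refine Complex.norm_deriv_le_of_forall_mem_sphere_norm_le (half_pos hz)
      (DifferentiableOn.diffContOnCl_ball hH fun w hw => (half_pos hz).trans_le (him w hw))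
      fun w hw => ?_
    have hw' := him w (Metric.sphere_subset_closedBall hw)
    refine (hBz w ((half_pos hz).trans_le hw')).trans ?_
    gcongr B * ?_
    exact Real.rpow_le_rpow_of_nonpos (half_pos hz) hw' (neg_nonpos.mpr hb)
  refine hcauchy.trans_eq ?_
  rw [Real.div_rpow hz.le zero_le_two, Real.rpow_neg zero_le_two, Real.rpow_sub_one hz.ne']
  field_simp

lemma norm_sub_horizontal_le_of_norm_le_rpow {H : ℂ → ℂ} {B b : ℝ} (hb : 0 ≤ b) (hB : 0 ≤ B)
    (hH : DifferentiableOn ℂ H {z | 0 < z.im})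
    (hBz : ∀ z : ℂ, 0 < z.im → ‖H z‖ ≤ B * z.im ^ (-b)) (x x' : ℝ) {t : ℝ} (ht : 0 < t) :
    ‖H (x + t * Complex.I) - H (x' + t * Complex.I)‖ ≤
      B * 2 ^ b * 2 * t ^ (-b - 1) * |x - x'| := by
  have hmem (y : ℝ) : (y : ℂ) + t * Complex.I ∈ {z : ℂ | t ≤ z.im} := by simp
  have hpos {z : ℂ} (hz : t ≤ z.im) : {z : ℂ | 0 < z.im} ∈ 𝓝 z :=
    (isOpen_lt continuous_const Complex.continuous_im).mem_nhds (ht.trans_le hz)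
  have hdist : ((x : ℂ) + t * Complex.I) - (x' + t * Complex.I) = ((x - x' : ℝ) : ℂ) := by
    push_cast
    ring
  have hmv := (convex_halfSpace_im_ge t).norm_image_sub_le_of_norm_deriv_le (𝕜 := ℂ) (f := H)
    (C := B * 2 ^ b * 2 * t ^ (-b - 1)) (fun z hz => hH.differentiableAt (hpos hz))
    (fun z hz => ?_) (hmem x') (hmem x)
  · rwa [hdist, Complex.norm_real, Real.norm_eq_abs] at hmv
  · refine (norm_deriv_le_of_norm_le_rpow hb hB hH hBz (ht.trans_le hz)).trans ?_
    gcongr _ * ?_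
    exact Real.rpow_le_rpow_of_nonpos ht hz (by linarith)

namespace IsFourierExpansion

variable {m κ a : ℝ} {c : ℕ → ℂ} {H : ℂ → ℂ}

lemma exists_norm_mul_sub_le (h : IsFourierExpansion m κ a c H) (α : ℝ) :
    ∃ C : ℝ, 0 ≤ C ∧ ∀ x x' t : ℝ, 0 < t →
      ‖((t ^ (α - 1) : ℝ) : ℂ) * (H (x + t * Complex.I) - H (x' + t * Complex.I))‖ ≤
        C * t ^ (α - a - 1) := by
  obtain ⟨B, hB, hBz⟩ := h.bound
  refine ⟨2 * B, by positivity, fun x x' t ht => ?_⟩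
  have hpt (y : ℝ) : ‖H (y + t * Complex.I)‖ ≤ B * t ^ (-a) := by
    simpa using hBz (y + t * Complex.I) (by simpa using ht)
  rw [norm_mul, Complex.norm_real, Real.norm_of_nonneg (by positivity),
    show α - a - 1 = (α - 1) + -a by ring, Real.rpow_add ht]
  calc t ^ (α - 1) * ‖H (x + t * Complex.I) - H (x' + t * Complex.I)‖
      ≤ t ^ (α - 1) * (B * t ^ (-a) + B * t ^ (-a)) := by
        gcongr
        exact (norm_sub_le _ _).trans (add_le_add (hpt x) (hpt x'))
    _ = 2 * B * (t ^ (α - 1) * t ^ (-a)) := by ring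

lemma exists_norm_mul_sub_le_mul_abs_sub (h : IsFourierExpansion m κ a c H) {b : ℝ} (hab : a ≤ b)
    (α : ℝ) : ∃ C : ℝ, 0 ≤ C ∧ ∀ x x' t : ℝ, 0 < t →
      ‖((t ^ (α - 1) : ℝ) : ℂ) * (H (x + t * Complex.I) - H (x' + t * Complex.I))‖ ≤
        C * |x - x'| * t ^ (α - b - 2) := by
  obtain ⟨B, hB, hBz⟩ := (h.mono hab).bound
  refine ⟨B * 2 ^ b * 2, by positivity, fun x x' t ht => ?_⟩
  rw [norm_mul, Complex.norm_real, Real.norm_of_nonneg (by positivity),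
    show α - b - 2 = (α - 1) + (-b - 1) by ring, Real.rpow_add ht]
  refine (mul_le_mul_of_nonneg_left (norm_sub_horizontal_le_of_norm_le_rpow
    (h.a_pos.le.trans hab) hB.le h.holo hBz x x' ht) (by positivity)).trans_eq ?_
  ring

lemma integrableOn_mul_sub (h : IsFourierExpansion m κ a c H) {α : ℝ} (hα : a < α) (x x' : ℝ) :
    IntegrableOn (fun t : ℝ => ((t ^ (α - 1) : ℝ) : ℂ) *
      (H (x + t * Complex.I) - H (x' + t * Complex.I))) (Set.Ioi 0) := by
  simp_rw [mul_sub]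
  exact (h.integrableOn_vertical hα x).sub (h.integrableOn_vertical hα x')

lemma norm_fracLimit_sub_le (h : IsFourierExpansion m κ a c H) {α : ℝ} (hα : a < α) (x x' : ℝ)
    {d : ℝ} (hd : 0 ≤ d) :
    ‖fracLimit m α H x - fracLimit m α H x'‖ ≤ |(2 * π / m) ^ α / Real.Gamma α| *
      (‖∫ t in Set.Ioc 0 d, ((t ^ (α - 1) : ℝ) : ℂ) *
          (H (x + t * Complex.I) - H (x' + t * Complex.I))‖ +
        ‖∫ t in Set.Ioi d, ((t ^ (α - 1) : ℝ) : ℂ) *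
          (H (x + t * Complex.I) - H (x' + t * Complex.I))‖) := by
  have hint := h.integrableOn_mul_sub hα x x'
  rw [fracLimit, fracLimit, ← mul_sub, ← integral_sub (h.integrableOn_vertical hα x)
    (h.integrableOn_vertical hα x'), norm_mul, Complex.norm_real, Real.norm_eq_abs]
  simp_rw [← mul_sub]
  rw [← Set.Ioc_union_Ioi_eq_Ioi hd] at hint ⊢
  rw [setIntegral_union (Set.Ioc_disjoint_Ioi le_rfl) measurableSet_Ioi
    hint.left_of_union hint.right_of_union]
  gcongr
  exact norm_add_le _ _

theorem exists_norm_fracLimit_sub_le_rpow (h : IsFourierExpansion m κ a c H) {α : ℝ} (hα : a < α)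
    (hα1 : α - a < 1) :
    ∃ C : ℝ, ∀ x x' : ℝ,
      ‖fracLimit m α H x - fracLimit m α H x'‖ ≤ C * |x - x'| ^ (α - a) := by
  have hβ : 0 < α - a := sub_pos.mpr hα
  obtain ⟨C₁, -, hC₁⟩ := h.exists_norm_mul_sub_le α
  obtain ⟨C₂, -, hC₂⟩ := h.exists_norm_mul_sub_le_mul_abs_sub le_rfl α
  refine ⟨|(2 * π / m) ^ α / Real.Gamma α| * (C₁ / (α - a) + C₂ / (1 - (α - a))),
    fun x x' => ?_⟩
  rcases eq_or_ne x x' with rfl | hne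
  · simp [Real.zero_rpow hβ.ne']
  have hd : 0 < |x - x'| := abs_pos.mpr (sub_ne_zero.mpr hne)
  have hnear := norm_integral_Ioc_zero_le hβ hd.le (hC₁ x x')
  have hfar := norm_integral_Ioi_le (β := 1 - (α - a)) (by linarith) hd
    (fun t ht => by convert hC₂ x x' t ht using 3; ring)
  refine (h.norm_fracLimit_sub_le hα x x' hd.le).trans ?_
  rw [mul_assoc]
  gcongr
  refine (add_le_add hnear hfar).trans_eq ?_
  rw [neg_sub, Real.rpow_sub_one hd.ne']
  field_simp

lemma exists_norm_integral_Ioi_le_log (h : IsFourierExpansion m κ a c H) :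
    ∃ C C' : ℝ, 0 ≤ C' ∧ ∀ x x' d : ℝ, 0 < d → d ≤ 1 →
      ‖∫ t in Set.Ioi d, ((t ^ (a + 1 - 1) : ℝ) : ℂ) *
          (H (x + t * Complex.I) - H (x' + t * Complex.I))‖ ≤
        C * |x - x'| * |Real.log d| + C' * |x - x'| := by
  obtain ⟨C₁, -, hC₁⟩ := h.exists_norm_mul_sub_le_mul_abs_sub le_rfl (a + 1)
  obtain ⟨C₂, hC₂0, hC₂⟩ :=
    h.exists_norm_mul_sub_le_mul_abs_sub (le_add_of_nonneg_right zero_le_one) (a + 1)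
  refine ⟨C₁, C₂, hC₂0, fun x x' d hd hd1 => ?_⟩
  have hmiddle := norm_integral_Ioc_one_le hd hd1 (A := C₁ * |x - x'|) fun t ht => by
    rw [← Real.rpow_neg_one]
    convert hC₁ x x' t ht using 3
    ring
  have hfar := norm_integral_Ioi_le (A := C₂ * |x - x'|) one_pos one_pos fun t ht => by
    convert hC₂ x x' t ht using 3
    ring
  rw [Real.one_rpow, div_one, mul_one] at hfar
  have hint := (h.integrableOn_mul_sub (lt_add_one a) x x').mono_set (Set.Ioi_subset_Ioi hd.le)
  rw [← Set.Ioc_union_Ioi_eq_Ioi hd1] at hint ⊢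
  rw [setIntegral_union (Set.Ioc_disjoint_Ioi le_rfl) measurableSet_Ioi
    hint.left_of_union hint.right_of_union]
  exact (norm_add_le _ _).trans (add_le_add hmiddle hfar)

theorem exists_norm_fracLimit_sub_le_log (h : IsFourierExpansion m κ a c H) :
    ∃ C : ℝ, ∀ x x' : ℝ, |x - x'| ≤ 1 / 2 →
      ‖fracLimit m (a + 1) H x - fracLimit m (a + 1) H x'‖ ≤
        C * (|x - x'| * |Real.log (|x - x'|)|) := by
  obtain ⟨C₁, hC₁0, hC₁⟩ := h.exists_norm_mul_sub_le (a + 1)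
  obtain ⟨C₂, C₃, hC₃0, hC₃⟩ := h.exists_norm_integral_Ioi_le_log
  refine ⟨|(2 * π / m) ^ (a + 1) / Real.Gamma (a + 1)| * (C₂ + (C₁ + C₃) / Real.log 2),
    fun x x' hxx => ?_⟩
  rcases eq_or_ne x x' with rfl | hne
  · simp
  have hd : 0 < |x - x'| := abs_pos.mpr (sub_ne_zero.mpr hne)
  have hlog2 : 0 < Real.log 2 := Real.log_pos one_lt_two
  have hlog : Real.log 2 ≤ |Real.log (|x - x'|)| := by
    rw [abs_of_nonpos (Real.log_nonpos hd.le (by linarith)), ← Real.log_inv]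
    refine Real.log_le_log two_pos ?_
    rw [le_inv_comm₀ two_pos hd]
    linarith
  have hnear := norm_integral_Ioc_zero_le (sub_pos.mpr (lt_add_one a)) hd.le (hC₁ x x')
  rw [add_sub_cancel_left, div_one, Real.rpow_one] at hnear
  have hfar := hC₃ x x' |x - x'| hd (by linarith)
  have hlinear : (C₁ + C₃) * |x - x'| ≤
      (C₁ + C₃) / Real.log 2 * (|x - x'| * |Real.log (|x - x'|)|) := by
    rw [div_mul_eq_mul_div, le_div_iff₀ hlog2, mul_assoc]
    gcongr
  refine (h.norm_fracLimit_sub_le (lt_add_one a) x x' hd.le).trans ?_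
  rw [mul_assoc]
  gcongr
  linear_combination hnear + hfar + hlinear

theorem memCk_fracLimit (h : IsFourierExpansion m κ a c H) {α : ℝ} (hα : a < α)
    (hj : ∀ j : ℤ, α - a ≠ j) :
    MemCk ⌊α - a⌋₊ (Int.fract (α - a)) (fracLimit m α H) Set.univ := by
  set k := ⌊α - a⌋₊ with hk
  have hfract : Int.fract (α - a) = α - k - a := by
    rw [Int.fract, ← natCast_floor_eq_intCast_floor (sub_nonneg.mpr hα.le), ← hk]
    ring
  have hfract_ne : Int.fract (α - a) ≠ 0 := fun h0 =>
    let ⟨j, hj'⟩ := Int.fract_eq_zero_iff.mp h0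
    hj j hj'.symm
  have hαk : a < α - k := by linarith [(Int.fract_nonneg (α - a)).lt_of_ne' hfract_ne]
  refine ⟨(h.continuous_fracLimit hα).continuousOn, h.hasDerivsOn_fracLimit k hαk,
    fun K _ _ => ?_⟩
  rw [h.iteratedDeriv_fracLimit k hαk]
  refine ⟨(continuous_const.mul (h.continuous_fracLimit hαk)).continuousOn, ?_⟩
  obtain ⟨C, hC⟩ := h.exists_norm_fracLimit_sub_le_rpow hαk (hfract ▸ Int.fract_lt_one _)
  refine ⟨‖(2 * π * Complex.I / m : ℂ) ^ k‖ * C, fun x _ y _ => ?_⟩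
  rw [← mul_sub, norm_mul, mul_assoc ‖_‖, hfract]
  gcongr
  exact hC x y

theorem memCkLog_fracLimit (h : IsFourierExpansion m κ a c H) {α : ℝ} {k : ℕ}
    (hk : α - a = (k : ℝ) + 1) :
    MemCkLog k 1 (fracLimit m α H) Set.univ := by
  have hαk : a < α - k := by linarith
  have hα : a < α := by linarith [Nat.cast_nonneg (α := ℝ) k]
  refine ⟨(h.continuous_fracLimit hα).continuousOn, h.hasDerivsOn_fracLimit k hαk,
    fun K _ _ => ?_⟩
  rw [h.iteratedDeriv_fracLimit k hαk]
  refine ⟨(continuous_const.mul (h.continuous_fracLimit hαk)).continuousOn, ?_⟩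
  obtain ⟨C, hC⟩ := h.exists_norm_fracLimit_sub_le_log
  refine ⟨‖(2 * π * Complex.I / m : ℂ) ^ k‖ * C, fun x _ y _ hxy => ?_⟩
  rw [← mul_sub, norm_mul, mul_assoc ‖_‖, Real.rpow_one, show α - k = a + 1 by linarith]
  gcongr
  exact hC x y hxy

end IsFourierExpansion

/-- Toeplitz's lemma. -/
lemma tendsto_zero_of_tendsto_sum_mul {ι : Type*} {L : Filter ι} {D : ℕ → ℂ} {w : ι → ℕ → ℂ}
    {T : ι → ℂ} {M : ℝ} (hD : Tendsto D atTop (𝓝 0)) (hw : ∀ n, Tendsto (w · n) L (𝓝 0))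
    (hM : ∀ᶠ i in L, ∀ N, ∑ n ∈ Finset.range N, ‖w i n‖ ≤ M)
    (hT : ∀ᶠ i in L, Tendsto (fun N => ∑ n ∈ Finset.range N, D n * w i n) atTop (𝓝 (T i))) :
    Tendsto T L (𝓝 0) := by
  rw [Metric.tendsto_nhds]
  intro ε hε
  set η := ε / (2 * (|M| + 1)) with hη
  have hη0 : 0 < η := by positivity
  have hηM : η * M < ε := by
    rw [hη, div_mul_eq_mul_div, div_lt_iff₀ (by positivity)]
    nlinarith [le_abs_self M, abs_nonneg M]
  obtain ⟨P, hP⟩ := eventually_atTop.mp (hD.norm.eventually (gt_mem_nhds (by simpa using hη0)))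
  have hhead : Tendsto (fun i => ∑ n ∈ Finset.range P, ‖D n * w i n‖ + η * M) L (𝓝 (η * M)) := by
    simpa using (tendsto_finsetSum (Finset.range P) fun n _ =>
      ((hw n).const_mul (D n)).norm).add_const (η * M)
  filter_upwards [hhead.eventually (gt_mem_nhds hηM), hM, hT] with i hi hMi hTi
  rw [dist_zero_right]
  refine (le_of_tendsto hTi.norm ?_).trans_lt hi
  filter_upwards [eventually_ge_atTop P] with N hN
  refine (norm_sum_le _ _).trans ?_
  rw [← Finset.sum_range_add_sum_Ico _ hN]
  gcongr
  calc ∑ n ∈ Finset.Ico P N, ‖D n * w i n‖ ≤ ∑ n ∈ Finset.Ico P N, η * ‖w i n‖ := by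
        refine Finset.sum_le_sum fun n hn => ?_
        rw [norm_mul]
        gcongr
        exact (hP n (Finset.mem_Ico.mp hn).1).le
    _ ≤ η * ∑ n ∈ Finset.range N, ‖w i n‖ := by
        rw [← Finset.mul_sum]
        gcongr
        exact fun n hn => Finset.mem_range.mpr (Finset.mem_Ico.mp hn).2
    _ ≤ η * M := by
        gcongr
        exact hMi N

lemma sum_range_mul_by_parts (b p : ℕ → ℂ) (l : ℂ) (N : ℕ) :
    ∑ n ∈ Finset.range N, b n * p n =
      (∑ n ∈ Finset.range N, b n - l) * p N + l * p 0 +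
        ∑ n ∈ Finset.range N, (∑ k ∈ Finset.range (n + 1), b k - l) * (p n - p (n + 1)) := by
  induction N with
  | zero => simp
  | succ N ih =>
    simp only [Finset.sum_range_succ _ N, ih]
    ring

lemma sum_norm_sub_le_of_eVariationOn {φ : ℝ → ℝ} (hφ : BoundedVariationOn φ (Set.Ici 0))
    {u : ℕ → ℝ} (hu : Monotone u) (hu0 : ∀ n, 0 ≤ u n) (N : ℕ) :
    ∑ n ∈ Finset.range N, ‖(φ (u n) : ℂ) - φ (u (n + 1))‖ ≤
      (eVariationOn φ (Set.Ici 0)).toReal := by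
  refine le_of_eq_of_le ?_ (ENNReal.toReal_mono hφ (eVariationOn.sum_le (n := N) hu hu0))
  rw [ENNReal.toReal_sum fun n _ => edist_ne_top _ _]
  refine Finset.sum_congr rfl fun n _ => ?_
  rw [← Complex.ofReal_sub, Complex.norm_real, edist_comm, edist_dist,
    ENNReal.toReal_ofReal dist_nonneg, Real.dist_eq, Real.norm_eq_abs]

/-- The partial sums of `b` are weighted, after summation by parts, by increments of `φ`, whose
`ℓ¹` norm is at most the variation. -/
lemma tendsto_zero_of_hasSum_mul_boundedVariationOn {b : ℕ → ℂ} {l : ℂ}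
    (hb : Tendsto (fun N => ∑ n ∈ Finset.range N, b n) atTop (𝓝 l))
    {lam : ℕ → ℝ} (hlam0 : ∀ n, 0 ≤ lam n) (hlam : Monotone lam)
    {φ : ℝ → ℝ} (hφ0 : φ 0 = 0) (hφ : ContinuousAt φ 0) (hvar : BoundedVariationOn φ (Set.Ici 0))
    {S : ℝ → ℂ} (hS : ∀ y, 0 < y → HasSum (fun n => b n * (φ (lam n * y) : ℂ)) (S y)) :
    Tendsto S (𝓝[>] 0) (𝓝 0) := by
  have hφlim (n : ℕ) : Tendsto (fun y : ℝ => (φ (lam n * y) : ℂ)) (𝓝[>] 0) (𝓝 0) := by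
    have hlin : Tendsto (fun y : ℝ => lam n * y) (𝓝[>] 0) (𝓝 0) :=
      ((by fun_prop : Continuous fun y : ℝ => lam n * y).tendsto' 0 0 (mul_zero _)).mono_left
        nhdsWithin_le_nhds
    have hcomp := (Complex.continuous_ofReal.tendsto _).comp (hφ.tendsto.comp hlin)
    rwa [hφ0] at hcomp
  have hD : Tendsto (fun N => ∑ n ∈ Finset.range N, b n - l) atTop (𝓝 0) := by
    simpa using hb.sub_const l
  have hparts : Tendsto (fun y => S y - l * φ (lam 0 * y)) (𝓝[>] 0) (𝓝 0) := by
    refine tendsto_zero_of_tendsto_sum_mul ((tendsto_add_atTop_iff_nat 1).mpr hD)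
      (w := fun y n => (φ (lam n * y) : ℂ) - φ (lam (n + 1) * y))
      (M := (eVariationOn φ (Set.Ici 0)).toReal)
      (fun n => by simpa using (hφlim n).sub (hφlim (n + 1))) ?_ ?_ <;>
    filter_upwards [self_mem_nhdsWithin] with y hy
    · exact sum_norm_sub_le_of_eVariationOn hvar
        (fun n k hnk => mul_le_mul_of_nonneg_right (hlam hnk) (Set.mem_Ioi.mp hy).le)
        fun n => mul_nonneg (hlam0 n) (Set.mem_Ioi.mp hy).le
    · have hbd : IsBoundedUnder (· ≤ ·) atTop fun N => ‖(φ (lam N * y) : ℂ)‖ := by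
        refine isBoundedUnder_of ⟨(eVariationOn φ (Set.Ici 0)).toReal, fun N => ?_⟩
        have hdist := hvar.dist_le (x := lam N * y) (y := 0)
          (mul_nonneg (hlam0 N) (Set.mem_Ioi.mp hy).le) Set.self_mem_Ici
        rwa [hφ0, dist_zero_right, ← Complex.norm_real] at hdist
      have hlim := ((hS y hy).tendsto_sum_nat.sub_const (l * φ (lam 0 * y))).sub
        (hD.zero_mul_isBoundedUnder_le hbd)
      rw [sub_zero] at hlim
      refine hlim.congr fun N => ?_
      rw [sum_range_mul_by_parts b _ l]
      ring
  simpa using hparts.add ((hφlim 0).const_mul l)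

/-- The density `t ^ α * e ^ (-t)` of the Gamma integral for `Γ(α + 1)`. -/
noncomputable def gammaWeight (α t : ℝ) : ℝ := t ^ α * Real.exp (-t)

lemma gammaWeight_nonneg (α : ℝ) {t : ℝ} (ht : 0 ≤ t) : 0 ≤ gammaWeight α t := by
  unfold gammaWeight
  positivity

lemma continuous_gammaWeight {α : ℝ} (hα : 0 < α) : Continuous (gammaWeight α) :=
  (Real.continuous_rpow_const hα.le).mul (by fun_prop)

lemma hasDerivAt_gammaWeight {α t : ℝ} (ht : 0 < t) :
    HasDerivAt (gammaWeight α) (t ^ (α - 1) * Real.exp (-t) * (α - t)) t := by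
  refine ((Real.hasDerivAt_rpow_const (p := α) (Or.inl ht.ne')).mul
    (hasDerivAt_neg t).exp).congr_deriv ?_
  rw [Real.rpow_sub_one ht.ne']
  field_simp
  ring

lemma monotoneOn_gammaWeight {α : ℝ} (hα : 0 < α) :
    MonotoneOn (gammaWeight α) (Set.Icc 0 α) := by
  refine monotoneOn_of_hasDerivWithinAt_nonneg (convex_Icc 0 α)
    (continuous_gammaWeight hα).continuousOn
    (f' := fun t => t ^ (α - 1) * Real.exp (-t) * (α - t)) ?_ ?_ <;>
  rw [interior_Icc] <;> intro t ht
  · exact (hasDerivAt_gammaWeight ht.1).hasDerivWithinAt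
  · have ht0 : 0 < t := ht.1
    have htα : 0 ≤ α - t := sub_nonneg.mpr ht.2.le
    positivity

lemma antitoneOn_gammaWeight {α : ℝ} (hα : 0 < α) :
    AntitoneOn (gammaWeight α) (Set.Ici α) := by
  refine antitoneOn_of_hasDerivWithinAt_nonpos (convex_Ici α)
    (continuous_gammaWeight hα).continuousOn
    (f' := fun t => t ^ (α - 1) * Real.exp (-t) * (α - t)) ?_ ?_ <;>
  rw [interior_Ici] <;> intro t ht
  · exact (hasDerivAt_gammaWeight (hα.trans ht)).hasDerivWithinAt
  · have ht0 : 0 < t := hα.trans ht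
    exact mul_nonpos_of_nonneg_of_nonpos (by positivity) (sub_nonpos.mpr (Set.mem_Ioi.mp ht).le)

lemma boundedVariationOn_gammaWeight {α : ℝ} (hα : 0 < α) :
    BoundedVariationOn (gammaWeight α) (Set.Ici 0) := by
  have hmono := monotoneOn_gammaWeight hα
  have hanti := antitoneOn_gammaWeight hα
  have hleft : BoundedVariationOn (gammaWeight α) (Set.Icc 0 α) :=
    hmono.boundedVariationOn (C := gammaWeight α α) fun t ht => by
      rw [abs_of_nonneg (gammaWeight_nonneg α ht.1)]
      exact hmono ht (Set.right_mem_Icc.mpr hα.le) ht.2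
  have hright : BoundedVariationOn (gammaWeight α) (Set.Ici α) := by
    have hneg : BoundedVariationOn (-gammaWeight α) (Set.Ici α) :=
      hanti.neg.boundedVariationOn (C := gammaWeight α α) fun t ht => by
        rw [Pi.neg_apply, abs_neg, abs_of_nonneg (gammaWeight_nonneg α (hα.le.trans ht))]
        exact hanti Set.self_mem_Ici ht ht
    simpa [Function.comp_def] using
      (LipschitzWith.id (α := ℝ)).neg.comp_boundedVariationOn hneg
  rw [BoundedVariationOn, ← Set.Icc_union_Ici_eq_Ici hα.le,
    eVariationOn.union _ (isGreatest_Icc hα.le) isLeast_Ici]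
  exact ENNReal.add_ne_top.mpr ⟨hleft, hright⟩

namespace IsFourierExpansion

variable {m κ a : ℝ} {c : ℕ → ℂ} {H : ℂ → ℂ}

lemma hasSum_gammaWeight (h : IsFourierExpansion m κ a c H) (α x : ℝ) {y : ℝ} (hy : 0 < y) :
    HasSum (fun n : ℕ => c n / ((((n : ℝ) + κ) ^ α : ℝ) : ℂ) * expMode m κ n x *
      (gammaWeight α (2 * π / m * (n + κ) * y) : ℂ))
      ((((2 * π / m) ^ α * y ^ α : ℝ) : ℂ) * H (x + y * Complex.I)) := by
  have hm := h.m_pos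
  refine ((h.hasSum (x + y * Complex.I) (by simpa using hy)).mul_left
    (((2 * π / m) ^ α * y ^ α : ℝ) : ℂ)).congr_fun fun n => ?_
  by_cases hn : 0 < (n : ℝ) + κ
  · have hweight : gammaWeight α (2 * π / m * (n + κ) * y) =
        (n + κ) ^ α * ((2 * π / m) ^ α * y ^ α * Real.exp (-(2 * π * (n + κ) / m * y))) := by
      rw [gammaWeight, Real.mul_rpow (by positivity) hy.le, Real.mul_rpow (by positivity) hn.le]
      ring_nf
    have hpow : ((((n : ℝ) + κ) ^ α : ℝ) : ℂ) ≠ 0 := by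
      exact_mod_cast (Real.rpow_pos_of_pos hn _).ne'
    rw [hweight, expMode_add_mul_I, Complex.ofReal_mul (_ ^ α) (_ * _), Complex.ofReal_mul (_ * _)]
    field_simp
  · simp [h.coeff_eq_zero n hn]

theorem tendsto_rpow_mul_norm_of_tendsto_fracPartial (h : IsFourierExpansion m κ a c H) {α : ℝ}
    (hα : 0 < α) {x : ℝ} {l : ℂ}
    (hl : Tendsto (fun N => fracPartial m κ α c N x) atTop (𝓝 l)) :
    Tendsto (fun y : ℝ => y ^ α * ‖H (x + y * Complex.I)‖) (𝓝[>] 0) (𝓝 0) := by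
  have hm := h.m_pos
  have hκ := h.κ_nonneg
  have hlim : Tendsto (fun y : ℝ => (((2 * π / m) ^ α * y ^ α : ℝ) : ℂ) * H (x + y * Complex.I))
      (𝓝[>] 0) (𝓝 0) :=
    tendsto_zero_of_hasSum_mul_boundedVariationOn (lam := fun n => 2 * π / m * (n + κ)) hl
      (fun n => by positivity) (fun n k hnk => by dsimp only; gcongr)
      (by simp [gammaWeight, hα.ne']) (continuous_gammaWeight hα).continuousAt
      (boundedVariationOn_gammaWeight hα) fun y hy => h.hasSum_gammaWeight α x hy
  have hscaled := hlim.norm.const_mul ((2 * π / m) ^ α)⁻¹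
  rw [norm_zero, mul_zero] at hscaled
  refine hscaled.congr' ?_
  filter_upwards [self_mem_nhdsWithin] with y hy
  have hyα : 0 ≤ y ^ α := Real.rpow_nonneg (Set.mem_Ioi.mp hy).le α
  rw [norm_mul, Complex.norm_real, Real.norm_of_nonneg (by positivity)]
  field_simp

end IsFourierExpansion

/-! ### Fourier inversion of the Gamma weight -/

lemma analyticOnNhd_integral_mul_cexp {μ : Measure ℝ} {g : ℝ → ℝ} {b : ℝ} (hg : Measurable g)
    (hg0 : ∀ᵐ t ∂μ, 0 ≤ g t) (hint : ∀ s < b, Integrable (fun t => g t * Real.exp (s * t)) μ) :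
    AnalyticOnNhd ℂ (fun z : ℂ => ∫ t, (g t : ℂ) * Complex.exp (z * t) ∂μ) {z | z.re < b} := by
  set ν : Measure ℝ := μ.withDensity fun t => ((g t).toNNReal : ENNReal) with hν
  have hdensity : Measurable fun t => (g t).toNNReal := hg.real_toNNReal
  have hset : Set.Iio b ⊆ ProbabilityTheory.integrableExpSet id ν := fun s hs => by
    rw [ProbabilityTheory.integrableExpSet, Set.mem_ofPred_eq, hν,
      integrable_withDensity_iff_integrable_smul hdensity]
    refine (hint s hs).congr ?_
    filter_upwards [hg0] with t ht
    simp only [id, NNReal.smul_def, smul_eq_mul, Real.coe_toNNReal _ ht]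
  have hmgf : ProbabilityTheory.complexMGF id ν =
      fun z => ∫ t, (g t : ℂ) * Complex.exp (z * t) ∂μ := by
    ext z
    rw [ProbabilityTheory.complexMGF, hν, integral_withDensity_eq_integral_smul hdensity]
    refine integral_congr_ae ?_
    filter_upwards [hg0] with t ht
    simp only [id, NNReal.smul_def, Complex.real_smul, Real.coe_toNNReal _ ht]
  rw [← hmgf]
  exact ProbabilityTheory.analyticOnNhd_complexMGF.mono fun z hz =>
    interior_maximal hset isOpen_Iio hz

lemma eqOn_of_analyticOnNhd_of_eq_ofReal {F G : ℂ → ℂ} {b : ℝ}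
    (hF : AnalyticOnNhd ℂ F {z | z.re < b}) (hG : AnalyticOnNhd ℂ G {z | z.re < b})
    (hFG : ∀ s : ℝ, s < b → F s = G s) : Set.EqOn F G {z | z.re < b} := by
  have hreal : Tendsto (fun s : ℝ => (s : ℂ)) (𝓝[≠] (b - 1)) (𝓝[≠] ((b - 1 : ℝ) : ℂ)) :=
    Complex.continuous_ofReal.continuousWithinAt.tendsto_nhdsWithin
      fun s hs => Complex.ofReal_injective.ne hs
  refine hF.eqOn_of_preconnected_of_frequently_eq hG (convex_halfSpace_re_lt b).isPreconnected
    (by simp : ((b - 1 : ℝ) : ℂ) ∈ {z : ℂ | z.re < b}) (hreal.frequently ?_)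
  refine Eventually.frequently ?_
  filter_upwards [nhdsWithin_le_nhds (Iio_mem_nhds (sub_one_lt b))] with s hs using hFG s hs

lemma integrableOn_gammaWeight_mul_exp {α s : ℝ} (hα : 0 < α) (hs : s < 1) :
    IntegrableOn (fun t : ℝ => gammaWeight α t * Real.exp (s * t)) (Set.Ioi 0) := by
  refine (integrableOn_rpow_mul_exp_neg_mul (s := α + 1) (b := 1 - s) (by linarith)
    (by linarith)).congr (Eventually.of_forall fun t => ?_)
  simp only [gammaWeight, add_sub_cancel_right]
  rw [mul_assoc, ← Real.exp_add]
  ring_nf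

lemma integral_gammaWeight_mul_exp {α s : ℝ} (hα : 0 < α) (hs : s < 1) :
    ∫ t in Set.Ioi (0 : ℝ), gammaWeight α t * Real.exp (s * t) =
      Real.Gamma (α + 1) * (1 - s) ^ (-(α + 1)) := by
  have hs1 : 0 < 1 - s := by linarith
  have hexp (t : ℝ) : gammaWeight α t * Real.exp (s * t) =
      t ^ (α + 1 - 1) * Real.exp (-((1 - s) * t)) := by
    rw [gammaWeight, mul_assoc, ← Real.exp_add]
    ring_nf
  simp_rw [hexp]
  rw [Real.integral_rpow_mul_exp_neg_mul_Ioi (by linarith) hs1, one_div, Real.inv_rpow hs1.le,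
    ← Real.rpow_neg hs1.le, mul_comm]

lemma integral_gammaWeight_mul_cexp {α : ℝ} (hα : 0 < α) {z : ℂ} (hz : z.re < 1) :
    ∫ t in Set.Ioi (0 : ℝ), (gammaWeight α t : ℂ) * Complex.exp (z * t) =
      Real.Gamma (α + 1) * (1 - z) ^ (-(α + 1) : ℂ) := by
  have hleft := analyticOnNhd_integral_mul_cexp (μ := volume.restrict (Set.Ioi 0))
    (continuous_gammaWeight hα).measurable
    ((ae_restrict_mem measurableSet_Ioi).mono fun t ht => gammaWeight_nonneg α (le_of_lt ht))
    fun s hs => integrableOn_gammaWeight_mul_exp hα hs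
  have hright : AnalyticOnNhd ℂ (fun w : ℂ => Real.Gamma (α + 1) * (1 - w) ^ (-(α + 1) : ℂ))
      {w | w.re < 1} := by
    refine DifferentiableOn.analyticOnNhd (fun w hw => ?_)
      (isOpen_lt Complex.continuous_re continuous_const)
    have hslit : 1 - w ∈ Complex.slitPlane := Or.inl (by simpa using hw)
    exact ((DifferentiableAt.cpow_const (by fun_prop) hslit).const_mul _).differentiableWithinAt
  refine eqOn_of_analyticOnNhd_of_eq_ofReal hleft hright (fun s hs => ?_) hz
  have hcast := congrArg Complex.ofReal (integral_gammaWeight_mul_exp hα hs)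
  rw [← integral_complex_ofReal, Complex.ofReal_mul, Complex.ofReal_cpow (sub_pos.mpr hs).le]
    at hcast
  exact_mod_cast hcast

/-- The weight `t ^ α * e ^ (-t)` on the positive half-line, extended by zero. -/
noncomputable def gammaCut (α t : ℝ) : ℂ := gammaWeight α (max t 0)

lemma gammaCut_of_nonpos {α t : ℝ} (hα : 0 < α) (ht : t ≤ 0) : gammaCut α t = 0 := by
  simp [gammaCut, gammaWeight, max_eq_right ht, hα.ne']

lemma gammaCut_of_nonneg {α t : ℝ} (ht : 0 ≤ t) : gammaCut α t = gammaWeight α t := by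
  rw [gammaCut, max_eq_left ht]

lemma continuous_gammaCut {α : ℝ} (hα : 0 < α) : Continuous (gammaCut α) :=
  Complex.continuous_ofReal.comp
    ((continuous_gammaWeight hα).comp (continuous_id.max continuous_const))

lemma gammaCut_eq_indicator {α : ℝ} (hα : 0 < α) :
    gammaCut α = (Set.Ioi 0).indicator fun t => (gammaWeight α t : ℂ) := by
  ext t
  rcases le_or_gt t 0 with ht | ht
  · rw [gammaCut_of_nonpos hα ht, Set.indicator_of_notMem (by simpa using ht)]
  · rw [gammaCut_of_nonneg ht.le, Set.indicator_of_mem (by simpa using ht)]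

lemma integrable_gammaCut {α : ℝ} (hα : 0 < α) : Integrable (gammaCut α) := by
  rw [gammaCut_eq_indicator hα, integrable_indicator_iff measurableSet_Ioi]
  simpa using! (integrableOn_gammaWeight_mul_exp hα zero_lt_one).ofReal (𝕜 := ℂ)

/-- The Fourier transform of `gammaCut`. -/
noncomputable def gammaKernel (α w : ℝ) : ℂ :=
  Real.Gamma (α + 1) * (1 + 2 * π * w * Complex.I) ^ (-(α + 1) : ℂ)

lemma one_add_mul_I_mem_slitPlane (w : ℝ) : 1 + 2 * π * w * Complex.I ∈ Complex.slitPlane :=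
  Or.inl (by simp)

lemma fourier_gammaCut {α : ℝ} (hα : 0 < α) :
    FourierTransform.fourier (gammaCut α) = gammaKernel α := by
  ext w
  have hindicator (v : ℝ) : Complex.exp (((-2 * π * v * w : ℝ) : ℂ) * Complex.I) • gammaCut α v =
      (Set.Ioi (0 : ℝ)).indicator (fun v => (gammaWeight α v : ℂ) *
        Complex.exp (-(2 * π * w * Complex.I) * v)) v := by
    rw [gammaCut_eq_indicator hα, Set.indicator_apply, Set.indicator_apply, smul_ite, smul_zero,
      smul_eq_mul, mul_comm]
    push_cast
    ring_nf
  simp_rw [Real.fourier_real_eq_integral_exp_smul, hindicator]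
  rw [integral_indicator measurableSet_Ioi,
    integral_gammaWeight_mul_cexp hα (by simp), gammaKernel, sub_neg_eq_add]

lemma continuous_gammaKernel (α : ℝ) : Continuous (gammaKernel α) :=
  continuous_const.mul
    (Continuous.cpow (by fun_prop) continuous_const one_add_mul_I_mem_slitPlane)

lemma norm_gammaKernel_le {α : ℝ} (hα : 0 < α) (w : ℝ) :
    ‖gammaKernel α w‖ ≤ Real.Gamma (α + 1) * (1 + ‖w‖ ^ 2) ^ (-(α + 1) / 2) := by
  have hΓ := Real.Gamma_pos_of_pos (by linarith : 0 < α + 1)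
  have hcpow : ‖(1 + 2 * π * w * Complex.I) ^ (-(α + 1) : ℂ)‖ =
      ‖1 + 2 * π * w * Complex.I‖ ^ (-(α + 1)) := by
    exact_mod_cast Complex.norm_cpow_real _ (-(α + 1))
  have hbase : (1 + ‖w‖ ^ 2) ^ ((1 : ℝ) / 2) ≤ ‖1 + 2 * π * w * Complex.I‖ := by
    rw [← Real.sqrt_eq_rpow, Complex.norm_eq_sqrt_sq_add_sq]
    refine Real.sqrt_le_sqrt ?_
    have hsq : w ^ 2 ≤ (2 * π * w) ^ 2 := by
      rw [mul_pow]
      exact le_mul_of_one_le_left (sq_nonneg w) (by nlinarith [Real.pi_gt_three])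
    simpa using hsq
  rw [gammaKernel, norm_mul, hcpow, Complex.norm_real, Real.norm_of_nonneg hΓ.le]
  refine mul_le_mul_of_nonneg_left ?_ hΓ.le
  calc ‖1 + 2 * π * w * Complex.I‖ ^ (-(α + 1))
      ≤ ((1 + ‖w‖ ^ 2) ^ ((1 : ℝ) / 2)) ^ (-(α + 1)) :=
        Real.rpow_le_rpow_of_nonpos (by positivity) hbase (by linarith)
    _ = (1 + ‖w‖ ^ 2) ^ (-(α + 1) / 2) := by
        rw [← Real.rpow_mul (by positivity)]
        ring_nf

lemma integrable_rpow_mul_gammaKernel {α β : ℝ} (hα : 0 < α) (hβ : 0 ≤ β) (hβα : β < α) :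
    Integrable fun w : ℝ => |w| ^ β * ‖gammaKernel α w‖ := by
  have hJapanese : Integrable fun w : ℝ => (1 + ‖w‖ ^ 2) ^ (-(α - β + 1) / 2) :=
    integrable_rpow_neg_one_add_norm_sq (by simpa using hβα)
  refine (hJapanese.const_mul (Real.Gamma (α + 1))).mono' (Continuous.aestronglyMeasurable
    (((Real.continuous_rpow_const hβ).comp continuous_abs).mul (continuous_gammaKernel α).norm))
    (Eventually.of_forall fun w => ?_)
  have hpow : |w| ^ β ≤ (1 + ‖w‖ ^ 2) ^ (β / 2) := by
    calc |w| ^ β = (‖w‖ ^ 2) ^ (β / 2) := by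
          rw [← Real.rpow_natCast, ← Real.rpow_mul (norm_nonneg _), Real.norm_eq_abs,
            Nat.cast_ofNat, mul_div_cancel₀ _ two_ne_zero]
      _ ≤ (1 + ‖w‖ ^ 2) ^ (β / 2) := by gcongr; linarith
  rw [Real.norm_of_nonneg (by positivity)]
  calc |w| ^ β * ‖gammaKernel α w‖
      ≤ (1 + ‖w‖ ^ 2) ^ (β / 2) * (Real.Gamma (α + 1) * (1 + ‖w‖ ^ 2) ^ (-(α + 1) / 2)) := by
        gcongr
        exact norm_gammaKernel_le hα w
    _ = Real.Gamma (α + 1) * (1 + ‖w‖ ^ 2) ^ (-(α - β + 1) / 2) := by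
        rw [mul_left_comm, ← Real.rpow_add (by positivity)]
        ring_nf

lemma integrable_gammaKernel {α : ℝ} (hα : 0 < α) : Integrable (gammaKernel α) := by
  have hnorm := integrable_rpow_mul_gammaKernel hα le_rfl hα
  simp only [Real.rpow_zero, one_mul] at hnorm
  exact (integrable_norm_iff (continuous_gammaKernel α).aestronglyMeasurable).mp hnorm

lemma integral_cexp_mul_gammaKernel {α : ℝ} (hα : 0 < α) (v : ℝ) :
    ∫ w : ℝ, Complex.exp ((2 * π * v * w : ℝ) * Complex.I) * gammaKernel α w = gammaCut α v := by
  have hinv := (continuous_gammaCut hα).fourierInv_fourier_eq (integrable_gammaCut hα)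
    (by simpa only [fourier_gammaCut hα] using integrable_gammaKernel hα)
  rw [fourier_gammaCut hα] at hinv
  rw [← congrFun hinv v, Real.fourierInv_eq']
  refine integral_congr_ae (Eventually.of_forall fun w => ?_)
  simp only [smul_eq_mul, RCLike.inner_apply, conj_trivial]
  ring_nf

/-! ### Differentiability and the Gamma transform -/

/-- The average of `U` around `x` at scale `y` against `gammaKernel`. It multiplies `e ^ (i θ u)`
by `gammaCut α (θ y)`, hence annihilates nonpositive frequencies. -/
noncomputable def gammaTransform (α : ℝ) (U : ℝ → ℂ) (x y : ℝ) : ℂ :=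
  ∫ w : ℝ, U (x + 2 * π * y * w) * gammaKernel α w

lemma integrable_mul_gammaKernel {α M : ℝ} (hα : 0 < α) {U : ℝ → ℂ} (hU : Continuous U)
    (hM : ∀ u, ‖U u‖ ≤ M) (x y : ℝ) :
    Integrable fun w : ℝ => U (x + 2 * π * y * w) * gammaKernel α w :=
  (integrable_gammaKernel hα).bdd_mul
    (Continuous.aestronglyMeasurable (hU.comp (by fun_prop))) (Eventually.of_forall fun _ => hM _)

lemma gammaTransform_const_mul (α : ℝ) (p : ℂ) (U : ℝ → ℂ) (x y : ℝ) :
    gammaTransform α (fun u => p * U u) x y = p * gammaTransform α U x y := by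
  simp only [gammaTransform, mul_assoc, integral_const_mul]

lemma gammaTransform_add {α M M' : ℝ} (hα : 0 < α) {U V : ℝ → ℂ} (hU : Continuous U)
    (hM : ∀ u, ‖U u‖ ≤ M) (hV : Continuous V) (hM' : ∀ u, ‖V u‖ ≤ M') (x y : ℝ) :
    gammaTransform α (fun u => U u + V u) x y =
      gammaTransform α U x y + gammaTransform α V x y := by
  simp only [gammaTransform, add_mul]
  exact integral_add (integrable_mul_gammaKernel hα hU hM x y)
    (integrable_mul_gammaKernel hα hV hM' x y)

lemma gammaTransform_cexp {α : ℝ} (hα : 0 < α) (θ x y : ℝ) :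
    gammaTransform α (fun u => Complex.exp ((θ * u : ℝ) * Complex.I)) x y =
      Complex.exp ((θ * x : ℝ) * Complex.I) * gammaCut α (θ * y) := by
  rw [← integral_cexp_mul_gammaKernel hα, ← integral_const_mul, gammaTransform]
  congr with w
  rw [← mul_assoc, ← Complex.exp_add]
  push_cast
  ring_nf

lemma gammaTransform_sum_mul_cexp {α : ℝ} (hα : 0 < α) (s : Finset ℕ) (b : ℕ → ℂ) (θ : ℕ → ℝ)
    (x y : ℝ) :
    gammaTransform α (fun u => ∑ n ∈ s, b n * Complex.exp ((θ n * u : ℝ) * Complex.I)) x y =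
      ∑ n ∈ s, b n * Complex.exp ((θ n * x : ℝ) * Complex.I) * gammaCut α (θ n * y) := by
  have hterm (n : ℕ) := (integrable_mul_gammaKernel hα
    (U := fun u => Complex.exp ((θ n * u : ℝ) * Complex.I)) (by fun_prop)
    (fun u => (Complex.norm_exp_ofReal_mul_I _).le) x y).const_mul (b n)
  simp only [gammaTransform, Finset.sum_mul, mul_assoc (b _)]
  rw [integral_finsetSum _ fun n _ => hterm n]
  refine Finset.sum_congr rfl fun n _ => ?_
  rw [integral_const_mul, ← gammaTransform_cexp hα, gammaTransform]

lemma tendsto_gammaTransform {α M : ℝ} (hα : 0 < α) {S : ℕ → ℝ → ℂ} {U : ℝ → ℂ}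
    (hS : ∀ N, Continuous (S N)) (hSU : TendstoUniformly S U atTop) (hM : ∀ u, ‖U u‖ ≤ M)
    (x y : ℝ) :
    Tendsto (fun N => gammaTransform α (S N) x y) atTop (𝓝 (gammaTransform α U x y)) := by
  refine tendsto_integral_filter_of_dominated_convergence (fun w => (M + 1) * ‖gammaKernel α w‖)
    (Eventually.of_forall fun N => ?_) ?_ ((integrable_gammaKernel hα).norm.const_mul _)
    (Eventually.of_forall fun w => (hSU.tendsto_at _).mul_const _)
  · exact Continuous.aestronglyMeasurable
      (((hS N).comp (by fun_prop)).mul (continuous_gammaKernel α))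
  · filter_upwards [Metric.tendstoUniformly_iff.mp hSU 1 one_pos] with N hN
    refine Eventually.of_forall fun w => ?_
    rw [norm_mul]
    gcongr
    have hclose := hN (x + 2 * π * y * w)
    rw [dist_comm, dist_eq_norm] at hclose
    linarith [hM (x + 2 * π * y * w), norm_le_norm_add_norm_sub' (S N (x + 2 * π * y * w))
      (U (x + 2 * π * y * w))]

lemma isLittleO_abs_rpow {V : ℝ → ℂ} {β : ℝ} (hV : V =o[𝓝 0] fun v : ℝ => v) (hβ : β ≤ 1) :
    V =o[𝓝 0] fun v : ℝ => |v| ^ β := by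
  refine hV.trans_isBigO (Asymptotics.IsBigO.of_bound 1 ?_)
  filter_upwards [Metric.ball_mem_nhds (0 : ℝ) one_pos] with v hv
  rw [mem_ball_zero_iff, Real.norm_eq_abs] at hv
  rw [one_mul, Real.norm_of_nonneg (Real.rpow_nonneg (abs_nonneg v) β), Real.norm_eq_abs]
  rcases eq_or_ne v 0 with rfl | hv0
  · simpa using Real.rpow_nonneg (le_refl (0 : ℝ)) β
  · simpa using Real.rpow_le_rpow_of_exponent_ge (abs_pos.mpr hv0) hv.le hβ

lemma exists_norm_le_mul_abs_rpow {V : ℝ → ℂ} {M β : ℝ} (hM : ∀ v, ‖V v‖ ≤ M) (hβ : 0 ≤ β)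
    (hV : V =O[𝓝 0] fun v : ℝ => |v| ^ β) : ∃ C, ∀ v, ‖V v‖ ≤ C * |v| ^ β := by
  have hM0 : 0 ≤ M := (norm_nonneg _).trans (hM 0)
  obtain ⟨C, hC⟩ := hV.bound
  obtain ⟨δ, hδ, hball⟩ := Metric.eventually_nhds_iff.mp hC
  refine ⟨max C (M * (δ ^ β)⁻¹), fun v => ?_⟩
  rcases lt_or_ge |v| δ with hv | hv
  · refine (hball (by simpa using hv)).trans ?_
    rw [Real.norm_of_nonneg (by positivity)]
    gcongr
    exact le_max_left _ _
  · calc ‖V v‖ ≤ M * ((δ ^ β)⁻¹ * δ ^ β) := by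
          rw [inv_mul_cancel₀ (Real.rpow_pos_of_pos hδ β).ne', mul_one]
          exact hM v
      _ ≤ M * ((δ ^ β)⁻¹ * |v| ^ β) := by gcongr
      _ ≤ max C (M * (δ ^ β)⁻¹) * |v| ^ β := by
          rw [← mul_assoc]
          gcongr
          exact le_max_right _ _

lemma tendsto_rpow_mul_of_isLittleO_abs_rpow {V : ℝ → ℂ} {β : ℝ}
    (hV : V =o[𝓝 0] fun v : ℝ => |v| ^ β) (b : ℝ) :
    Tendsto (fun y : ℝ => ((y ^ (-β) : ℝ) : ℂ) * V (y * b)) (𝓝[>] 0) (𝓝 0) := by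
  have hlin : Tendsto (fun y : ℝ => y * b) (𝓝[>] 0) (𝓝 0) :=
    ((by fun_prop : Continuous fun y : ℝ => y * b).tendsto' 0 0 (zero_mul b)).mono_left
      nhdsWithin_le_nhds
  have hbound : (fun y : ℝ => |y * b| ^ β) =O[𝓝[>] 0] fun y => ((y ^ β : ℝ) : ℂ) := by
    refine Asymptotics.IsBigO.of_bound (|b| ^ β) ?_
    filter_upwards [self_mem_nhdsWithin] with y (hy : 0 < y)
    rw [abs_mul, abs_of_pos hy, Real.mul_rpow hy.le (abs_nonneg b), norm_mul, Complex.norm_real,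
      mul_comm, Real.norm_of_nonneg (by positivity)]
  refine ((hV.comp_tendsto hlin).trans_isBigO hbound).tendsto_div_nhds_zero.congr' ?_
  filter_upwards [self_mem_nhdsWithin] with y (hy : 0 < y)
  rw [Function.comp_apply, Real.rpow_neg hy.le, Complex.ofReal_inv, div_eq_inv_mul]

lemma tendsto_rpow_mul_gammaTransform_of_isLittleO {V : ℝ → ℂ} {M α β x : ℝ}
    (hV : Continuous V) (hM : ∀ u, ‖V u‖ ≤ M)
    (hVo : (fun v => V (x + v)) =o[𝓝 0] fun v : ℝ => v) (hβ0 : 0 ≤ β) (hβ1 : β ≤ 1)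
    (hβα : β < α) :
    Tendsto (fun y : ℝ => ((y ^ (-β) : ℝ) : ℂ) * gammaTransform α V x y) (𝓝[>] 0) (𝓝 0) := by
  have hVβ := isLittleO_abs_rpow hVo hβ1
  obtain ⟨C, hC⟩ := exists_norm_le_mul_abs_rpow (fun v => hM (x + v)) hβ0 hVβ.isBigO
  have hscale (y w : ℝ) : 2 * π * y * w = y * (2 * π * w) := by ring
  simp_rw [gammaTransform, hscale, ← integral_const_mul]
  rw [← integral_zero ℝ ℂ]
  refine tendsto_integral_filter_of_dominated_convergence
    (fun w => C * (2 * π) ^ β * (|w| ^ β * ‖gammaKernel α w‖)) (Eventually.of_forall fun y => ?_)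
    ?_ ((integrable_rpow_mul_gammaKernel (hβ0.trans_lt hβα) hβ0 hβα).const_mul _)
    (Eventually.of_forall fun w => ?_)
  · exact Continuous.aestronglyMeasurable (continuous_const.mul
      ((hV.comp (by fun_prop)).mul (continuous_gammaKernel α)))
  · filter_upwards [self_mem_nhdsWithin] with y (hy : 0 < y)
    refine Eventually.of_forall fun w => ?_
    have hpow : |y * (2 * π * w)| ^ β = y ^ β * ((2 * π) ^ β * |w| ^ β) := by
      rw [abs_mul, abs_mul, abs_of_pos hy, abs_of_pos Real.two_pi_pos,
        Real.mul_rpow hy.le (by positivity), Real.mul_rpow (by positivity) (abs_nonneg w)]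
    rw [norm_mul, norm_mul, Complex.norm_real, Real.norm_of_nonneg (by positivity)]
    calc y ^ (-β) * (‖V (x + y * (2 * π * w))‖ * ‖gammaKernel α w‖)
        ≤ y ^ (-β) * (C * (y ^ β * ((2 * π) ^ β * |w| ^ β)) * ‖gammaKernel α w‖) := by
          gcongr
          exact hpow ▸ hC (y * (2 * π * w))
      _ = C * (2 * π) ^ β * (|w| ^ β * ‖gammaKernel α w‖) := by
          rw [Real.rpow_neg hy.le]
          field_simp
  · simpa [mul_assoc] using
      (tendsto_rpow_mul_of_isLittleO_abs_rpow hVβ (2 * π * w)).mul_const (gammaKernel α w)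

lemma exists_hasDerivAt_zero_add_sum_cexp {U : ℝ → ℂ} {x : ℝ} (hd : DifferentiableAt ℝ U x) :
    ∃ b : ℕ → ℂ, ∃ P : ℝ → ℂ,
      (P = fun u => ∑ n ∈ Finset.range 2, b n * Complex.exp (((-n : ℝ) * u : ℝ) * Complex.I)) ∧
      U x + P x = 0 ∧ HasDerivAt (fun u => U u + P u) 0 x := by
  set D := deriv U x
  let b : ℕ → ℂ := fun n => if n = 0 then D * Complex.I - U x
    else -(D * Complex.I * Complex.exp (x * Complex.I))
  have hP (u : ℝ) : ∑ n ∈ Finset.range 2, b n * Complex.exp (((-n : ℝ) * u : ℝ) * Complex.I) =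
      D * Complex.I - U x - D * Complex.I * Complex.exp ((x - u) * Complex.I) := by
    rw [sub_mul, sub_eq_add_neg ((x : ℂ) * Complex.I), Complex.exp_add]
    simp only [b, Finset.sum_range_succ, Finset.range_one, Finset.sum_singleton, if_true,
      one_ne_zero, if_false, neg_mul, Nat.cast_zero, zero_mul, neg_zero, Nat.cast_one, one_mul,
      Complex.ofReal_neg, Complex.ofReal_zero, Complex.exp_zero, mul_one]
    ring
  have hexp : HasDerivAt (fun u : ℝ => Complex.exp ((x - u) * Complex.I)) (-Complex.I) x := by
    have hlin : HasDerivAt (fun u : ℝ => ((x : ℂ) - u) * Complex.I) (-Complex.I) x := by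
      simpa using ((hasDerivAt_id x).ofReal_comp.const_sub (x : ℂ)).mul_const Complex.I
    simpa using hlin.cexp
  refine ⟨b, _, rfl, ?_, ?_⟩ <;> simp only [hP]
  · simp
  · refine (hd.hasDerivAt.fun_add ((hexp.const_mul (D * Complex.I)).const_sub _)).congr_deriv ?_
    linear_combination D * Complex.I_mul_I

/-- The transform annihilates nonpositive frequencies; subtracting some of them, one may assume
that `U` vanishes to second order at `x`. -/
lemma tendsto_rpow_mul_gammaTransform {U : ℝ → ℂ} {M α β x : ℝ} (hU : Continuous U)
    (hM : ∀ u, ‖U u‖ ≤ M) (hd : DifferentiableAt ℝ U x) (hβ0 : 0 ≤ β) (hβ1 : β ≤ 1)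
    (hβα : β < α) :
    Tendsto (fun y : ℝ => ((y ^ (-β) : ℝ) : ℂ) * gammaTransform α U x y) (𝓝[>] 0) (𝓝 0) := by
  have hα := hβ0.trans_lt hβα
  obtain ⟨b, P, hPb, hzero, hderiv⟩ := exists_hasDerivAt_zero_add_sum_cexp hd
  have hPc : Continuous P := by rw [hPb]; fun_prop
  have hPM (u : ℝ) : ‖P u‖ ≤ ∑ n ∈ Finset.range 2, ‖b n‖ := by
    rw [hPb]
    exact norm_sum_le_of_le _ fun n _ => by rw [norm_mul, Complex.norm_exp_ofReal_mul_I, mul_one]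
  have hlittle : (fun v => U (x + v) + P (x + v)) =o[𝓝 0] fun v : ℝ => v := by
    simpa [hzero] using hasDerivAt_iff_isLittleO_nhds_zero.mp hderiv
  have hP {y : ℝ} (hy : 0 < y) : gammaTransform α P x y = 0 := by
    rw [hPb, gammaTransform_sum_mul_cexp hα]
    refine Finset.sum_eq_zero fun n _ => ?_
    rw [gammaCut_of_nonpos hα (mul_nonpos_of_nonpos_of_nonneg (by simp) hy.le), mul_zero]
  refine (tendsto_rpow_mul_gammaTransform_of_isLittleO (hU.add hPc)
    (fun u => norm_add_le_of_le (hM u) (hPM u)) hlittle hβ0 hβ1 hβα).congr' ?_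
  filter_upwards [self_mem_nhdsWithin] with y (hy : 0 < y)
  rw [Pi.add_def, gammaTransform_add hα hU hM hPc hPM, hP hy, add_zero]

namespace IsFourierExpansion

variable {m κ a : ℝ} {c : ℕ → ℂ} {H : ℂ → ℂ}

lemma gammaTransform_fracLimit (h : IsFourierExpansion m κ a c H) {α : ℝ} (hα : a < α) (x : ℝ)
    {y : ℝ} (hy : 0 < y) :
    gammaTransform α (fracLimit m α H) x y =
      (((2 * π / m) ^ α * y ^ α : ℝ) : ℂ) * H (x + y * Complex.I) := by
  have hm := h.m_pos
  have hκ := h.κ_nonneg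
  have hα0 := h.a_pos.trans hα
  obtain ⟨M, hM⟩ := h.exists_norm_fracLimit_le hα
  have hpartial (N : ℕ) : fracPartial m κ α c N = fun u => ∑ n ∈ Finset.range N,
      c n / ((((n : ℝ) + κ) ^ α : ℝ) : ℂ) *
        Complex.exp ((2 * π / m * (n + κ) * u : ℝ) * Complex.I) := by
    ext u
    refine Finset.sum_congr rfl fun n _ => ?_
    rw [expMode]
    push_cast
    ring_nf
  refine tendsto_nhds_unique (tendsto_gammaTransform hα0 (continuous_fracPartial α)
    (h.tendstoUniformly_fracPartial hα) hM x y) ?_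
  refine (h.hasSum_gammaWeight α x hy).tendsto_sum_nat.congr fun N => ?_
  rw [hpartial, gammaTransform_sum_mul_cexp hα0]
  refine Finset.sum_congr rfl fun n _ => ?_
  rw [gammaCut_of_nonneg (by positivity), expMode]
  push_cast
  ring_nf

lemma gammaTransform_conj_fracLimit (h : IsFourierExpansion m κ a c H) {α : ℝ} (hα : a < α)
    (x : ℝ) {y : ℝ} (hy : 0 < y) :
    gammaTransform α (fun u => (starRingEnd ℂ) (fracLimit m α H u)) x y = 0 := by
  have hm := h.m_pos
  have hκ := h.κ_nonneg
  have hα0 := h.a_pos.trans hα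
  obtain ⟨M, hM⟩ := h.exists_norm_fracLimit_le hα
  have hpartial (N : ℕ) : (fun u => (starRingEnd ℂ) (fracPartial m κ α c N u)) = fun u =>
      ∑ n ∈ Finset.range N, (starRingEnd ℂ) (c n / ((((n : ℝ) + κ) ^ α : ℝ) : ℂ)) *
        Complex.exp ((-(2 * π / m * (n + κ)) * u : ℝ) * Complex.I) := by
    ext u
    rw [fracPartial, map_sum]
    refine Finset.sum_congr rfl fun n _ => ?_
    rw [map_mul, expMode, ← Complex.exp_conj]
    congr 2
    simp only [map_mul, map_div₀, map_add, Complex.conj_ofReal, Complex.conj_I,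
      Complex.conj_natCast, Complex.conj_ofNat]
    push_cast
    ring
  refine tendsto_nhds_unique (tendsto_gammaTransform hα0
    (S := fun N u => (starRingEnd ℂ) (fracPartial m κ α c N u))
    (fun N => Complex.continuous_conj.comp (continuous_fracPartial α N))
    (Complex.conjLIE.isometry.uniformContinuous.comp_tendstoUniformly
      (h.tendstoUniformly_fracPartial hα)) (fun u => (RCLike.norm_conj _).trans_le (hM u)) x y) ?_
  refine tendsto_const_nhds.congr fun N => ?_
  rw [hpartial, gammaTransform_sum_mul_cexp hα0, eq_comm]
  refine Finset.sum_eq_zero fun n _ => ?_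
  have hfreq : 0 ≤ 2 * π / m * (n + κ) * y := by positivity
  rw [gammaCut_of_nonpos hα0 (by linarith), mul_zero]

theorem tendsto_rpow_mul_norm_of_differentiableAt (h : IsFourierExpansion m κ a c H) {α : ℝ}
    (hα : a < α) (hα1 : α ≤ a + 1) {p q : ℂ} (hp : p ≠ 0) {x : ℝ}
    (hd : DifferentiableAt ℝ (fun u => p * fracLimit m α H u +
      q * (starRingEnd ℂ) (fracLimit m α H u)) x) :
    Tendsto (fun y : ℝ => y ^ a * ‖H (x + y * Complex.I)‖) (𝓝[>] 0) (𝓝 0) := by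
  have hm := h.m_pos
  have hα0 := h.a_pos.trans hα
  obtain ⟨M, hM⟩ := h.exists_norm_fracLimit_le hα
  have hF := h.continuous_fracLimit hα
  have hpF : Continuous fun u => p * fracLimit m α H u := hF.const_mul p
  have hqF : Continuous fun u => q * (starRingEnd ℂ) (fracLimit m α H u) :=
    (Complex.continuous_conj.comp hF).const_mul q
  have hpM (u : ℝ) : ‖p * fracLimit m α H u‖ ≤ ‖p‖ * M := norm_mul_le_of_le le_rfl (hM u)
  have hqM (u : ℝ) : ‖q * (starRingEnd ℂ) (fracLimit m α H u)‖ ≤ ‖q‖ * M :=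
    norm_mul_le_of_le le_rfl ((RCLike.norm_conj _).trans_le (hM u))
  have htransform {y : ℝ} (hy : 0 < y) : gammaTransform α (fun u => p * fracLimit m α H u +
      q * (starRingEnd ℂ) (fracLimit m α H u)) x y =
        p * ((((2 * π / m) ^ α * y ^ α : ℝ) : ℂ) * H (x + y * Complex.I)) := by
    rw [gammaTransform_add hα0 hpF hpM hqF hqM, gammaTransform_const_mul, gammaTransform_const_mul,
      h.gammaTransform_fracLimit hα x hy, h.gammaTransform_conj_fracLimit hα x hy, mul_zero,
      add_zero]
  have hlim := ((tendsto_rpow_mul_gammaTransform (hpF.add hqF)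
    (fun u => norm_add_le_of_le (hpM u) (hqM u)) hd (α := α) (β := α - a) (by linarith)
    (by linarith) (by linarith [h.a_pos])).norm).const_mul (‖p‖ * (2 * π / m) ^ α)⁻¹
  rw [norm_zero, mul_zero] at hlim
  refine hlim.congr' ?_
  filter_upwards [self_mem_nhdsWithin] with y (hy : 0 < y)
  have hsplit : y ^ a = y ^ (-(α - a)) * y ^ α := by
    rw [← Real.rpow_add hy]
    ring_nf
  have hp0 : ‖p‖ ≠ 0 := norm_ne_zero_iff.mpr hp
  rw [Pi.add_def, htransform hy, norm_mul, norm_mul, norm_mul, Complex.norm_real,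
    Complex.norm_real, Real.norm_of_nonneg (by positivity), Real.norm_of_nonneg (by positivity),
    hsplit]
  field_simp

end IsFourierExpansion

/-! ### The invariant norm of a modular form -/

lemma im_smul_eq (γ : SL(2, ℤ)) (z : ℍ) : (γ • z).im = z.im / ‖denom γ z‖ ^ 2 := by
  rw [ModularGroup.im_smul_eq_div_normSq, Complex.normSq_eq_norm_sq]

lemma norm_denom_pos (γ : SL(2, ℤ)) (z : ℍ) : 0 < ‖denom γ z‖ :=
  norm_pos_iff.mpr (denom_ne_zero _ z)

lemma im_le_norm_denom {γ : SL(2, ℤ)} (hγ : γ 1 0 ≠ 0) (z : ℍ) : z.im ≤ ‖denom γ z‖ := by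
  have him : (denom γ z).im = γ 1 0 * z.im := by simp [ModularGroup.denom_apply]
  have hone : (1 : ℝ) ≤ |(γ 1 0 : ℝ)| := by exact_mod_cast Int.one_le_abs hγ
  calc z.im ≤ |(γ 1 0 : ℝ)| * z.im := le_mul_of_one_le_left z.im_pos.le hone
    _ = |(denom γ z).im| := by rw [him, abs_mul, abs_of_pos z.im_pos]
    _ ≤ ‖denom γ z‖ := Complex.abs_im_le_norm _

/-- The function `|f z| (Im z) ^ (r / 2)`, which is invariant under the group of a modular form `f`
of weight `r`. -/
noncomputable def invNorm (r : ℝ) (f : ℍ → ℂ) (z : ℍ) : ℝ := ‖f z‖ * z.im ^ (r / 2)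

lemma im_smul_rpow (γ : SL(2, ℤ)) (z : ℍ) (r : ℝ) :
    (γ • z).im ^ (r / 2) = z.im ^ (r / 2) / ‖denom γ z‖ ^ r := by
  rw [im_smul_eq, Real.div_rpow z.im_pos.le (by positivity), ← Real.rpow_natCast,
    ← Real.rpow_mul (norm_nonneg _), Nat.cast_ofNat, mul_div_cancel₀ r two_ne_zero]

lemma norm_slash (r : ℝ) (f : ℍ → ℂ) (γ : SL(2, ℤ)) (z : ℍ) :
    ‖slash r f γ z‖ = ‖f (γ • z)‖ / ‖denom γ z‖ ^ r := by
  rw [slash, norm_div, ← ModularGroup.denom_apply, Complex.norm_cpow_real]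

lemma norm_slash_mul_im_rpow (r : ℝ) (f : ℍ → ℂ) (γ : SL(2, ℤ)) (z : ℍ) :
    ‖slash r f γ z‖ * z.im ^ (r / 2) = invNorm r f (γ • z) := by
  rw [invNorm, im_smul_rpow, norm_slash]
  ring

lemma slash_one (r : ℝ) (f : ℍ → ℂ) : slash r f 1 = f := by
  ext z
  simp [slash]

namespace IsModularForm

variable {Γ : Subgroup SL(2, ℤ)} {r : ℝ} {μ : Γ → Circle} {f : ℍ → ℂ}

lemma invNorm_smul (hf : IsModularForm Γ r μ f) {g : SL(2, ℤ)} (hg : g ∈ Γ) (z : ℍ) :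
    invNorm r f (g • z) = invNorm r f z := by
  have hnorm : ‖f (g • z)‖ = ‖denom g z‖ ^ r * ‖f z‖ := by
    rw [hf.transform ⟨g, hg⟩ z, norm_mul, norm_mul, Circle.norm_coe, one_mul,
      ← ModularGroup.denom_apply, Complex.norm_cpow_real]
  have hpos : 0 < ‖denom g z‖ ^ r := Real.rpow_pos_of_pos (norm_denom_pos g z) r
  rw [invNorm, invNorm, im_smul_rpow, hnorm]
  field_simp

lemma norm_slash_mul_left (hf : IsModularForm Γ r μ f) {g : SL(2, ℤ)} (hg : g ∈ Γ)
    (γ : SL(2, ℤ)) (z : ℍ) : ‖slash r f (g * γ) z‖ = ‖slash r f γ z‖ := by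
  have hinv : ‖slash r f (g * γ) z‖ * z.im ^ (r / 2) = ‖slash r f γ z‖ * z.im ^ (r / 2) := by
    rw [norm_slash_mul_im_rpow, norm_slash_mul_im_rpow, mul_smul, hf.invNorm_smul hg]
  exact mul_right_cancel₀ (Real.rpow_pos_of_pos z.im_pos _).ne' hinv

end IsModularForm

/-! ### Widths of cusps -/

lemma coe_T_pow (n : ℕ) : ((ModularGroup.T ^ n : SL(2, ℤ)) : Matrix (Fin 2) (Fin 2) ℤ) =
    !![1, (n : ℤ); 0, 1] := by
  simpa only [zpow_natCast] using ModularGroup.coe_T_zpow n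

lemma T_pow_smul (n : ℕ) (z : ℍ) : ModularGroup.T ^ n • z = (n : ℝ) +ᵥ z := by
  simpa using modular_T_zpow_smul z n

lemma exists_forall_conj_T_pow_mem (Γ : Subgroup SL(2, ℤ)) (hΓ : Γ.FiniteIndex) :
    ∃ M : ℕ, 0 < M ∧ ∀ (γ : SL(2, ℤ)) (k : ℕ),
      γ * ModularGroup.T ^ (M * k) * γ⁻¹ ∈ Γ := by
  have := Subgroup.finiteIndex_normalCore Γ
  obtain ⟨M, hM, -, hT⟩ := Subgroup.exists_pow_mem_of_index_ne_zero
    (H := Γ.normalCore) Subgroup.FiniteIndex.index_ne_zero ModularGroup.T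
  refine ⟨M, hM, fun γ k => ?_⟩
  rw [pow_mul]
  exact Γ.normalCore_le (Γ.normalCore_normal.conj_mem _ (Subgroup.pow_mem _ hT k) γ)

lemma width_spec (Γ : Subgroup SL(2, ℤ)) (hΓ : Γ.FiniteIndex) (γ : SL(2, ℤ)) :
    0 < width Γ γ ∧ (γ * ModularGroup.T ^ width Γ γ * γ⁻¹ ∈ Γ ∨
      -(γ * ModularGroup.T ^ width Γ γ * γ⁻¹) ∈ Γ) := by
  obtain ⟨M, hM, hT⟩ := exists_forall_conj_T_pow_mem Γ hΓ
  have hmem := hT γ 1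
  rw [mul_one] at hmem
  exact Nat.sInf_mem (s := {m : ℕ | 0 < m ∧ (γ * ModularGroup.T ^ m * γ⁻¹ ∈ Γ ∨
    -(γ * ModularGroup.T ^ m * γ⁻¹) ∈ Γ)}) ⟨M, hM, Or.inl hmem⟩

lemma IsModularForm.norm_slash_width_vadd {Γ : Subgroup SL(2, ℤ)} {r : ℝ} {μ : Γ → Circle}
    {f : ℍ → ℂ} (hf : IsModularForm Γ r μ f) (hΓ : Γ.FiniteIndex) (γ : SL(2, ℤ)) (z : ℍ) :
    ‖slash r f γ ((width Γ γ : ℝ) +ᵥ z)‖ = ‖slash r f γ z‖ := by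
  have hinv : invNorm r f (γ • ((width Γ γ : ℝ) +ᵥ z)) = invNorm r f (γ • z) := by
    have hconj : γ • ((width Γ γ : ℝ) +ᵥ z) =
        (γ * ModularGroup.T ^ width Γ γ * γ⁻¹) • γ • z := by
      rw [← T_pow_smul, ← mul_smul, ← mul_smul, inv_mul_cancel_right]
    rw [hconj]
    rcases (width_spec Γ hΓ γ).2 with hmem | hmem
    · exact hf.invNorm_smul hmem _
    · rw [← ModularGroup.SL_neg_smul]
      exact hf.invNorm_smul hmem _
  rw [← norm_slash_mul_im_rpow, ← norm_slash_mul_im_rpow, vadd_im] at hinv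
  exact mul_right_cancel₀ (Real.rpow_pos_of_pos z.im_pos _).ne' hinv

/-! ### Holomorphy of the slash operator and the cusp parameter -/

lemma differentiableOn_linear_cpow (c d : ℤ) (s : ℂ) :
    DifferentiableOn ℂ (fun z : ℂ => ((c : ℂ) * z + d) ^ s) {z | 0 < z.im} := by
  by_cases hc : c = 0
  · simp [hc]
  · intro z hz
    have hslit : (c : ℂ) * z + d ∈ Complex.slitPlane := by
      refine Or.inr ?_
      have hz : 0 < z.im := hz
      simpa using ⟨hc, hz.ne'⟩
    have hlin : DifferentiableAt ℂ (fun w : ℂ => (c : ℂ) * w + d) z := by fun_prop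
    exact (hlin.cpow_const hslit).differentiableWithinAt

lemma mdifferentiable_slash {r : ℝ} {f : ℍ → ℂ} (hf : MDifferentiable 𝓘(ℂ) 𝓘(ℂ) f)
    (γ : SL(2, ℤ)) : MDifferentiable 𝓘(ℂ) 𝓘(ℂ) (slash r f γ) := by
  have hcomp : MDifferentiable 𝓘(ℂ) 𝓘(ℂ) (fun z : ℍ => f (γ • z)) :=
    hf.comp (mdifferentiable_smul (g := (γ : GL (Fin 2) ℝ)) (by simp))
  rw [mdifferentiable_iff] at hcomp ⊢
  refine (hcomp.div (differentiableOn_linear_cpow (γ 1 0) (γ 1 1) r)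
    fun z (hz : 0 < z.im) => ?_).congr fun z (hz : 0 < z.im) => ?_
  · rw [Complex.cpow_ne_zero_iff]
    exact Or.inl (ModularGroup.denom_apply γ ⟨z, hz⟩ ▸ denom_ne_zero _ _)
  · simp [slash, ofComplex_apply_of_im_pos hz]

lemma exists_eqOn_const_mul_of_norm_eq {U : Set ℂ} (hU : IsOpen U) (hUc : IsPreconnected U)
    {g k : ℂ → ℂ} (hg : DifferentiableOn ℂ g U) (hk : DifferentiableOn ℂ k U)
    (hnorm : ∀ z ∈ U, ‖g z‖ = ‖k z‖) {z₀ : ℂ} (hz₀ : z₀ ∈ U) (hk₀ : k z₀ ≠ 0) :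
    ∃ c : ℂ, ‖c‖ = 1 ∧ Set.EqOn g (fun z => c * k z) U := by
  have hnear : ∀ᶠ w in 𝓝 z₀, w ∈ U ∧ k w ≠ 0 := (hU.eventually_mem hz₀).and
    ((hk.differentiableAt (hU.mem_nhds hz₀)).continuousAt.eventually_ne hk₀)
  have hquot : ∀ᶠ w in 𝓝 z₀, ‖g w / k w‖ = 1 := by
    filter_upwards [hnear] with w hw
    rw [norm_div, hnorm w hw.1, div_self (norm_ne_zero_iff.mpr hw.2)]
  -- The quotient has constant modulus near `z₀`, so the maximum principle makes it constant there.
  have hconst : ∀ᶠ w in 𝓝 z₀, g w / k w = g z₀ / k z₀ := by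
    refine Complex.eventually_eq_of_isLocalMax_norm (f := fun w => g w / k w) ?_ ?_
    · filter_upwards [hnear] with w hw
      exact (hg.differentiableAt (hU.mem_nhds hw.1)).div
        (hk.differentiableAt (hU.mem_nhds hw.1)) hw.2
    · filter_upwards [hquot] with w hw
      exact (hw.trans hquot.self_of_nhds.symm).le
  refine ⟨g z₀ / k z₀, hquot.self_of_nhds,
    (hg.analyticOnNhd hU).eqOn_of_preconnected_of_eventuallyEq
      ((hk.const_mul (g z₀ / k z₀)).analyticOnNhd hU) hUc hz₀ ?_⟩
  filter_upwards [hconst, hnear] with w hw hwk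
  rw [← hw, div_mul_cancel₀ _ hwk.2]

lemma exists_eq_mul_of_norm_eq {g k : ℍ → ℂ} (hg : MDifferentiable 𝓘(ℂ) 𝓘(ℂ) g)
    (hk : MDifferentiable 𝓘(ℂ) 𝓘(ℂ) k) (hnorm : ∀ z, ‖g z‖ = ‖k z‖) {z₀ : ℍ} (hk₀ : k z₀ ≠ 0) :
    ∃ c : ℂ, ‖c‖ = 1 ∧ ∀ z, g z = c * k z := by
  obtain ⟨c, hc, heq⟩ := exists_eqOn_const_mul_of_norm_eq isOpen_upperHalfPlaneSet
    (convex_halfSpace_im_gt 0).isPreconnected (mdifferentiable_iff.mp hg)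
    (mdifferentiable_iff.mp hk) (fun _ _ => hnorm _) z₀.im_pos (by simpa using hk₀)
  exact ⟨c, hc, fun z => by simpa using heq z.im_pos⟩

lemma eq_of_exp_two_pi_I_mul_eq {κ κ' : ℝ} (h0 : 0 ≤ κ) (h1 : κ < 1) (h0' : 0 ≤ κ') (h1' : κ' < 1)
    (h : Complex.exp (2 * π * Complex.I * κ) = Complex.exp (2 * π * Complex.I * κ')) :
    κ = κ' := by
  obtain ⟨n, hn⟩ := Complex.exp_eq_exp_iff_exists_int.mp h
  have hdiff : (κ : ℂ) = κ' + n :=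
    mul_left_cancel₀ Complex.two_pi_I_ne_zero (by linear_combination hn)
  have hfract : Int.fract κ = Int.fract κ' :=
    Int.fract_eq_fract.mpr ⟨n, sub_eq_of_eq_add' (by exact_mod_cast hdiff)⟩
  rwa [Int.fract_eq_self.mpr ⟨h0, h1⟩, Int.fract_eq_self.mpr ⟨h0', h1'⟩] at hfract

lemma exists_exp_two_pi_I_mul_eq {c : ℂ} (hc : ‖c‖ = 1) :
    ∃ κ : ℝ, 0 ≤ κ ∧ κ < 1 ∧ c = Complex.exp (2 * π * Complex.I * κ) := by
  refine ⟨Int.fract (c.arg / (2 * π)), Int.fract_nonneg _, Int.fract_lt_one _, ?_⟩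
  have hpolar : c = Complex.exp (c.arg * Complex.I) := by
    simpa [hc] using (Complex.norm_mul_exp_arg_mul_I c).symm
  conv_lhs => rw [hpolar]
  refine Complex.exp_eq_exp_iff_exists_int.mpr ⟨⌊c.arg / (2 * π)⌋, ?_⟩
  have hpi : (π : ℂ) ≠ 0 := by exact_mod_cast Real.pi_ne_zero
  rw [Int.fract]
  push_cast
  field_simp
  ring

lemma cuspParam_spec {g : ℍ → ℂ} {m : ℕ} {z₀ : ℍ} (hz₀ : g z₀ ≠ 0) {c : ℂ} (hc : ‖c‖ = 1)
    (h : ∀ z : ℍ, g ((m : ℝ) +ᵥ z) = c * g z) :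
    0 ≤ cuspParam g m ∧ cuspParam g m < 1 ∧
      ∀ z : ℍ, g ((m : ℝ) +ᵥ z) = Complex.exp (2 * π * Complex.I * cuspParam g m) * g z := by
  obtain ⟨κ, hκ0, hκ1, rfl⟩ := exists_exp_two_pi_I_mul_eq hc
  have hset : {κ : ℝ | 0 ≤ κ ∧ κ < 1 ∧ ∀ z : ℍ, g ((m : ℝ) +ᵥ z) =
      Complex.exp (2 * π * Complex.I * κ) * g z} = {κ} := by
    ext κ'
    constructor
    · rintro ⟨h0', h1', h'⟩
      exact eq_of_exp_two_pi_I_mul_eq h0' h1' hκ0 hκ1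
        (mul_right_cancel₀ hz₀ ((h' z₀).symm.trans (h z₀)))
    · rintro rfl
      exact ⟨hκ0, hκ1, h⟩
  rw [cuspParam, hset, csInf_singleton]
  exact ⟨hκ0, hκ1, h⟩

lemma IsModularForm.cuspParam_slash {Γ : Subgroup SL(2, ℤ)} {r : ℝ} {μ : Γ → Circle} {f : ℍ → ℂ}
    (hf : IsModularForm Γ r μ f) (hΓ : Γ.FiniteIndex) (hf0 : f ≠ 0) (γ : SL(2, ℤ)) :
    0 ≤ cuspParam (slash r f γ) (width Γ γ) ∧ cuspParam (slash r f γ) (width Γ γ) < 1 ∧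
      ∀ z : ℍ, slash r f γ ((width Γ γ : ℝ) +ᵥ z) = Complex.exp (2 * π * Complex.I *
        cuspParam (slash r f γ) (width Γ γ)) * slash r f γ z := by
  obtain ⟨z₀, hz₀ : f z₀ ≠ 0⟩ := Function.ne_iff.mp hf0
  have hslash : slash r f γ (γ⁻¹ • z₀) ≠ 0 := by
    rw [← norm_pos_iff, norm_slash, smul_inv_smul]
    exact div_pos (norm_pos_iff.mpr hz₀) (Real.rpow_pos_of_pos (norm_denom_pos _ _) r)
  have hholo := mdifferentiable_slash (r := r) hf.holo γ
  have hholo_vadd :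
      MDifferentiable 𝓘(ℂ) 𝓘(ℂ) (fun z : ℍ => slash r f γ ((width Γ γ : ℝ) +ᵥ z)) := by
    simp_rw [← T_pow_smul]
    exact hholo.comp (mdifferentiable_smul
      (g := ((ModularGroup.T ^ width Γ γ : SL(2, ℤ)) : GL (Fin 2) ℝ)) (by simp))
  obtain ⟨c, hc, heq⟩ :=
    exists_eq_mul_of_norm_eq hholo_vadd hholo (hf.norm_slash_width_vadd hΓ γ) hslash
  exact cuspParam_spec hslash hc heq

/-! ### Growth at the cusps -/

lemma apply_zero_zero_mul_apply_one_one {γ : SL(2, ℤ)} (hc : γ 1 0 = 0) : γ 0 0 * γ 1 1 = 1 := by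
  have hdet := γ.det_coe
  rw [Matrix.det_fin_two] at hdet
  simpa [hc] using hdet

lemma exists_mem_mul_apply_one_zero_ne_zero (Γ : Subgroup SL(2, ℤ)) (hΓ : Γ.FiniteIndex)
    (γ : SL(2, ℤ)) : ∃ g ∈ Γ, (g * γ) 1 0 ≠ 0 := by
  by_cases hc : γ 1 0 = 0
  · obtain ⟨M, hM, hT⟩ := exists_forall_conj_T_pow_mem Γ hΓ
    refine ⟨_, hT ModularGroup.S 1, ?_⟩
    have h00 : γ 0 0 ≠ 0 := left_ne_zero_of_mul_eq_one (apply_zero_zero_mul_apply_one_one hc)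
    have hentry : (ModularGroup.S * ModularGroup.T ^ (M * 1) * ModularGroup.S⁻¹ * γ) 1 0 =
        -(M * γ 0 0) := by
      simp only [Matrix.SpecialLinearGroup.coe_mul, coe_T_pow, mul_one]
      simp [ModularGroup.coe_S, Matrix.SpecialLinearGroup.coe_inv, Matrix.adjugate_fin_two,
        Matrix.mul_apply, Fin.sum_univ_two, hc]
    rw [hentry]
    simp [hM.ne', h00]
  · exact ⟨1, Γ.one_mem, by simpa using hc⟩

lemma exists_norm_eq_of_norm_vadd {g : ℍ → ℂ} {m : ℝ} (hm : 0 < m)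
    (h : ∀ z, ‖g (m +ᵥ z)‖ = ‖g z‖) (z : ℍ) :
    ∃ w : ℍ, |w.re| ≤ m ∧ w.im = z.im ∧ ‖g z‖ = ‖g w‖ := by
  have hper : Function.Periodic (fun x : ℝ => ‖g (x +ᵥ z)‖) m := by
    intro x
    simp only
    rw [add_comm, ← vadd_vadd, h]
  obtain ⟨y, hy, heq⟩ := hper.exists_mem_Ico hm 0 (-z.re)
  refine ⟨y +ᵥ z, ?_, vadd_im _ _, by simpa using heq⟩
  rw [vadd_re, abs_le]
  constructor <;> linarith [hy.1, hy.2]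

lemma norm_denom_le (γ : SL(2, ℤ)) {m : ℝ} {z : ℍ} (hre : |z.re| ≤ m) (him : 1 ≤ z.im) :
    ‖denom γ z‖ ≤ (|(γ 1 0 : ℝ)| * (m + 1) + |(γ 1 1 : ℝ)|) * z.im := by
  have hnorm : ‖(z : ℂ)‖ ≤ (m + 1) * z.im := by
    have hz := Complex.norm_le_abs_re_add_abs_im (z : ℂ)
    rw [coe_re, coe_im, abs_of_pos z.im_pos] at hz
    nlinarith [(abs_nonneg z.re).trans hre]
  calc ‖denom γ z‖ ≤ |(γ 1 0 : ℝ)| * ‖(z : ℂ)‖ + |(γ 1 1 : ℝ)| := by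
        rw [ModularGroup.denom_apply]
        refine (norm_add_le _ _).trans_eq ?_
        rw [norm_mul, Complex.norm_intCast, Complex.norm_intCast]
    _ ≤ |(γ 1 0 : ℝ)| * ((m + 1) * z.im) + |(γ 1 1 : ℝ)| * z.im := by
        gcongr
        exact le_mul_of_one_le_right (abs_nonneg _) him
    _ = _ := by ring

lemma im_smul_le_inv {γ : SL(2, ℤ)} {z : ℍ} (h : z.im ≤ ‖denom γ z‖) : (γ • z).im ≤ z.im⁻¹ := by
  have hpos := norm_denom_pos γ z
  rw [im_smul_eq, div_le_iff₀ (by positivity), inv_mul_eq_div, le_div_iff₀ z.im_pos, ← pow_two]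
  gcongr

namespace IsModularForm

variable {Γ : Subgroup SL(2, ℤ)} {r : ℝ} {μ : Γ → Circle} {f : ℍ → ℂ}

lemma exists_nonneg_growth (hf : IsModularForm Γ r μ f) :
    ∃ C A δ : ℝ, 0 ≤ C ∧ 0 ≤ A ∧ 0 < δ ∧ ∀ z : ℍ, z.im < δ → ‖f z‖ ≤ C * z.im ^ (-A) := by
  obtain ⟨C, A, δ, hδ, hgrowth⟩ := hf.growth
  refine ⟨|C|, |A|, min δ 1, abs_nonneg C, abs_nonneg A, by positivity, fun z hz => ?_⟩
  have hexp : z.im ^ (-A) ≤ z.im ^ (-|A|) := Real.rpow_le_rpow_of_exponent_ge z.im_pos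
    (hz.le.trans (min_le_right _ _)) (neg_le_neg (le_abs_self A))
  calc ‖f z‖ ≤ C * z.im ^ (-A) := hgrowth z (hz.trans_le (min_le_left _ _))
    _ ≤ |C| * z.im ^ (-|A|) :=
        mul_le_mul (le_abs_self C) hexp (Real.rpow_pos_of_pos z.im_pos _).le (abs_nonneg C)

lemma exists_norm_slash_le (hf : IsModularForm Γ r μ f) (hΓ : Γ.FiniteIndex) (hr : 0 ≤ r)
    (γ : SL(2, ℤ)) : ∃ B C Y : ℝ, ∀ z : ℍ, Y ≤ z.im → ‖slash r f γ z‖ ≤ C * z.im ^ B := by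
  obtain ⟨g, hg, hc⟩ := exists_mem_mul_apply_one_zero_ne_zero Γ hΓ γ
  obtain ⟨C, A, δ, hC, hA, hδ, hgrowth⟩ := hf.exists_nonneg_growth
  have hm : (0 : ℝ) < width Γ γ := by exact_mod_cast (width_spec Γ hΓ γ).1
  set σ := g * γ
  set L : ℝ := |(σ 1 0 : ℝ)| * (width Γ γ + 1) + |(σ 1 1 : ℝ)|
  have hL : 0 ≤ L := by positivity
  refine ⟨2 * A, C * L ^ (2 * A), max 1 (2 / δ), fun z hz => ?_⟩
  obtain ⟨w, hw_re, hw_im, hw_norm⟩ :=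
    exists_norm_eq_of_norm_vadd hm (hf.norm_slash_width_vadd hΓ γ) z
  rw [hw_norm, ← hw_im, ← hf.norm_slash_mul_left hg]
  rw [← hw_im, max_le_iff] at hz
  obtain ⟨him, himδ⟩ := hz
  have hdenom : w.im ≤ ‖denom σ w‖ := im_le_norm_denom hc w
  have hsmall : (σ • w).im < δ := by
    refine (im_smul_le_inv hdenom).trans_lt (inv_lt_of_inv_lt₀ hδ ?_)
    rw [div_eq_mul_inv] at himδ
    linarith [inv_pos.mpr hδ]
  have hinv : ((σ • w).im)⁻¹ ≤ (L * w.im) ^ (2 : ℝ) := by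
    rw [im_smul_eq, inv_div, Real.rpow_two]
    refine (div_le_self (by positivity) him).trans ?_
    gcongr
    exact norm_denom_le σ hw_re him
  calc ‖slash r f σ w‖ ≤ ‖f (σ • w)‖ := by
        rw [norm_slash]
        exact div_le_self (norm_nonneg _) (Real.one_le_rpow (him.trans hdenom) hr)
    _ ≤ C * (σ • w).im ^ (-A) := hgrowth _ hsmall
    _ ≤ C * ((L * w.im) ^ (2 : ℝ)) ^ A := by
        rw [Real.rpow_neg (σ • w).im_pos.le, ← Real.inv_rpow (σ • w).im_pos.le]
        gcongr
    _ = C * L ^ (2 * A) * w.im ^ (2 * A) := by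
        rw [← Real.rpow_mul (by positivity), Real.mul_rpow hL w.im_pos.le, mul_assoc]

end IsModularForm

/-! ### Fourier expansions at the cusps -/

lemma periodic_comp_ofComplex {g : ℍ → ℂ} {m : ℝ} (h : ∀ z : ℍ, g (m +ᵥ z) = g z) :
    Function.Periodic (g ∘ ofComplex) (m : ℂ) := by
  intro w
  simp only [Function.comp_apply]
  by_cases hw : 0 < w.im
  · have hwm : 0 < (w + (m : ℂ)).im := by simpa using hw
    rw [ofComplex_apply_of_im_pos hw, ofComplex_apply_of_im_pos hwm, ← h ⟨w, hw⟩]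
    congr 1
    ext
    simp [add_comm]
  · have hwm : (w + (m : ℂ)).im ≤ 0 := by simpa using hw
    rw [ofComplex_apply_of_im_nonpos (not_lt.mp hw), ofComplex_apply_of_im_nonpos hwm]

lemma mdifferentiable_mul_comp_coe {s : ℍ → ℂ} {e : ℂ → ℂ} (hs : MDifferentiable 𝓘(ℂ) 𝓘(ℂ) s)
    (he : Differentiable ℂ e) : MDifferentiable 𝓘(ℂ) 𝓘(ℂ) (fun z : ℍ => s z * e z) := by
  rw [mdifferentiable_iff] at hs ⊢
  refine (hs.mul he.differentiableOn).congr fun w (hw : 0 < w.im) => ?_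
  simp [ofComplex_apply_of_im_pos hw]

lemma isBoundedAtImInfty_of_isZeroAtImInfty_mul_expMode {m : ℝ} (hm : 0 < m) {h : ℍ → ℂ}
    (hholo : MDifferentiable 𝓘(ℂ) 𝓘(ℂ) h) (hper : ∀ z : ℍ, h (m +ᵥ z) = h z)
    (hzero : IsZeroAtImInfty fun z : ℍ => h z * expMode m 0 1 z) : IsBoundedAtImInfty h := by
  have hper_mul : Function.Periodic ((fun z : ℍ => h z * expMode m 0 1 z) ∘ ofComplex) (m : ℂ) := by
    refine periodic_comp_ofComplex fun z => ?_
    rw [hper, coe_vadd, add_comm, expMode_add_period hm.ne', Complex.ofReal_zero, mul_zero,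
      Complex.exp_zero, one_mul]
  obtain ⟨C, hC⟩ := (hzero.exp_decay_atImInfty hm hper_mul
    (mdifferentiable_mul_comp_coe hholo (differentiable_expMode m 0 1))
    hzero.isBoundedAtImInfty).bound
  obtain ⟨A, hA⟩ := (atImInfty_mem _).mp hC
  refine isBoundedAtImInfty_iff.mpr ⟨C, A, fun z hz => ?_⟩
  have hle : ‖h z * expMode m 0 1 z‖ ≤ C * ‖Real.exp (-2 * π * z.im / m)‖ := hA z hz
  have hexp : ‖expMode m 0 1 z‖ = Real.exp (-2 * π * z.im / m) := by
    rw [norm_expMode, coe_im]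
    congr 1
    push_cast
    ring
  rw [norm_mul, hexp, Real.norm_eq_abs, Real.abs_exp] at hle
  exact le_of_mul_le_mul_right hle (Real.exp_pos _)

/-- The function `s (z) e^{-2πiκz/m}`, which has period `m` when `s (z + m) = e^{2πiκ} s (z)`. It
reduces Fourier expansions with a cusp parameter to `q`-expansions. -/
noncomputable def untwist (m κ : ℝ) (s : ℍ → ℂ) (z : ℍ) : ℂ := s z * expMode m κ 0 (-z)

lemma mdifferentiable_untwist {s : ℍ → ℂ} (hs : MDifferentiable 𝓘(ℂ) 𝓘(ℂ) s) (m κ : ℝ) :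
    MDifferentiable 𝓘(ℂ) 𝓘(ℂ) (untwist m κ s) :=
  mdifferentiable_mul_comp_coe hs ((differentiable_expMode m κ 0).comp differentiable_neg)

lemma untwist_mul_expMode (m κ : ℝ) (s : ℍ → ℂ) (z : ℍ) :
    untwist m κ s z * expMode m κ 0 z = s z := by
  rw [untwist, mul_assoc, expMode_neg_mul, mul_one]

lemma untwist_vadd {m κ : ℝ} (hm : m ≠ 0) {s : ℍ → ℂ}
    (hs : ∀ z : ℍ, s (m +ᵥ z) = Complex.exp (2 * π * Complex.I * κ) * s z) (z : ℍ) :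
    untwist m κ s (m +ᵥ z) = untwist m κ s z := by
  have hmode := expMode_add_period hm κ 0 (-(m + z : ℂ))
  rw [neg_add_rev, neg_add_cancel_right, ← neg_add_rev] at hmode
  rw [untwist, untwist, hs, coe_vadd, hmode]
  ring

lemma isZeroAtImInfty_untwist_mul_expMode {m κ : ℝ} (hm : 0 < m) (hκ : κ < 1) {s : ℍ → ℂ}
    (hs : ∃ B C Y : ℝ, ∀ z : ℍ, Y ≤ z.im → ‖s z‖ ≤ C * z.im ^ B) :
    IsZeroAtImInfty fun z : ℍ => untwist m κ s z * expMode m 0 1 z := by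
  obtain ⟨B, C, Y, hle⟩ := hs
  have hnorm (z : ℍ) : ‖untwist m κ s z * expMode m 0 1 z‖ =
      ‖s z‖ * Real.exp (-(2 * π * (1 - κ) / m) * z.im) := by
    rw [untwist, norm_mul, norm_mul, norm_expMode, norm_expMode, mul_assoc, ← Real.exp_add]
    congr 2
    rw [Complex.neg_im, coe_im]
    push_cast
    ring
  have hrate : 0 < 2 * π * (1 - κ) / m := by
    have := sub_pos.mpr hκ
    positivity
  have hlim := (tendsto_rpow_mul_exp_neg_mul_atTop_nhds_zero B _ hrate).const_mul C
  rw [mul_zero] at hlim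
  rw [isZeroAtImInfty_iff]
  intro ε hε
  obtain ⟨A, hA⟩ := eventually_atTop.mp (hlim.eventually (eventually_le_nhds hε))
  refine ⟨max A Y, fun z hz => ?_⟩
  rw [max_le_iff] at hz
  calc _ ≤ C * z.im ^ B * Real.exp (-(2 * π * (1 - κ) / m) * z.im) := by
        rw [hnorm]
        gcongr
        exact hle z hz.2
    _ ≤ ε := by
        rw [mul_assoc]
        exact hA z.im hz.1

lemma coeff_qExpansion_untwist {m : ℕ} (hm : 0 < m) {κ : ℝ} {s : ℍ → ℂ}
    (hs : MDifferentiable 𝓘(ℂ) 𝓘(ℂ) s)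
    (hper : Function.Periodic (untwist m κ s ∘ ofComplex) (m : ℝ))
    (hbdd : IsBoundedAtImInfty (untwist m κ s)) (n : ℕ) :
    (qExpansion m (untwist m κ s)).coeff n = cuspCoeff s m κ n := by
  have hmC : (m : ℂ) ≠ 0 := by exact_mod_cast hm.ne'
  rw [qExpansion_coeff_eq_intervalIntegral (by exact_mod_cast hm) hper
    (mdifferentiable_untwist hs m κ) hbdd n one_pos, cuspCoeff, Complex.ofReal_natCast]
  congr 1
  refine intervalIntegral.integral_congr fun u _ => ?_
  simp only [Complex.ofReal_one, one_mul]
  have hline : (⟨(u : ℂ) + (UpperHalfPlane.I : ℂ), by simp⟩ : ℍ) = u +ᵥ UpperHalfPlane.I := by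
    ext
    simp
  rw [untwist, hline, Function.Periodic.qParam, ← Complex.exp_nat_mul, one_div, ← Complex.exp_neg,
    expMode, mul_comm, mul_assoc, ← Complex.exp_add, coe_vadd, coe_I]
  congr 2
  push_cast
  field_simp
  ring

theorem hasSum_cuspCoeff_mul_expMode {m : ℕ} (hm : 0 < m) {κ : ℝ} (hκ : κ < 1) {s : ℍ → ℂ}
    (hs : MDifferentiable 𝓘(ℂ) 𝓘(ℂ) s)
    (hper : ∀ z : ℍ, s ((m : ℝ) +ᵥ z) = Complex.exp (2 * π * Complex.I * κ) * s z)
    (hle : ∃ B C Y : ℝ, ∀ z : ℍ, Y ≤ z.im → ‖s z‖ ≤ C * z.im ^ B) (z : ℍ) :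
    HasSum (fun n => cuspCoeff s m κ n * expMode m κ n z) (s z) := by
  have hmR : (0 : ℝ) < m := by exact_mod_cast hm
  have hholo := mdifferentiable_untwist hs m κ
  have hvadd := untwist_vadd hmR.ne' hper
  have hbdd := isBoundedAtImInfty_of_isZeroAtImInfty_mul_expMode hmR hholo hvadd
    (isZeroAtImInfty_untwist_mul_expMode hmR hκ hle)
  have hperiodic := periodic_comp_ofComplex hvadd
  have hsum := (hasSum_qExpansion hmR hperiodic hholo hbdd z).mul_right (expMode m κ 0 z)
  rw [untwist_mul_expMode] at hsum
  refine hsum.congr_fun fun n => ?_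
  have hmode : expMode m κ n z = expMode m κ 0 z * Function.Periodic.qParam m z ^ n := by
    have hq : expMode m 0 1 z = Function.Periodic.qParam m z := by
      rw [expMode, Function.Periodic.qParam]
      congr 1
      push_cast
      ring
    rw [← hq, ← expMode_add_nat, zero_add]
  rw [coeff_qExpansion_untwist hm hs hperiodic hbdd, hmode, smul_eq_mul]
  ring

lemma IsModularForm.hasSum_cuspCoeff {Γ : Subgroup SL(2, ℤ)} {r : ℝ} {μ : Γ → Circle} {f : ℍ → ℂ}
    (hf : IsModularForm Γ r μ f) (hΓ : Γ.FiniteIndex) (hr : 0 ≤ r) (hf0 : f ≠ 0) (γ : SL(2, ℤ))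
    (z : ℍ) :
    HasSum (fun n => cuspCoeff (slash r f γ) (width Γ γ) (cuspParam (slash r f γ) (width Γ γ)) n *
      expMode (width Γ γ) (cuspParam (slash r f γ) (width Γ γ)) n z) (slash r f γ z) := by
  obtain ⟨-, hκ, hper⟩ := hf.cuspParam_slash hΓ hf0 γ
  exact hasSum_cuspCoeff_mul_expMode (width_spec Γ hΓ γ).1 hκ (mdifferentiable_slash hf.holo γ) hper
    (hf.exists_norm_slash_le hΓ hr γ) z

/-! ### The Fourier expansion of a modular form -/

/-- The Fourier coefficients of positive frequency, extended by zero. -/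
noncomputable def posCoeff (g : ℍ → ℂ) (m : ℕ) (n : ℕ) : ℂ :=
  if 0 < (n : ℝ) + cuspParam g m then cuspCoeff g m (cuspParam g m) n else 0

/-- The Fourier coefficient of frequency zero, which is zero by convention if the cusp parameter is
positive. -/
noncomputable def constTerm (g : ℍ → ℂ) (m : ℕ) : ℂ :=
  if cuspParam g m = 0 then cuspCoeff g m (cuspParam g m) 0 else 0

lemma im_le_norm_denom_of_im_le_one (γ : SL(2, ℤ)) {z : ℍ} (hz : z.im ≤ 1) :
    z.im ≤ ‖denom γ z‖ := by
  by_cases hc : γ 1 0 = 0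
  · have h11 : γ 1 1 ≠ 0 := right_ne_zero_of_mul_eq_one (apply_zero_zero_mul_apply_one_one hc)
    have hone : (1 : ℝ) ≤ |(γ 1 1 : ℝ)| := by exact_mod_cast Int.one_le_abs h11
    have hnorm : ‖denom γ z‖ = |(γ 1 1 : ℝ)| := by simp [ModularGroup.denom_apply, hc]
    exact hnorm ▸ hz.trans hone
  · exact im_le_norm_denom hc z

lemma alphaZero_pos (Γ : Subgroup SL(2, ℤ)) {r : ℝ} (f : ℍ → ℂ) (hr : 0 < r) :
    0 < alphaZero Γ r f := by
  rw [alphaZero]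
  split_ifs
  exacts [half_pos hr, hr]

namespace IsModularForm

variable {Γ : Subgroup SL(2, ℤ)} {r : ℝ} {μ : Γ → Circle} {f : ℍ → ℂ}

lemma isCuspidalAt_iff (hf : IsModularForm Γ r μ f) (hΓ : Γ.FiniteIndex) (hf0 : f ≠ 0)
    (γ : SL(2, ℤ)) :
    IsCuspidalAt Γ r f γ ↔ constTerm (slash r f γ) (width Γ γ) = 0 := by
  obtain ⟨hκ, -, -⟩ := hf.cuspParam_slash hΓ hf0 γ
  rw [IsCuspidalAt, constTerm]
  split_ifs with h
  · simp [h]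
  · simp [hκ.lt_of_ne' h]

lemma hasSum_posCoeff (hf : IsModularForm Γ r μ f) (hΓ : Γ.FiniteIndex) (hr : 0 ≤ r)
    (hf0 : f ≠ 0) (γ : SL(2, ℤ)) (z : ℍ) :
    HasSum (fun n => posCoeff (slash r f γ) (width Γ γ) n *
      expMode (width Γ γ) (cuspParam (slash r f γ) (width Γ γ)) n z)
      (slash r f γ z - constTerm (slash r f γ) (width Γ γ)) := by
  obtain ⟨hκ, -, -⟩ := hf.cuspParam_slash hΓ hf0 γ
  refine ((hf.hasSum_cuspCoeff hΓ hr hf0 γ z).sub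
    (hasSum_ite_eq 0 (constTerm (slash r f γ) (width Γ γ)))).congr_fun fun n => ?_
  rw [posCoeff, constTerm]
  rcases Nat.eq_zero_or_pos n with rfl | hn
  · rcases hκ.eq_or_lt with h | h
    · simp [← h, expMode]
    · simp [h, h.ne']
  · have hpos : 0 < (n : ℝ) + cuspParam (slash r f γ) (width Γ γ) := by positivity
    simp [hpos, hn.ne']

lemma norm_slash_sub_constTerm_le (hf : IsModularForm Γ r μ f) (hΓ : Γ.FiniteIndex) (hr : 0 ≤ r)
    (hf0 : f ≠ 0) (γ : SL(2, ℤ)) :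
    ∃ C p : ℝ, 0 < C ∧ 0 < p ∧ ∀ z : ℍ, 1 / 2 ≤ z.im →
      ‖slash r f γ z - constTerm (slash r f γ) (width Γ γ)‖ ≤ C * Real.exp (-(p * z.im)) := by
  obtain ⟨hκ, -, -⟩ := hf.cuspParam_slash hΓ hf0 γ
  have hm : (0 : ℝ) < width Γ γ := by exact_mod_cast (width_spec Γ hΓ γ).1
  obtain ⟨δ, hδ0, hδ⟩ := exists_pos_forall_le_add hκ
  obtain ⟨C, hC, hle⟩ := norm_le_exp_of_hasSum hm one_half_pos
    (c := posCoeff (slash r f γ) (width Γ γ))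
    (H := fun z => slash r f γ (ofComplex z) - constTerm (slash r f γ) (width Γ γ))
    (fun n hn => hδ n (not_not.mp fun hneg => hn (if_neg hneg)))
    (fun z hz => by
      rw [ofComplex_apply_of_im_pos hz]
      exact hf.hasSum_posCoeff hΓ hr hf0 γ ⟨z, hz⟩)
  refine ⟨C, 2 * π * δ / width Γ γ, hC, by positivity, fun z hz => ?_⟩
  simpa only [ofComplex_apply, coe_im] using hle z hz

/-- Since `Γ` has finite index, the constants of the individual cusps can be chosen uniformly. -/
lemma exists_invNorm_smul_le (hf : IsModularForm Γ r μ f) (hΓ : Γ.FiniteIndex) {S : Set ℍ}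
    {P : ℍ → ℝ} (hP : ∀ z, 0 ≤ P z)
    (h : ∀ γ : SL(2, ℤ), ∃ C : ℝ, ∀ z ∈ S, invNorm r f (γ • z) ≤ C * P z) :
    ∃ C : ℝ, 0 ≤ C ∧ ∀ (γ : SL(2, ℤ)), ∀ z ∈ S, invNorm r f (γ • z) ≤ C * P z := by
  choose C hC using h
  have hfin : Finite (SL(2, ℤ) ⧸ Γ) := inferInstance
  obtain ⟨B, hB⟩ := (Set.finite_range fun q : SL(2, ℤ) ⧸ Γ => C q.out⁻¹).bddAbove
  refine ⟨max B 0, le_max_right _ _, fun γ z hz => ?_⟩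
  obtain ⟨g, hg⟩ := QuotientGroup.mk_out_eq_mul Γ γ⁻¹
  set σ := (QuotientGroup.mk (s := Γ) γ⁻¹).out
  have hγ : γ = (g : SL(2, ℤ)) * σ⁻¹ := by
    rw [hg]
    group
  rw [hγ, mul_smul, hf.invNorm_smul g.2]
  refine (hC _ z hz).trans (mul_le_mul_of_nonneg_right ?_ (hP z))
  exact (hB ⟨_, rfl⟩).trans (le_max_left _ _)

lemma exists_invNorm_le_of_isCuspForm (hf : IsModularForm Γ r μ f) (hΓ : Γ.FiniteIndex)
    (hr : 0 < r) (hf0 : f ≠ 0) (hcusp : IsCuspForm Γ r f) :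
    ∃ C : ℝ, 0 ≤ C ∧ ∀ z, invNorm r f z ≤ C := by
  obtain ⟨C, hC0, hC⟩ := hf.exists_invNorm_smul_le hΓ (S := {z | 1 / 2 ≤ z.im}) (P := fun _ => 1)
    (fun _ => zero_le_one) fun γ => by
      obtain ⟨C, p, hC, hp, hle⟩ := hf.norm_slash_sub_constTerm_le hΓ hr.le hf0 γ
      rw [(hf.isCuspidalAt_iff hΓ hf0 γ).mp (hcusp γ)] at hle
      refine ⟨C * ((r / 2) / p) ^ (r / 2), fun z hz => ?_⟩
      have hzr : 0 < z.im ^ (r / 2) := Real.rpow_pos_of_pos z.im_pos _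
      calc invNorm r f (γ • z) = ‖slash r f γ z - 0‖ * z.im ^ (r / 2) := by
            rw [sub_zero, norm_slash_mul_im_rpow]
        _ ≤ C * (((r / 2) / p) ^ (r / 2) * z.im ^ (-(r / 2))) * z.im ^ (r / 2) := by
            gcongr
            refine (hle z hz).trans ?_
            gcongr
            exact exp_neg_mul_le_rpow hp (half_pos hr) z.im_pos
        _ = C * ((r / 2) / p) ^ (r / 2) * 1 := by
            rw [Real.rpow_neg z.im_pos.le]
            field_simp
  refine ⟨C, hC0, fun z => ?_⟩
  obtain ⟨γ, hγ⟩ := ModularGroup.exists_one_half_le_im_smul z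
  simpa using hC γ⁻¹ (γ • z) hγ

lemma exists_invNorm_le_rpow_neg (hf : IsModularForm Γ r μ f) (hΓ : Γ.FiniteIndex) (hr : 0 ≤ r)
    (hf0 : f ≠ 0) :
    ∃ C : ℝ, 0 ≤ C ∧ ∀ z : ℍ, z.im ≤ 1 → invNorm r f z ≤ C * z.im ^ (-(r / 2)) := by
  obtain ⟨C, hC0, hC⟩ := hf.exists_invNorm_smul_le hΓ (S := {z | 1 / 2 ≤ z.im})
    (P := fun z => z.im ^ (r / 2)) (fun z => Real.rpow_nonneg z.im_pos.le _) fun γ => by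
      obtain ⟨C, p, hC, hp, hle⟩ := hf.norm_slash_sub_constTerm_le hΓ hr hf0 γ
      refine ⟨C + ‖constTerm (slash r f γ) (width Γ γ)‖, fun z hz => ?_⟩
      rw [← norm_slash_mul_im_rpow]
      have hexp : Real.exp (-(p * z.im)) ≤ 1 :=
        Real.exp_le_one_iff.mpr (neg_nonpos.mpr (mul_pos hp z.im_pos).le)
      gcongr
      calc ‖slash r f γ z‖
          ≤ ‖slash r f γ z - constTerm (slash r f γ) (width Γ γ)‖ +
            ‖constTerm (slash r f γ) (width Γ γ)‖ := norm_le_norm_sub_add _ _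
        _ ≤ C + ‖constTerm (slash r f γ) (width Γ γ)‖ := by
            gcongr
            exact (hle z hz).trans (mul_le_of_le_one_right hC.le hexp)
  refine ⟨C, hC0, fun z hz => ?_⟩
  obtain ⟨γ, hγ⟩ := ModularGroup.exists_one_half_le_im_smul z
  have him := im_smul_le_inv (im_le_norm_denom_of_im_le_one γ hz)
  calc invNorm r f z ≤ C * (γ • z).im ^ (r / 2) := by simpa using hC γ⁻¹ (γ • z) hγ
    _ ≤ C * z.im⁻¹ ^ (r / 2) := by
        gcongr
    _ = C * z.im ^ (-(r / 2)) := by rw [Real.inv_rpow z.im_pos.le, Real.rpow_neg z.im_pos.le]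

lemma exists_norm_le_rpow (hf : IsModularForm Γ r μ f) (hΓ : Γ.FiniteIndex) (hr : 0 < r)
    (hf0 : f ≠ 0) :
    ∃ C : ℝ, 0 ≤ C ∧ ∀ z : ℍ, z.im ≤ 1 → ‖f z‖ ≤ C * z.im ^ (-alphaZero Γ r f) := by
  have hnorm (z : ℍ) : ‖f z‖ = invNorm r f z * z.im ^ (-(r / 2)) := by
    rw [invNorm, mul_assoc, ← Real.rpow_add z.im_pos, add_neg_cancel, Real.rpow_zero, mul_one]
  have hpos (z : ℍ) : 0 ≤ z.im ^ (-(r / 2)) := Real.rpow_nonneg z.im_pos.le _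
  rw [alphaZero]
  split_ifs with hcusp
  · obtain ⟨C, hC0, hC⟩ := hf.exists_invNorm_le_of_isCuspForm hΓ hr hf0 hcusp
    refine ⟨C, hC0, fun z _ => ?_⟩
    rw [hnorm]
    exact mul_le_mul_of_nonneg_right (hC z) (hpos z)
  · obtain ⟨C, hC0, hC⟩ := hf.exists_invNorm_le_rpow_neg hΓ hr.le hf0
    refine ⟨C, hC0, fun z hz => ?_⟩
    calc ‖f z‖ ≤ C * z.im ^ (-(r / 2)) * z.im ^ (-(r / 2)) := by
          rw [hnorm]
          exact mul_le_mul_of_nonneg_right (hC z hz) (hpos z)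
      _ = C * z.im ^ (-r) := by
          rw [mul_assoc, ← Real.rpow_add z.im_pos, ← neg_add, add_halves]

lemma exists_norm_sub_constTerm_le_rpow (hf : IsModularForm Γ r μ f) (hΓ : Γ.FiniteIndex)
    (hr : 0 < r) (hf0 : f ≠ 0) :
    ∃ C : ℝ, 0 < C ∧ ∀ z : ℍ,
      ‖f z - constTerm f (width Γ 1)‖ ≤ C * z.im ^ (-alphaZero Γ r f) := by
  set a := alphaZero Γ r f
  set b := constTerm f (width Γ 1)
  have ha : 0 < a := alphaZero_pos Γ f hr
  obtain ⟨C, hC0, hC⟩ := hf.exists_norm_le_rpow hΓ hr hf0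
  obtain ⟨D, p, hD, hp, hexp⟩ := hf.norm_slash_sub_constTerm_le hΓ hr.le hf0 1
  rw [slash_one] at hexp
  have hpa : 0 < D * (a / p) ^ a := by positivity
  refine ⟨C + ‖b‖ + D * (a / p) ^ a, by positivity, fun z => ?_⟩
  have hza : 0 < z.im ^ (-a) := Real.rpow_pos_of_pos z.im_pos _
  rcases le_total z.im 1 with hz | hz
  · have hone : 1 ≤ z.im ^ (-a) :=
      Real.one_le_rpow_of_pos_of_le_one_of_nonpos z.im_pos hz (neg_nonpos.mpr ha.le)
    calc ‖f z - b‖ ≤ C * z.im ^ (-a) + ‖b‖ * z.im ^ (-a) := by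
          refine (norm_sub_le _ _).trans (add_le_add (hC z hz) ?_)
          exact le_mul_of_one_le_right (norm_nonneg b) hone
      _ = (C + ‖b‖) * z.im ^ (-a) := by ring
      _ ≤ _ := by
          exact mul_le_mul_of_nonneg_right (le_add_of_nonneg_right hpa.le) hza.le
  · calc ‖f z - b‖ ≤ D * ((a / p) ^ a * z.im ^ (-a)) := by
          refine (hexp z (by linarith)).trans ?_
          gcongr
          exact exp_neg_mul_le_rpow hp ha z.im_pos
      _ = D * (a / p) ^ a * z.im ^ (-a) := by ring
      _ ≤ _ := by
          gcongr
          exact le_add_of_nonneg_left (add_nonneg hC0 (norm_nonneg b))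

theorem isFourierExpansion (hf : IsModularForm Γ r μ f) (hΓ : Γ.FiniteIndex) (hr : 0 < r)
    (hf0 : f ≠ 0) :
    IsFourierExpansion (width Γ 1) (cuspParam f (width Γ 1)) (alphaZero Γ r f)
      (posCoeff f (width Γ 1)) (fun z => f (ofComplex z) - constTerm f (width Γ 1)) where
  m_pos := by exact_mod_cast (width_spec Γ hΓ 1).1
  κ_nonneg := by simpa only [slash_one] using (hf.cuspParam_slash hΓ hf0 1).1
  a_pos := alphaZero_pos Γ f hr
  coeff_eq_zero _ hn := if_neg hn
  holo := (UpperHalfPlane.mdifferentiable_iff.mp hf.holo).sub_const _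
  hasSum z hz := by
    rw [ofComplex_apply_of_im_pos hz]
    simpa only [slash_one] using hf.hasSum_posCoeff hΓ hr.le hf0 1 ⟨z, hz⟩
  bound := by
    obtain ⟨C, hC, hle⟩ := hf.exists_norm_sub_constTerm_le_rpow hΓ hr hf0
    refine ⟨C, hC, fun z hz => ?_⟩
    rw [ofComplex_apply_of_im_pos hz]
    exact hle ⟨z, hz⟩

end IsModularForm

/-! ### Boundary behaviour on a dense set -/

lemma tendsto_natCast_affine_div_affine {A B p q b d : ℂ} (hB : B ≠ 0) (hq : q ≠ 0) :
    Tendsto (fun k : ℕ => (p * (A + k * B) + b) / (q * (A + k * B) + d)) atTop (𝓝 (p / q)) := by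
  have hlim (p b : ℂ) :
      Tendsto (fun k : ℕ => p * (A * (1 / (k : ℂ)) + B) + b * (1 / (k : ℂ))) atTop (𝓝 (p * B)) := by
    have hinv := tendsto_one_div_atTop_nhds_zero_nat (𝕜 := ℂ)
    simpa using (((hinv.const_mul A).add_const B).const_mul p).add (hinv.const_mul b)
  have hquot := (hlim p b).div (hlim q d) (mul_ne_zero hq hB)
  rw [mul_div_mul_right _ _ hB] at hquot
  refine hquot.congr' ?_
  filter_upwards [eventually_ne_atTop 0] with k hk
  have hk' : (k : ℂ) ≠ 0 := by exact_mod_cast hk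
  have hscale (p b : ℂ) :
      p * (A + k * B) + b = k * (p * (A * (1 / (k : ℂ)) + B) + b * (1 / (k : ℂ))) := by
    field_simp
  rw [hscale p b, hscale q d, mul_div_mul_left _ _ hk', Pi.div_apply]

lemma exists_apply_zero_zero_div_mem {V : Set ℝ} (hV : IsOpen V) (hne : V.Nonempty) :
    ∃ δ : SL(2, ℤ), δ 1 0 ≠ 0 ∧ (δ 0 0 : ℝ) / δ 1 0 ∈ V := by
  obtain ⟨q, hq⟩ := Rat.denseRange_cast.exists_mem_open hV hne
  obtain ⟨δ, h0, h1⟩ := (Rat.isCoprime_num_den q).exists_SL2_col 0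
  refine ⟨δ, ?_, ?_⟩
  · rw [h1]
    exact_mod_cast q.den_ne_zero
  · rw [Rat.cast_def] at hq
    rw [h0, h1]
    exact_mod_cast hq

lemma coe_SL2_smul (γ : SL(2, ℤ)) (z : ℍ) :
    ((γ • z : ℍ) : ℂ) = ((γ 0 0 : ℂ) * z + γ 0 1) / ((γ 1 0 : ℂ) * z + γ 1 1) := by
  simp [specialLinearGroup_apply]

lemma tendsto_conj_T_pow_smul {M : ℕ} (hM : 0 < M) {δ : SL(2, ℤ)} (hδ : δ 1 0 ≠ 0) (z : ℍ) :
    Tendsto (fun k : ℕ => (((δ * ModularGroup.T ^ (M * k) * δ⁻¹) • z : ℍ) : ℂ)) atTop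
      (𝓝 (((δ 0 0 : ℝ) / δ 1 0 : ℝ) : ℂ)) := by
  have hlim := tendsto_natCast_affine_div_affine (A := (δ⁻¹ • z : ℍ)) (B := M) (p := δ 0 0)
    (q := δ 1 0) (b := δ 0 1) (d := δ 1 1) (by exact_mod_cast hM.ne') (by exact_mod_cast hδ)
  push_cast
  refine hlim.congr fun k => ?_
  rw [mul_smul, mul_smul, coe_SL2_smul δ (_ • _), T_pow_smul, coe_vadd]
  push_cast
  congr 2 <;> ring

lemma exists_smul_re_mem_im_lt {Γ : Subgroup SL(2, ℤ)} (hΓ : Γ.FiniteIndex) (z : ℍ) {V : Set ℝ}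
    (hV : IsOpen V) (hne : V.Nonempty) {η : ℝ} (hη : 0 < η) :
    ∃ g ∈ Γ, (g • z).re ∈ V ∧ (g • z).im < η := by
  obtain ⟨δ, hδ, hδV⟩ := exists_apply_zero_zero_div_mem hV hne
  obtain ⟨M, hM, hT⟩ := exists_forall_conj_T_pow_mem Γ hΓ
  have hlim := tendsto_conj_T_pow_smul hM hδ z
  have hre := ((Complex.continuous_re.tendsto _).comp hlim).eventually (hV.mem_nhds hδV)
  have him := ((Complex.continuous_im.tendsto _).comp hlim).eventually (eventually_lt_nhds hη)
  obtain ⟨k, hk⟩ := (hre.and him).exists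
  exact ⟨_, hT δ k, hk⟩

lemma norm_smul_sub_le_inv_norm_denom {γ : SL(2, ℤ)} (hγ : γ 1 0 ≠ 0) (z : ℍ) :
    ‖((γ • z : ℍ) : ℂ) - (((γ 0 0 : ℝ) / γ 1 0 : ℝ) : ℂ)‖ ≤ ‖denom γ z‖⁻¹ := by
  have hdet : (γ 0 0 : ℂ) * γ 1 1 - γ 0 1 * γ 1 0 = 1 := by
    exact_mod_cast (Matrix.det_fin_two _).symm.trans γ.det_coe
  have hc : (γ 1 0 : ℂ) ≠ 0 := by exact_mod_cast hγ
  have hdenom : denom γ z ≠ 0 := denom_ne_zero _ z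
  have heq : ((γ • z : ℍ) : ℂ) - (((γ 0 0 : ℝ) / γ 1 0 : ℝ) : ℂ) =
      -((γ 1 0 : ℂ) * denom γ z)⁻¹ := by
    rw [coe_SL2_smul, ← ModularGroup.denom_apply]
    push_cast
    field_simp
    linear_combination -(γ 0 0 : ℂ) * ModularGroup.denom_apply γ z - hdet
  have hone : (1 : ℝ) ≤ |(γ 1 0 : ℝ)| := by exact_mod_cast Int.one_le_abs hγ
  rw [heq, norm_neg, norm_inv, norm_mul, Complex.norm_intCast]
  exact inv_anti₀ (norm_denom_pos γ z) (le_mul_of_one_le_left (norm_nonneg _) hone)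

lemma im_smul_of_apply_one_zero_eq_zero {γ : SL(2, ℤ)} (hγ : γ 1 0 = 0) (z : ℍ) :
    (γ • z).im = z.im := by
  have habs : |(γ 1 1 : ℝ)| = 1 := by
    exact_mod_cast Int.isUnit_iff_abs_eq.mp
      (IsUnit.of_mul_eq_one_right _ (apply_zero_zero_mul_apply_one_one hγ))
  rw [im_smul_eq, ModularGroup.denom_apply, hγ, Int.cast_zero, zero_mul, zero_add,
    Complex.norm_intCast, habs, one_pow, div_one]

/-- If `γ ∙ i` is close to the real line, then it is close to the cusp `γ(∞)`; so the density of an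
orbit of cusps follows from that of an orbit of points. -/
lemma exists_mul_apply_zero_zero_div_mem {Γ : Subgroup SL(2, ℤ)} (hΓ : Γ.FiniteIndex)
    (γ : SL(2, ℤ)) {V : Set ℝ} (hV : IsOpen V) (hne : V.Nonempty) :
    ∃ g ∈ Γ, (g * γ) 1 0 ≠ 0 ∧ ((g * γ) 0 0 : ℝ) / (g * γ) 1 0 ∈ V := by
  obtain ⟨x, hx⟩ := hne
  obtain ⟨ρ, hρ, hball⟩ := Metric.isOpen_iff.mp hV x hx
  obtain ⟨g, hg, hre, him⟩ := exists_smul_re_mem_im_lt hΓ (γ • UpperHalfPlane.I)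
    (η := min 1 ((ρ / 2) ^ 2)) Metric.isOpen_ball
    ⟨x, Metric.mem_ball_self (half_pos hρ)⟩ (by positivity)
  rw [← mul_smul] at hre him
  set σ := g * γ
  have hσ : σ 1 0 ≠ 0 := by
    intro h0
    rw [im_smul_of_apply_one_zero_eq_zero h0, I_im] at him
    exact (him.trans_le (min_le_left _ _)).false
  refine ⟨g, hg, hσ, hball ?_⟩
  have hinv : ‖denom σ UpperHalfPlane.I‖⁻¹ < ρ / 2 := by
    refine lt_of_pow_lt_pow_left₀ 2 (by positivity) ?_
    calc ‖denom σ UpperHalfPlane.I‖⁻¹ ^ 2 = (σ • UpperHalfPlane.I).im := by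
          rw [im_smul_eq, I_im, inv_pow, one_div]
      _ < (ρ / 2) ^ 2 := him.trans_le (min_le_right _ _)
  have hdist : dist ((σ 0 0 : ℝ) / σ 1 0) (σ • UpperHalfPlane.I).re < ρ / 2 := by
    rw [dist_comm, Real.dist_eq]
    calc |(σ • UpperHalfPlane.I).re - (σ 0 0 : ℝ) / σ 1 0|
        = |(((σ • UpperHalfPlane.I : ℍ) : ℂ) - (((σ 0 0 : ℝ) / σ 1 0 : ℝ) : ℂ)).re| := by
          rw [Complex.sub_re, coe_re, Complex.ofReal_re]
      _ ≤ _ := Complex.abs_re_le_norm _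
      _ ≤ _ := norm_smul_sub_le_inv_norm_denom hσ _
      _ < ρ / 2 := hinv
  have htri := dist_triangle ((σ 0 0 : ℝ) / σ 1 0) (σ • UpperHalfPlane.I).re x
  rw [Metric.mem_ball] at hre ⊢
  linarith

lemma exists_isOpen_forall_le_of_tendsto {X : Type*} [TopologicalSpace X] [BaireSpace X]
    {F : X → ℝ → ℝ} (hF : ∀ y, 0 < y → Continuous fun x => F x y) {U : Set X} (hU : IsOpen U)
    (hne : U.Nonempty) (hlim : ∀ x ∈ U, Tendsto (F x) (𝓝[>] 0) (𝓝 0)) {ε : ℝ} (hε : 0 < ε) :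
    ∃ V : Set X, IsOpen V ∧ V.Nonempty ∧ ∃ η : ℝ, 0 < η ∧
      ∀ x ∈ V, ∀ y, 0 < y → y < η → F x y ≤ ε := by
  set E : ℕ → Set X := fun n => {x | ∀ y : ℝ, 0 < y → y < 1 / ((n : ℝ) + 1) → F x y ≤ ε} with hE
  have hclosed (n : ℕ) : IsClosed (E n) := by
    simp only [hE, Set.ofPred_forall]
    exact isClosed_iInter fun y => isClosed_iInter fun hy => isClosed_iInter fun _ =>
      isClosed_le (hF y hy) continuous_const
  have hcover : ⋃ n, (E n ∪ Uᶜ) = Set.univ := by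
    refine Set.eq_univ_of_forall fun x => Set.mem_iUnion.mpr ?_
    by_cases hx : x ∈ U
    · obtain ⟨η, hη, hle⟩ := mem_nhdsGT_iff_exists_Ioo_subset.mp
        ((hlim x hx).eventually (eventually_le_nhds hε))
      obtain ⟨n, hn⟩ := exists_nat_one_div_lt (Set.mem_Ioi.mp hη)
      exact ⟨n, Or.inl fun y hy hyn => hle ⟨hy, hyn.trans hn⟩⟩
    · exact ⟨0, Or.inr hx⟩
  obtain ⟨x, hxU, hx⟩ := (dense_iUnion_interior_of_closed
    (fun n => (hclosed n).union hU.isClosed_compl) hcover).inter_open_nonempty U hU hne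
  obtain ⟨n, hxn⟩ := Set.mem_iUnion.mp hx
  refine ⟨U ∩ interior (E n ∪ Uᶜ), hU.inter isOpen_interior, ⟨x, hxU, hxn⟩, 1 / ((n : ℝ) + 1),
    by positivity, fun x' hx' => ?_⟩
  exact (interior_subset hx'.2).resolve_right (not_not.mpr hx'.1)

lemma im_pos_add_mul_I (x : ℝ) {y : ℝ} (hy : 0 < y) : 0 < ((x : ℂ) + y * Complex.I).im := by
  simpa using hy

lemma ofComplex_re_add_im_mul_I (z : ℍ) : ofComplex (z.re + z.im * Complex.I) = z := by
  rw [← coe_re, ← coe_im, Complex.re_add_im, ofComplex_apply]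

lemma im_smul_of_mul_re_add_eq_zero {γ : SL(2, ℤ)} {z : ℍ}
    (h : (γ 1 0 : ℝ) * z.re + γ 1 1 = 0) : (γ • z).im = ((γ 1 0 : ℝ) ^ 2)⁻¹ * z.im⁻¹ := by
  have hdenom : denom γ z = ((γ 1 0 * z.im : ℝ) : ℂ) * Complex.I := by
    rw [ModularGroup.denom_apply]
    apply Complex.ext <;> simp [h]
  rw [im_smul_eq, hdenom, norm_mul, Complex.norm_I, mul_one, Complex.norm_real, Real.norm_eq_abs,
    sq_abs, mul_pow]
  field_simp [z.im_pos.ne']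

lemma im_inv_smul {σ : SL(2, ℤ)} (hσ : σ 1 0 ≠ 0) {z : ℍ} (hz : z.re = (σ 0 0 : ℝ) / σ 1 0) :
    (σ⁻¹ • z).im = ((σ 1 0 : ℝ) ^ 2)⁻¹ * z.im⁻¹ := by
  have hc : (σ 1 0 : ℝ) ≠ 0 := by exact_mod_cast hσ
  have h10 : σ⁻¹ 1 0 = -σ 1 0 := by
    simp [Matrix.SpecialLinearGroup.coe_inv, Matrix.adjugate_fin_two]
  have h11 : σ⁻¹ 1 1 = σ 0 0 := by
    simp [Matrix.SpecialLinearGroup.coe_inv, Matrix.adjugate_fin_two]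
  rw [im_smul_of_mul_re_add_eq_zero, h10, Int.cast_neg, neg_sq]
  rw [h10, h11, Int.cast_neg, hz, neg_mul, mul_div_cancel₀ _ hc, neg_add_cancel]

lemma tendsto_rpow_mul_norm_at_cusp {r : ℝ} {f : ℍ → ℂ} {σ : SL(2, ℤ)} (hσ : σ 1 0 ≠ 0) {L : ℝ}
    (h : Tendsto (fun z => ‖slash r f σ z‖) atImInfty (𝓝 L)) :
    Tendsto (fun y : ℝ => y ^ r * ‖f (ofComplex (((σ 0 0 : ℝ) / σ 1 0 : ℝ) + y * Complex.I))‖)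
      (𝓝[>] 0) (𝓝 (L * ((σ 1 0 : ℝ) ^ 2)⁻¹ ^ (r / 2))) := by
  have hc : (σ 1 0 : ℝ) ≠ 0 := by exact_mod_cast hσ
  set x : ℝ := (σ 0 0 : ℝ) / σ 1 0
  set z : ℝ → ℍ := fun y => ofComplex (x + y * Complex.I) with hz
  have hzre {y : ℝ} (hy : 0 < y) : (z y).re = x := by
    simp [hz, ofComplex_apply_of_im_pos (im_pos_add_mul_I x hy), ← coe_re]
  have hzim {y : ℝ} (hy : 0 < y) : (z y).im = y := by
    simp [hz, ofComplex_apply_of_im_pos (im_pos_add_mul_I x hy), ← coe_im]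
  have him {y : ℝ} (hy : 0 < y) : (σ⁻¹ • z y).im = ((σ 1 0 : ℝ) ^ 2)⁻¹ * y⁻¹ := by
    rw [im_inv_smul hσ (hzre hy), hzim hy]
  have hcusp : Tendsto (fun y => σ⁻¹ • z y) (𝓝[>] 0) atImInfty := by
    rw [atImInfty, tendsto_comap_iff]
    refine (tendsto_inv_nhdsGT_zero.const_mul_atTop
      (show 0 < ((σ 1 0 : ℝ) ^ 2)⁻¹ by positivity)).congr' ?_
    filter_upwards [self_mem_nhdsWithin] with y hy
    exact (him hy).symm
  refine ((h.comp hcusp).mul_const _).congr' ?_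
  filter_upwards [self_mem_nhdsWithin] with y (hy : 0 < y)
  have hslash := norm_slash_mul_im_rpow r f σ (σ⁻¹ • z y)
  rw [smul_inv_smul, invNorm, hzim hy, him hy] at hslash
  have hsplit : ((σ 1 0 : ℝ) ^ 2)⁻¹ ^ (r / 2) =
      (((σ 1 0 : ℝ) ^ 2)⁻¹ * y⁻¹) ^ (r / 2) * y ^ (r / 2) := by
    rw [← Real.mul_rpow (by positivity) hy.le, inv_mul_cancel_right₀ hy.ne']
  rw [Function.comp_apply, hsplit, ← mul_assoc, hslash, mul_assoc, ← Real.rpow_add hy, add_halves,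
    mul_comm]

namespace IsModularForm

variable {Γ : Subgroup SL(2, ℤ)} {r : ℝ} {μ : Γ → Circle} {f : ℍ → ℂ}

lemma continuous_rpow_mul_norm (hf : IsModularForm Γ r μ f) {y : ℝ} (hy : 0 < y) :
    Continuous fun x : ℝ => y ^ (r / 2) * ‖f (ofComplex (x + y * Complex.I))‖ := by
  have hline : Continuous fun x : ℝ => (f ∘ ofComplex) (x + y * Complex.I) :=
    (UpperHalfPlane.mdifferentiable_iff.mp hf.holo).continuousOn.comp_continuous (by fun_prop)
      fun x => im_pos_add_mul_I x hy
  exact continuous_const.mul hline.norm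

/-- The points of one `Γ`-orbit accumulate at every real number, and `invNorm r f` is constant on
the orbit. -/
lemma dense_not_tendsto_half (hf : IsModularForm Γ r μ f) (hΓ : Γ.FiniteIndex) (hf0 : f ≠ 0) :
    Dense {x : ℝ | ¬ Tendsto (fun y : ℝ => y ^ (r / 2) * ‖f (ofComplex (x + y * Complex.I))‖)
      (𝓝[>] 0) (𝓝 0)} := by
  obtain ⟨z₀, hz₀⟩ := Function.ne_iff.mp hf0
  have hpos : 0 < invNorm r f z₀ :=
    mul_pos (norm_pos_iff.mpr hz₀) (Real.rpow_pos_of_pos z₀.im_pos _)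
  rw [dense_iff_inter_open]
  intro U hU hne
  by_contra hcon
  have hlim : ∀ x ∈ U, Tendsto (fun y : ℝ => y ^ (r / 2) * ‖f (ofComplex (x + y * Complex.I))‖)
      (𝓝[>] 0) (𝓝 0) := fun x hx => by_contra fun hx' => hcon ⟨x, hx, hx'⟩
  obtain ⟨V, hV, hVne, η, hη, hle⟩ := exists_isOpen_forall_le_of_tendsto
    (fun y hy => hf.continuous_rpow_mul_norm hy) hU hne hlim (half_pos hpos)
  obtain ⟨g, hg, hre, him⟩ := exists_smul_re_mem_im_lt hΓ z₀ hV hVne hη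
  have hsmall := hle _ hre _ (g • z₀).im_pos him
  rw [ofComplex_re_add_im_mul_I, mul_comm, ← invNorm, hf.invNorm_smul hg] at hsmall
  linarith

lemma tendsto_norm_slash (hf : IsModularForm Γ r μ f) (hΓ : Γ.FiniteIndex) (hr : 0 ≤ r)
    (hf0 : f ≠ 0) (γ : SL(2, ℤ)) :
    Tendsto (fun z => ‖slash r f γ z‖) atImInfty
      (𝓝 ‖constTerm (slash r f γ) (width Γ γ)‖) := by
  obtain ⟨C, p, -, hp, hle⟩ := hf.norm_slash_sub_constTerm_le hΓ hr hf0 γ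
  refine Tendsto.norm ?_
  rw [tendsto_iff_norm_sub_tendsto_zero]
  have hexp : Tendsto (fun t : ℝ => C * Real.exp (-(p * t))) atTop (𝓝 0) := by
    simpa using (Real.tendsto_exp_neg_atTop_nhds_zero.comp
      (tendsto_id.const_mul_atTop hp)).const_mul C
  exact squeeze_zero' (Eventually.of_forall fun _ => norm_nonneg _)
    ((atImInfty_mem _).mpr ⟨1 / 2, hle⟩) (hexp.comp tendsto_comap)

lemma dense_not_tendsto_of_not_isCuspForm (hf : IsModularForm Γ r μ f) (hΓ : Γ.FiniteIndex)
    (hr : 0 ≤ r) (hf0 : f ≠ 0) (hcusp : ¬ IsCuspForm Γ r f) :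
    Dense {x : ℝ | ¬ Tendsto (fun y : ℝ => y ^ r * ‖f (ofComplex (x + y * Complex.I))‖)
      (𝓝[>] 0) (𝓝 0)} := by
  obtain ⟨γ, hγ⟩ := not_forall.mp hcusp
  rw [hf.isCuspidalAt_iff hΓ hf0] at hγ
  rw [dense_iff_inter_open]
  intro U hU hne
  obtain ⟨g, hg, hσ, hσU⟩ := exists_mul_apply_zero_zero_div_mem hΓ γ hU hne
  refine ⟨_, hσU, fun hzero => ?_⟩
  have hlim := hf.tendsto_norm_slash hΓ hr hf0 γ
  simp only [← hf.norm_slash_mul_left hg γ] at hlim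
  have hc : ((g * γ) 1 0 : ℝ) ≠ 0 := by exact_mod_cast hσ
  have hpos : 0 < ‖constTerm (slash r f γ) (width Γ γ)‖ *
      (((g * γ) 1 0 : ℝ) ^ 2)⁻¹ ^ (r / 2) := by positivity
  exact hpos.ne (tendsto_nhds_unique hzero (tendsto_rpow_mul_norm_at_cusp hσ hlim))

theorem dense_not_tendsto (hf : IsModularForm Γ r μ f) (hΓ : Γ.FiniteIndex) (hr : 0 ≤ r)
    (hf0 : f ≠ 0) :
    Dense {x : ℝ | ¬ Tendsto
      (fun y : ℝ => y ^ alphaZero Γ r f * ‖f (ofComplex (x + y * Complex.I))‖)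
      (𝓝[>] 0) (𝓝 0)} := by
  rw [alphaZero]
  split_ifs with hcusp
  · exact hf.dense_not_tendsto_half hΓ hf0
  · exact hf.dense_not_tendsto_of_not_isCuspForm hΓ hr hf0 hcusp

end IsModularForm

/-! ### The fractional integral of a modular form -/

lemma fracSum_eq_fracPartial (Γ : Subgroup SL(2, ℤ)) (f : ℍ → ℂ) (α : ℝ) :
    fracSum Γ f α =
      fracPartial (width Γ 1) (cuspParam f (width Γ 1)) α (posCoeff f (width Γ 1)) := by
  ext N x
  refine Finset.sum_congr rfl fun n _ => ?_
  simp only [fracTerm, posCoeff]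
  split_ifs with hn
  · simp [expMode]
  · simp

lemma tendsto_rpow_mul_norm_of_sub_const {E : Type*} [SeminormedAddCommGroup E] {g : ℝ → E}
    {b : E} {β a : ℝ} (hβ : 0 < β) (hβa : β ≤ a)
    (h : Tendsto (fun y : ℝ => y ^ β * ‖g y - b‖) (𝓝[>] 0) (𝓝 0)) :
    Tendsto (fun y : ℝ => y ^ a * ‖g y‖) (𝓝[>] 0) (𝓝 0) := by
  have hpow : Tendsto (fun y : ℝ => y ^ β) (𝓝[>] 0) (𝓝 0) := by
    simpa only [Real.zero_rpow hβ.ne'] using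
      (Real.continuousAt_rpow_const 0 β (Or.inr hβ.le)).tendsto.mono_left nhdsWithin_le_nhds
  have hsum : Tendsto (fun y : ℝ => y ^ β * ‖g y - b‖ + y ^ β * ‖b‖) (𝓝[>] 0) (𝓝 0) := by
    simpa only [zero_mul, add_zero] using h.add (hpow.mul_const ‖b‖)
  refine squeeze_zero' ?_ ?_ hsum
  · filter_upwards [self_mem_nhdsWithin] with y (hy : 0 < y)
    positivity
  · filter_upwards [Ioo_mem_nhdsGT (zero_lt_one' ℝ)] with y hy
    rw [← mul_add]
    exact mul_le_mul (Real.rpow_le_rpow_of_exponent_ge hy.1 hy.2.le hβa)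
      (norm_le_norm_sub_add _ _) (norm_nonneg _) (Real.rpow_nonneg hy.1.le _)

lemma MemCk.differentiableAt {E : Type*} [NormedAddCommGroup E] [NormedSpace ℝ E] {k : ℕ} {s : ℝ}
    {g : ℝ → E} {Ω : Set ℝ} (h : MemCk k s g Ω) (hk : 0 < k) {x : ℝ} (hx : x ∈ Ω) :
    DifferentiableAt ℝ g x := by
  simpa only [iteratedDeriv_zero] using h.2.1 0 hk x hx

namespace IsModularForm

variable {Γ : Subgroup SL(2, ℤ)} {r : ℝ} {μ : Γ → Circle} {f : ℍ → ℂ} {α : ℝ}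

lemma fracInt_eq_fracLimit (hf : IsModularForm Γ r μ f) (hΓ : Γ.FiniteIndex) (hr : 0 < r)
    (hf0 : f ≠ 0) (hα : alphaZero Γ r f < α) :
    fracInt Γ f α =
      fracLimit (width Γ 1) α (fun z => f (ofComplex z) - constTerm f (width Γ 1)) := by
  ext x
  rw [fracInt, fracSum_eq_fracPartial]
  exact ((hf.isFourierExpansion hΓ hr hf0).tendstoUniformly_fracPartial hα).tendsto_at x
    |>.limUnder_eq

theorem dense_not_exists_tendsto_fracSum (hf : IsModularForm Γ r μ f) (hΓ : Γ.FiniteIndex)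
    (hr : 0 < r) (hf0 : f ≠ 0) (hα : 0 < α) (hle : α ≤ alphaZero Γ r f) :
    Dense {x : ℝ | ¬ ∃ l : ℂ, Tendsto (fun N : ℕ => fracSum Γ f α N x) atTop (𝓝 l)} := by
  refine (hf.dense_not_tendsto hΓ hr.le hf0).mono fun x hx => ?_
  rintro ⟨l, hl⟩
  rw [fracSum_eq_fracPartial] at hl
  exact hx (tendsto_rpow_mul_norm_of_sub_const hα hle
    ((hf.isFourierExpansion hΓ hr hf0).tendsto_rpow_mul_norm_of_tendsto_fracPartial hα hl))

theorem dense_not_differentiableAt (hf : IsModularForm Γ r μ f) (hΓ : Γ.FiniteIndex)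
    (hr : 0 < r) (hf0 : f ≠ 0) (hα : alphaZero Γ r f < α) (hα1 : α ≤ alphaZero Γ r f + 1) :
    Dense {x : ℝ | ∀ p q : ℂ, p ≠ 0 → ¬ DifferentiableAt ℝ
      (fun u => p * fracInt Γ f α u + q * (starRingEnd ℂ) (fracInt Γ f α u)) x} := by
  refine (hf.dense_not_tendsto hΓ hr.le hf0).mono fun x hx => ?_
  intro p q hp hd
  rw [hf.fracInt_eq_fracLimit hΓ hr hf0 hα] at hd
  exact hx (tendsto_rpow_mul_norm_of_sub_const (alphaZero_pos Γ f hr) le_rfl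
    ((hf.isFourierExpansion hΓ hr hf0).tendsto_rpow_mul_norm_of_differentiableAt hα hα1 hp hd))

theorem not_memCk_fracInt (hf : IsModularForm Γ r μ f) (hΓ : Γ.FiniteIndex) (hr : 0 < r)
    (hf0 : f ≠ 0) (hα : alphaZero Γ r f < α) (hα1 : α ≤ alphaZero Γ r f + 1) {k : ℕ} (hk : 0 < k)
    (s : ℝ) {I : Set ℝ} (hI : IsOpen I) (hne : I.Nonempty) :
    ¬ MemCk k s (fracInt Γ f α) I ∧ ¬ MemCk k s (fun x => (fracInt Γ f α x).re) I ∧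
      ¬ MemCk k s (fun x => (fracInt Γ f α x).im) I := by
  obtain ⟨x, hxI, hx⟩ :=
    (hf.dense_not_differentiableAt hΓ hr hf0 hα hα1).inter_open_nonempty I hI hne
  refine ⟨fun h => hx 1 0 one_ne_zero ?_, fun h => hx (1 / 2) (1 / 2) (by norm_num) ?_,
    fun h => hx (1 / (2 * Complex.I)) (-(1 / (2 * Complex.I))) (by simp) ?_⟩
  · simpa only [one_mul, zero_mul, add_zero] using h.differentiableAt hk hxI
  · refine (h.differentiableAt hk hxI).hasDerivAt.ofReal_comp.differentiableAt
      |>.congr_of_eventuallyEq (.of_forall fun u => ?_)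
    simp only [Complex.re_eq_add_conj]
    ring
  · refine (h.differentiableAt hk hxI).hasDerivAt.ofReal_comp.differentiableAt
      |>.congr_of_eventuallyEq (.of_forall fun u => ?_)
    simp only [Complex.im_eq_sub_conj]
    ring

end IsModularForm

end FracInt

theorem theorem2p1_general (Γ : Subgroup SL(2, ℤ)) (hΓ : Γ.FiniteIndex) (r : ℝ) (hr : 0 < r)
    (μ : Γ → Circle) (f : ℍ → ℂ) (hf : FracInt.IsModularForm Γ r μ f) (hf0 : f ≠ 0)
    (α : ℝ) (hα : 0 < α) :
    (α ≤ FracInt.alphaZero Γ r f →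
      Dense {x : ℝ | ¬ ∃ l : ℂ, Tendsto (fun N : ℕ => FracInt.fracSum Γ f α N x) atTop (𝓝 l)}) ∧
    (FracInt.alphaZero Γ r f < α →
      TendstoUniformly (FracInt.fracSum Γ f α) (FracInt.fracInt Γ f α) atTop ∧
      Continuous (FracInt.fracInt Γ f α) ∧
      ((∀ j : ℤ, α - FracInt.alphaZero Γ r f ≠ j) →
        FracInt.MemCk ⌊α - FracInt.alphaZero Γ r f⌋₊ (Int.fract (α - FracInt.alphaZero Γ r f))
          (FracInt.fracInt Γ f α) Set.univ) ∧
      (∀ k : ℕ, α - FracInt.alphaZero Γ r f = (k : ℝ) + 1 →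
        FracInt.MemCkLog k 1 (FracInt.fracInt Γ f α) Set.univ)) ∧
    (0 < α - FracInt.alphaZero Γ r f → α - FracInt.alphaZero Γ r f ≤ 1 →
      ∀ I : Set ℝ, IsOpen I → I.Nonempty →
        ¬ FracInt.MemCk 1 0 (FracInt.fracInt Γ f α) I ∧
        ¬ FracInt.MemCk 1 0 (fun x => (FracInt.fracInt Γ f α x).re) I ∧
        ¬ FracInt.MemCk 1 0 (fun x => (FracInt.fracInt Γ f α x).im) I) := by
  have h := hf.isFourierExpansion hΓ hr hf0
  refine ⟨hf.dense_not_exists_tendsto_fracSum hΓ hr hf0 hα, fun hα0 => ?_,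
    fun hpos hle I hI hne => hf.not_memCk_fracInt hΓ hr hf0 (sub_pos.mp hpos)
      (sub_le_iff_le_add'.mp hle) one_pos 0 hI hne⟩
  rw [hf.fracInt_eq_fracLimit hΓ hr hf0 hα0, FracInt.fracSum_eq_fracPartial]
  exact ⟨h.tendstoUniformly_fracPartial hα0, h.continuous_fracLimit hα0, h.memCk_fracLimit hα0,
    fun _ => h.memCkLog_fracLimit⟩

theorem theorem2p1 (Γ : Subgroup SL(2, ℤ)) (hΓ : Γ.FiniteIndex) (r : ℝ) (hr : 0 < r)
    (μ : Γ → Circle) (f : ℍ → ℂ) (hf : FracInt.IsModularForm Γ r μ f) (hf0 : f ≠ 0)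
    (hκ : ∀ γ : SL(2, ℤ), ∃ q : ℚ,
      FracInt.cuspParam (FracInt.slash r f γ) (FracInt.width Γ γ) = (q : ℝ))
    (α : ℝ) (hα : 0 < α) :
    -- divergence on a dense set
    (α ≤ FracInt.alphaZero Γ r f →
      Dense {x : ℝ | ¬ ∃ l : ℂ, Tendsto (fun N : ℕ => FracInt.fracSum Γ f α N x) atTop (𝓝 l)}) ∧
    -- uniform convergence and global regularity
    (FracInt.alphaZero Γ r f < α →
      TendstoUniformly (FracInt.fracSum Γ f α) (FracInt.fracInt Γ f α) atTop ∧
      Continuous (FracInt.fracInt Γ f α) ∧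
      ((∀ j : ℤ, α - FracInt.alphaZero Γ r f ≠ j) →
        FracInt.MemCk ⌊α - FracInt.alphaZero Γ r f⌋₊ (Int.fract (α - FracInt.alphaZero Γ r f))
          (FracInt.fracInt Γ f α) Set.univ) ∧
      (∀ k : ℕ, α - FracInt.alphaZero Γ r f = (k : ℝ) + 1 →
        FracInt.MemCkLog k 1 (FracInt.fracInt Γ f α) Set.univ)) ∧
    -- failure of continuous differentiability on every open interval
    (0 < α - FracInt.alphaZero Γ r f → α - FracInt.alphaZero Γ r f ≤ 1 →
      ∀ I : Set ℝ, IsOpen I → I.OrdConnected → I.Nonempty →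
        ¬ FracInt.MemCk 1 0 (FracInt.fracInt Γ f α) I ∧
        ¬ FracInt.MemCk 1 0 (fun x => (FracInt.fracInt Γ f α x).re) I ∧
        ¬ FracInt.MemCk 1 0 (fun x => (FracInt.fracInt Γ f α x).im) I) := by
  obtain ⟨hdiv, hreg, hnot⟩ := theorem2p1_general Γ hΓ r hr μ f hf hf0 α hα
  exact ⟨hdiv, hreg, fun hpos hle I hI _ hne => hnot hpos hle I hI hne⟩
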